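/- Let $\mathbb F$ be a non-Archimedean local field with ring of integers $\mathcal O$, maximal ideal $\mathfrak p$, residue field $\kappa$ of **odd** cardinality $q$, normalised valuation $\mathrm{val}$ and a fixed uniformizer $\varpi$. Let $n\ge 2$ be an integer with $n\mid q-1$, and put $\underline n=n$ if $n$ is odd and $\underline n=n/2$ if $n$ is even. Let $\mu_n$ be the group of $n$-th roots of unity of $\mathbb F$, identified by reduction with the $n$-th roots of unity of $\kappa$, and let $$(a,b)_n=\overline{c}^{\,(q-1)/n},\qquad c=(-1)^{\mathrm{val}(a)\mathrm{val}(b)}\,a^{\mathrm{val}(b)}/b^{\mathrm{val}(a)}\in\mathcal O^\times,$$ be the $n$-th Hilbert symbol; write $\overline\varpi(a)=(\varpi,a)_n$. *The covering group.* Let $G^1=\mathrm{SL}_2(\mathbb F)$ and $K^1=\mathrm{SL}_2(\mathcal O)$; let $T^1=\{\mathrm{dg}(t)=\mathrm{diag}(t,t^{-1})\}$, $B^1$ and $N^1$ be the diagonal torus, the upper triangular Borel subgroup and its unipotent radical. For $g\in G^1$ with lower row $(c,d)$ let $X(g)=c$ if $c\neq0$ and $X(g)=d$ if $c=0$. Let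 $\widetilde G^1=G^1\times\mu_n$ with $(g_1,\zeta_1)(g_2,\zeta_2)=(g_1g_2,\beta(g_1,g_2)\zeta_1\zeta_2)$, where $\beta(g_1,g_2)=\left(\frac{X(g_1g_2)}{X(g_1)},\frac{X(g_1g_2)}{X(g_2)}\right)_n$ is Kubota's cocycle, and let $\widetilde{T^1},\widetilde{B^1},\widetilde{K^1}$ be the inverse images of $T^1,B^1,K^1$. For $j\ge1$ the group $K^1_j=\{g\in K^1: g\equiv 1 \bmod \mathfrak p^j\}$ is identified with the subgroup $K^1_j\times\{1\}$ of $\widetilde G^1$; these subgroups form a basis of neighbourhoods of the identity of $\widetilde G^1$. One has $\widetilde{B^1}=\widetilde{T^1}\ltimes N^1$ with $N^1$ identified with $N^1\times\{1\}$. $\mathrm{Ind}$ denotes smooth non-normalised induction; all representations are complex. *The data.* Fix a faithful character $\epsilon:\mu_n\to\mathbb C^\times$. Let $\rho$ be a smooth irreducible representation of $\widetilde{T^1}$ on which $\mu_n$ acts by $\epsilon$, with central character $\chi:Z(\widetilde{T^1})\to\mathbb C^\times$, extended trivially over $N^1$ to $\widetilde{B^1}$. Let $A=C_{\widetilde{T^1}}(\widetilde{T^1}\cap\widetilde{K^1})$,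 which consists of the $(\mathrm{dg}(a\varpi^{r\underline n}),\zeta)$ with $a\in\mathcal O^\times$, $r\in\mathbb Z$, $\zeta\in\mu_n$, and let $\chi_0$ be a character of $A$ extending $\chi$. For $0\le i<\underline n$ let $\chi_i$ be the character $$\chi_i(\mathrm{dg}(a\varpi^{r\underline n}),\zeta)=\chi_0(\mathrm{dg}(a\varpi^{r\underline n}),\overline\varpi(a)^{2i}\zeta)$$ of $A$, and also its restriction to $\widetilde{T^1}\cap\widetilde{K^1}$, extended trivially over $N^1\cap K^1$ to $\widetilde{B^1}\cap\widetilde{K^1}$. Let $m\ge1$ be such that $\chi$ is primitive mod $m$, i.e. $m$ is the smallest positive integer for which $\chi$ is trivial on $Z(\widetilde{T^1})\cap K^1_m$. Put $$V_i=\mathrm{Ind}_{\widetilde{B^1}\cap\widetilde{K^1}}^{\widetilde{K^1}}\chi_i,\qquad \widetilde W_{i,l}=V_i^{K^1_l}/V_i^{K^1_{l-1}}\quad(l>m).$$ **Theorem.** For all $0\le i<\underline n$ and $l>m$ the representation $\widetilde W_{i,l}$ of $\widetilde{K^1}$ is the direct sum $\widetilde W^+_{i,l}\oplus\widetilde W^-_{i,l}$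 of two irreducible subrepresentations, and $$\mathrm{Res}_{\widetilde{K^1}}\mathrm{Ind}_{\widetilde{B^1}}^{\widetilde G^1}\rho\;\cong\;\bigoplus_{i=0}^{\underline n-1}\Big(V_i^{K^1_m}\oplus\bigoplus_{l>m}\big(\widetilde W^+_{i,l}\oplus\widetilde W^-_{i,l}\big)\Big).$$ For $0\le i<\underline n$ let $(E_i)$ be the condition that $\chi_0(\mathrm{dg}(s),1)=\epsilon(\overline\varpi(s)^{-2i})$ for all $s\in(\mathcal O^{\times})^2$. If it is not the case that $m=1$ and $(E_i)$ holds for some $0\le i<\underline n$, then all $V_i^{K^1_m}$, $0\le i<\underline n$, are irreducible. If $m=1$ and $(E_i)$ holds for some $0\le i<\underline n$, then: 1. If $4\nmid n$, there is exactly one $0\le i<\underline n$ for which $(E_i)$ holds; for it $V_i^{K^1_1}$ is the direct sum of two irreducible subrepresentations, and all other $V_j^{K^1_1}$ are irreducible. 2. If $4\mid n$, there are exactly two $0\le i,k<\underline n$ for which $(E_i)$, $(E_k)$ hold, and $|i-k|=n/4$; for them $V_i^{K^1_1}$ and $V_k^{K^1_1}$ are each the direct sum of two irreducible subrepresentations,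 and all other $V_j^{K^1_1}$ are irreducible. -/

import Mathlib

open ValuativeRel

namespace KTypes

noncomputable section

set_option linter.unusedSimpArgs false
set_option linter.unusedSectionVars false
set_option linter.unusedTactic false
set_option linter.unnecessarySeqFocus false

/-! ### The valuation and the Hilbert symbol -/

section Hilbert

variable {F : Type*} [Field F] [ValuativeRel F] [TopologicalSpace F] [IsNonarchimedeanLocalField F]

/-- The normalised valuation `val : Fˣ → ℤ`; a uniformizer is an `ϖ` with `val ϖ = 1`. -/
def val (x : Fˣ) : ℤ :=
  -WithZero.log (IsNonarchimedeanLocalField.valueGroupWithZeroIsoInt F (valuation F (x : F)))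

theorem vgz_ne_zero (x : Fˣ) :
    IsNonarchimedeanLocalField.valueGroupWithZeroIsoInt F (valuation F (x : F)) ≠ 0 := by
  simp

theorem val_mul (x y : Fˣ) : val (x * y) = val x + val y := by
  unfold val
  rw [Units.val_mul, map_mul, map_mul, WithZero.log_mul (vgz_ne_zero x) (vgz_ne_zero y)]
  ring

theorem val_one : val (1 : Fˣ) = 0 := by
  simp [val]

theorem val_inv (x : Fˣ) : val x⁻¹ = -val x := by
  have h := val_mul x x⁻¹
  rw [mul_inv_cancel, val_one] at h
  linarith

theorem val_div (x y : Fˣ) : val (x / y) = val x - val y := by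
  rw [div_eq_mul_inv, val_mul, val_inv]; ring

theorem val_zpow (x : Fˣ) (k : ℤ) : val (x ^ k) = k * val x := by
  unfold val
  rw [Units.val_zpow_eq_zpow_val, map_zpow₀, map_zpow₀, WithZero.log_zpow]
  simp

theorem val_nonneg_iff (x : Fˣ) : 0 ≤ val x ↔ valuation F (x : F) ≤ 1 := by
  unfold val
  rw [Left.nonneg_neg_iff, ← WithZero.log_one, WithZero.log_le_log (vgz_ne_zero x) one_ne_zero]
  rw [← map_one (IsNonarchimedeanLocalField.valueGroupWithZeroIsoInt F),
    (IsNonarchimedeanLocalField.valueGroupWithZeroIsoInt F).strictMono.le_iff_le]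

theorem val_pos_iff (x : Fˣ) : 0 < val x ↔ valuation F (x : F) < 1 := by
  unfold val
  rw [Left.neg_pos_iff, ← WithZero.log_one, WithZero.log_lt_log (vgz_ne_zero x) one_ne_zero]
  rw [← map_one (IsNonarchimedeanLocalField.valueGroupWithZeroIsoInt F),
    (IsNonarchimedeanLocalField.valueGroupWithZeroIsoInt F).strictMono.lt_iff_lt]

theorem val_eq_zero_iff (x : Fˣ) : val x = 0 ↔ valuation F (x : F) = 1 := by
  constructor
  · intro h
    refine le_antisymm ((val_nonneg_iff x).1 h.ge) ?_
    by_contra hlt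
    have := (val_pos_iff x).2 (not_le.1 hlt)
    omega
  · intro h
    refine le_antisymm ?_ ((val_nonneg_iff x).2 h.le)
    by_contra hlt
    have := (val_pos_iff x).1 (not_le.1 hlt)
    exact absurd h this.ne

variable (F) in
/-- The units `𝒪ˣ`, as a subgroup of `Fˣ`. -/
def integerUnits : Subgroup Fˣ where
  carrier := {u | val u = 0}
  one_mem' := val_one
  mul_mem' {a b} ha hb := by
    simp only [Set.mem_ofPred_eq] at *
    rw [val_mul, ha, hb, add_zero]
  inv_mem' {a} ha := by
    simp only [Set.mem_ofPred_eq] at *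
    rw [val_inv, ha, neg_zero]

theorem mem_integerUnits {u : Fˣ} : u ∈ integerUnits F ↔ val u = 0 := Iff.rfl

variable (F) in
/-- Reduction `𝒪ˣ → κˣ`. -/
def red : integerUnits F →* 𝓀[F]ˣ :=
  (Units.map (IsLocalRing.residue 𝒪[F]).toMonoidHom).comp
    { toFun := fun u =>
        { val := ⟨(u : Fˣ), ((val_eq_zero_iff _).1 u.2).le⟩
          inv := ⟨((u : Fˣ)⁻¹ : Fˣ), ((val_eq_zero_iff _).1 (u⁻¹).2).le⟩
          val_inv := Subtype.ext (by simp)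
          inv_val := Subtype.ext (by simp) }
      map_one' := by ext; simp
      map_mul' := fun x y => by ext; simp }

theorem red_val (u : integerUnits F) :
    ((red F u : 𝓀[F]ˣ) : 𝓀[F]) =
      IsLocalRing.residue 𝒪[F] ⟨(u : Fˣ), ((val_eq_zero_iff _).1 u.2).le⟩ := rfl

/-- Two units with the same class modulo `𝔭` have the same reduction. -/
theorem red_eq_of_sub_lt (u v : integerUnits F)
    (h : valuation F (((u : Fˣ) : F) - ((v : Fˣ) : F)) < 1) : red F u = red F v := by
  ext
  rw [red_val, red_val, ← sub_eq_zero, ← map_sub, IsLocalRing.residue_eq_zero_iff,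
    IsLocalRing.mem_maximalIdeal, mem_nonunits_iff, Valuation.Integer.not_isUnit_iff_valuation_lt_one]
  exact h

/-- The element `(-1)^{val a val b} a^{val b} / b^{val a}` of `𝒪ˣ`. -/
def tameElt (a b : Fˣ) : integerUnits F :=
  ⟨(-1) ^ (val a * val b) * (a ^ val b / b ^ val a), by
    have h1 : val (-1 : Fˣ) = 0 := by
      have h := val_mul (-1 : Fˣ) (-1)
      rw [neg_one_mul, neg_neg, val_one] at h
      omega
    rw [mem_integerUnits, val_mul, val_div, val_zpow, val_zpow, val_zpow, h1]
    ring⟩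

theorem tameElt_mul_left (a b c : Fˣ) : tameElt (a * b) c = tameElt a c * tameElt b c := by
  apply Subtype.ext
  simp only [tameElt, Subgroup.coe_mul, val_mul, add_mul, zpow_add, mul_zpow]
  simp only [div_eq_mul_inv, mul_inv]
  ac_rfl

theorem tameElt_mul_right (a b c : Fˣ) : tameElt a (b * c) = tameElt a b * tameElt a c := by
  apply Subtype.ext
  simp only [tameElt, Subgroup.coe_mul, val_mul, mul_add, zpow_add, mul_zpow]
  simp only [div_eq_mul_inv, mul_inv]
  ac_rfl

/-- The `n`-th Hilbert symbol `(a, b)ₙ`, that is the class in `κˣ` of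
`(-1)^{val a val b} a^{val b} / b^{val a}`, raised to the power `(q - 1) / n`. The group `μₙ` is
realised as the `n`-th roots of unity of the residue field `κ`. -/
def hilbert (n : ℕ) [hn : Fact (n ∣ Nat.card 𝓀[F] - 1)] :
    Fˣ →* Fˣ →* rootsOfUnity n 𝓀[F] :=
  MonoidHom.mk'
    (fun a => MonoidHom.mk'
      (fun b => ⟨red F (tameElt a b) ^ ((Nat.card 𝓀[F] - 1) / n), by
        rw [mem_rootsOfUnity, ← pow_mul, Nat.div_mul_cancel hn.out, ← Nat.card_units]
        exact pow_card_eq_one'⟩)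
      (fun b c => Subtype.ext (by
        simp only [tameElt_mul_right, map_mul, mul_pow, Subgroup.coe_mul])))
    (fun a b => MonoidHom.ext fun c => Subtype.ext (by
        simp only [MonoidHom.mk'_apply, tameElt_mul_left, map_mul, mul_pow, Subgroup.coe_mul,
          MonoidHom.mul_apply]))

theorem hilbert_val (n : ℕ) [Fact (n ∣ Nat.card 𝓀[F] - 1)] (a b : Fˣ) :
    ((hilbert n a b : rootsOfUnity n 𝓀[F]) : 𝓀[F]ˣ) =
      red F (tameElt a b) ^ ((Nat.card 𝓀[F] - 1) / n) := rfl

theorem hilbert_eq_one_of_tameElt (n : ℕ) [Fact (n ∣ Nat.card 𝓀[F] - 1)] (a b : Fˣ)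
    (h : valuation F (((tameElt a b : Fˣ) : F) - 1) < 1) : hilbert n a b = 1 := by
  apply Subtype.ext
  rw [hilbert_val, red_eq_of_sub_lt (tameElt a b) 1 (by simpa using h)]
  simp

theorem hilbert_self_neg (n : ℕ) [Fact (n ∣ Nat.card 𝓀[F] - 1)] (a : Fˣ) :
    hilbert n a (-a) = 1 := by
  have h : (tameElt a (-a) : Fˣ) = 1 := by
    have hv : val (-a) = val a := by
      unfold val; rw [Units.val_neg, Valuation.map_neg]
    have : (-a) = (-1) * a := by simp
    rw [tameElt]
    simp only [hv]
    rw [this, mul_zpow, zpow_mul]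
    rcases Int.even_or_odd (val a) with he | ho
    · simp [he.neg_one_zpow]
    · simp only [ho.neg_one_zpow, neg_one_mul, div_eq_mul_inv]
      rw [← neg_one_mul (a ^ val a), mul_inv, inv_neg, inv_one, neg_one_mul, mul_neg,
        neg_neg, mul_inv_cancel]
  apply hilbert_eq_one_of_tameElt
  simp [h]

theorem hilbert_unit_unit (n : ℕ) [Fact (n ∣ Nat.card 𝓀[F] - 1)] {a b : Fˣ}
    (ha : val a = 0) (hb : val b = 0) : hilbert n a b = 1 := by
  apply hilbert_eq_one_of_tameElt
  simp [tameElt, ha, hb]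

/-- `1 + 𝔭` is in the kernel of the symbol. -/
theorem hilbert_one_add (n : ℕ) [Fact (n ∣ Nat.card 𝓀[F] - 1)] (a : Fˣ) {u : Fˣ}
    (hu : valuation F ((u : F) - 1) < 1) : hilbert n a u = 1 := by
  have hu1 : valuation F (u : F) = 1 := by
    have h := Valuation.map_one_add_of_lt (v := valuation F) hu
    simpa using h
  have h0 : val u = 0 := (val_eq_zero_iff u).2 hu1
  have hr : red F ⟨u, h0⟩ = 1 := by
    have := red_eq_of_sub_lt ⟨u, h0⟩ 1 (by simpa using hu)
    simpa using this
  apply Subtype.ext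
  have ht : tameElt a u = (⟨u, h0⟩ : integerUnits F) ^ (-val a) := by
    apply Subtype.ext
    simp [tameElt, h0]
  rw [hilbert_val, ht, map_zpow, hr]
  simp

theorem hilbert_skew (n : ℕ) [Fact (n ∣ Nat.card 𝓀[F] - 1)] (a b : Fˣ) :
    hilbert n a b * hilbert n b a = 1 := by
  have h := hilbert_self_neg n (a * b)
  have h1 := hilbert_self_neg n a
  have h2 := hilbert_self_neg n b
  have e1 : -(a * b) = -a * b := by rw [neg_mul]
  have e2 : hilbert n b (-(a * b)) = hilbert n b a * hilbert n b (-b) := by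
    rw [← map_mul]; congr 1; simp
  rw [map_mul, MonoidHom.mul_apply, e2, e1, map_mul, h1, h2] at h
  simpa using h

/-- The Steinberg relation. -/
theorem hilbert_steinberg (n : ℕ) [Fact (n ∣ Nat.card 𝓀[F] - 1)] {a b : Fˣ}
    (hab : (a : F) + b = 1) : hilbert n a b = 1 := by
  rcases lt_trichotomy (val a) 0 with ha | ha | ha
  · -- `a = -b (1 - b⁻¹)`
    have hva : 1 < valuation F (a : F) := by
      by_contra h
      have := (val_nonneg_iff a).2 (not_lt.1 h)
      omega
    have hb : (b : F) = 1 - a := by rw [← hab]; ring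
    have hvb : valuation F (b : F) = valuation F (a : F) := by
      rw [hb, Valuation.map_sub_swap]
      apply Valuation.map_sub_eq_of_lt_left
      simpa using hva
    have hd : hilbert n a b = hilbert n a (-b / a) := by
      have : b = (-b / a) * (-a) := by
        rw [div_mul_eq_mul_div, neg_mul_neg, mul_div_assoc, div_self', mul_one]
      conv_lhs => rw [this, map_mul, hilbert_self_neg, mul_one]
    rw [hd]
    apply hilbert_one_add
    have hne : (a : F) ≠ 0 := a.ne_zero
    have : (((-b / a : Fˣ) : F)) - 1 = -(1 / (a : F)) := by
      rw [Units.val_div_eq_div_val, Units.val_neg, hb]; field_simp; ring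
    rw [this, Valuation.map_neg, map_div₀, map_one]
    rw [div_lt_one₀ (lt_trans one_pos hva)]
    exact hva
  · by_cases hb : val b = 0
    · exact hilbert_unit_unit n ha hb
    · have hva := (val_eq_zero_iff a).1 ha
      have hvb : valuation F (b : F) ≤ 1 := by
        have hb' : (b : F) = 1 - a := by rw [← hab]; ring
        rw [hb']
        exact (Valuation.map_sub _ _ _).trans (by simp [hva])
      have hvb' : valuation F (b : F) < 1 :=
        lt_of_le_of_ne hvb (fun h => hb ((val_eq_zero_iff b).2 h))
      have h := hilbert_skew n a b
      rw [hilbert_one_add n b (u := a), mul_one] at h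
      · exact h
      · have : (a : F) - 1 = -b := by rw [← hab]; ring
        rw [this, Valuation.map_neg]; exact hvb'
  · apply hilbert_one_add
    have : (b : F) - 1 = -a := by rw [← hab]; ring
    rw [this, Valuation.map_neg]
    exact (val_pos_iff a).1 ha

end Hilbert

/-! ### Kubota's cocycle -/

section Cocycle

/-- Bilinear symbols on `Fˣ` satisfying the Steinberg relation, written additively. -/
structure IsSymbol {F A : Type*} [Field F] [AddCommGroup A] (h : Fˣ → Fˣ → A) : Prop where
  mul_left : ∀ a b c, h (a * b) c = h a c + h b c
  mul_right : ∀ a b c, h a (b * c) = h a b + h a c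
  self_neg : ∀ a, h a (-a) = 0
  steinberg : ∀ a b : Fˣ, (a : F) + b = 1 → h a b = 0

namespace IsSymbol

variable {F A : Type*} [Field F] [AddCommGroup A] {h : Fˣ → Fˣ → A}


theorem one_left (H : IsSymbol h) (a : Fˣ) : h 1 a = 0 := by
  have := H.mul_left 1 1 a
  rw [one_mul] at this
  simpa using this

theorem one_right (H : IsSymbol h) (a : Fˣ) : h a 1 = 0 := by
  have := H.mul_right a 1 1
  rw [one_mul] at this
  simpa using this

theorem inv_left (H : IsSymbol h) (a b : Fˣ) : h a⁻¹ b = -h a b := by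
  have := H.mul_left a⁻¹ a b
  rw [inv_mul_cancel, H.one_left] at this
  exact eq_neg_of_add_eq_zero_left this.symm

theorem inv_right (H : IsSymbol h) (a b : Fˣ) : h a b⁻¹ = -h a b := by
  have := H.mul_right a b⁻¹ b
  rw [inv_mul_cancel, H.one_right] at this
  exact eq_neg_of_add_eq_zero_left this.symm

theorem div_left (H : IsSymbol h) (a b c : Fˣ) : h (a / b) c = h a c - h b c := by
  rw [div_eq_mul_inv, H.mul_left, H.inv_left, sub_eq_add_neg]

theorem div_right (H : IsSymbol h) (a b c : Fˣ) : h a (b / c) = h a b - h a c := by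
  rw [div_eq_mul_inv, H.mul_right, H.inv_right, sub_eq_add_neg]

theorem neg_right (H : IsSymbol h) (a b : Fˣ) : h a (-b) = h a b - h a a := by
  have h1 : h a (-1) + h a a = 0 := by rw [← H.mul_right, _root_.neg_one_mul, H.self_neg]
  rw [← _root_.neg_one_mul, H.mul_right, eq_neg_of_add_eq_zero_left h1]; abel

theorem skew (H : IsSymbol h) (a b : Fˣ) : h a b + h b a = 0 := by
  have h1 := H.self_neg (a * b)
  rw [H.mul_left, H.neg_right a, H.neg_right b, H.mul_right, H.mul_right] at h1
  have h2 : h a a + h b b = h a (a * b) + h b (a * b) - (h a b + h b a) := by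
    rw [H.mul_right, H.mul_right]; abel
  have e1 := H.neg_right a a
  have e2 := H.neg_right b b
  rw [H.self_neg] at e1 e2
  have h3 : h a a + h a b - h a a + (h b a + h b b - h b b) = h a b + h b a := by abel
  rw [← h3]; exact h1

theorem self_add_self (H : IsSymbol h) (a : Fˣ) : h a a + h a a = 0 := H.skew a a

theorem mul_neg_one (H : IsSymbol h) (a : Fˣ) : h a (-1) + h a a = 0 := by
  rw [← H.mul_right, _root_.neg_one_mul, H.self_neg]

theorem neg_one_mul (H : IsSymbol h) (a : Fˣ) : h (-1) a = h a a := by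
  have h1 := H.skew a (-1)
  have h2 := H.mul_neg_one a
  grind

theorem neg_left (H : IsSymbol h) (a b : Fˣ) : h (-a) b = h a b + h b b := by
  have h1 := H.skew (-a) b
  rw [H.neg_right] at h1
  have h2 := H.skew a b
  grind

/-- The identity behind the cocycle relation, for lower left entries that do not vanish. -/
theorem cocycle_generic (H : IsSymbol h) {a b c p r s : Fˣ} (e : (s : F) * b + a * c = r * p) :
    h (p / a) (p / b) + h (s / p) (s / c) = h (s / a) (s / r) + h (r / b) (r / c) := by
  have hst : h (s * b / (r * p)) (a * c / (r * p)) = 0 := by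
    apply H.steinberg
    have : (r : F) * p ≠ 0 := mul_ne_zero r.ne_zero p.ne_zero
    push_cast
    field_simp
    exact e
  simp only [H.div_left, H.div_right, H.mul_left, H.mul_right] at hst ⊢
  linear_combination (norm := module) (-1 : ℤ) • hst + (1 : ℤ) • H.self_add_self p - (1 : ℤ) • H.skew p b
    - (1 : ℤ) • H.skew a p + (1 : ℤ) • H.skew a b - (1 : ℤ) • H.skew p s + (1 : ℤ) • H.skew a s
    - (1 : ℤ) • H.skew a r + (1 : ℤ) • H.skew r p

theorem cocycle_1 (H : IsSymbol h) {a b c p r s : Fˣ} (e1 : p = a * b) (e2 : s = a * r) :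
    h (p / a) (p / b) + h (s / p) (s / c) = h (s / a) (s / r) + h (r / b) (r / c) := by
  subst e1 e2
  have := H.skew a b
  have := H.skew a r
  have := H.skew a c
  have := H.skew b c
  have := H.skew b r
  have := H.skew c r
  have := H.self_add_self a
  simp only [H.div_left, H.div_right, H.mul_left, H.mul_right] at *
  grind

theorem cocycle_2a (H : IsSymbol h) {a b c p r s : Fˣ} (e1 : r = b / c) (e2 : s = p / c) :
    h (p / a) (p / b) + h (s / p) (s / c) = h (s / a) (s / r) + h (r / b) (r / c) := by
  subst e1 e2
  have := H.skew a b
  have := H.skew a p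
  have := H.skew a c
  have := H.skew b c
  have := H.skew b p
  have := H.skew c p
  have := H.self_add_self c
  simp only [H.div_left, H.div_right, H.mul_left, H.mul_right] at *
  grind

theorem cocycle_2b (H : IsSymbol h) {a b c p r s : Fˣ} (e0 : p = a / b) (e1 : r = b * c)
    (e2 : s = p / c) :
    h (p / a) (p / b) + h (s / p) (s / c) = h (s / a) (s / r) + h (r / b) (r / c) := by
  subst e2 e1 e0
  have := H.skew a b
  have := H.skew a c
  have := H.skew b c
  have := H.self_add_self a
  have := H.self_add_self b
  have := H.self_add_self c
  simp only [H.div_left, H.div_right, H.mul_left, H.mul_right] at *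
  grind

theorem cocycle_2c (H : IsSymbol h) {a b c p r s : Fˣ} (e0 : p = (-1) * (a / b)) (e1 : r = b / c)
    (e2 : s = p * c) :
    h (p / a) (p / b) + h (s / p) (s / c) = h (s / a) (s / r) + h (r / b) (r / c) := by
  subst e2 e1 e0
  have := H.skew a b
  have := H.skew a c
  have := H.skew b c
  have := H.self_add_self a
  have := H.self_add_self b
  have := H.self_add_self c
  have := H.mul_neg_one a
  have := H.skew a (-1)
  have := H.mul_neg_one b
  have := H.skew b (-1)
  have := H.mul_neg_one c
  have := H.skew c (-1)
  have := H.self_add_self (-1)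
  simp only [H.div_left, H.div_right, H.mul_left, H.mul_right] at *
  grind

theorem cocycle_3 (H : IsSymbol h) {a b c p r s : Fˣ} (e0 : p = a / b) (e1 : r = b * c) :
    h (p / a) (p / b) + h (s / p) (s / c) = h (s / a) (s / r) + h (r / b) (r / c) := by
  subst e1 e0
  have := H.skew a b
  have := H.skew a c
  have := H.skew b c
  have := H.skew a s
  have := H.skew b s
  have := H.skew c s
  have := H.self_add_self a
  have := H.self_add_self b
  have := H.self_add_self c
  simp only [H.div_left, H.div_right, H.mul_left, H.mul_right] at *
  grind

theorem cocycle_4a (H : IsSymbol h) {a b c p r s : Fˣ} (e0 : p = (-1) * (a / b)) (e1 : s = p * c) :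
    h (p / a) (p / b) + h (s / p) (s / c) = h (s / a) (s / r) + h (r / b) (r / c) := by
  subst e1 e0
  have ma : h a (-1) = -h a a := eq_neg_of_add_eq_zero_left (H.mul_neg_one a)
  have sab : h b a = -h a b := eq_neg_of_add_eq_zero_right (H.skew a b)
  have sac : h c a = -h a c := eq_neg_of_add_eq_zero_right (H.skew a c)
  have sar : h r a = -h a r := eq_neg_of_add_eq_zero_right (H.skew a r)
  have mb : h b (-1) = -h b b := eq_neg_of_add_eq_zero_left (H.mul_neg_one b)
  have sbc : h c b = -h b c := eq_neg_of_add_eq_zero_right (H.skew b c)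
  have sbr : h r b = -h b r := eq_neg_of_add_eq_zero_right (H.skew b r)
  have mc : h c (-1) = -h c c := eq_neg_of_add_eq_zero_left (H.mul_neg_one c)
  have scr : h r c = -h c r := eq_neg_of_add_eq_zero_right (H.skew c r)
  have mr : h r (-1) = -h r r := eq_neg_of_add_eq_zero_left (H.mul_neg_one r)
  simp only [H.div_left, H.div_right, H.mul_left, H.mul_right]
  simp only [ma, H.neg_one_mul a, sab, sac, sar, mb, H.neg_one_mul b, sbc, sbr, mc, H.neg_one_mul c, scr, mr, H.neg_one_mul r]
  linear_combination (norm := module) (-1 : ℤ) • H.self_add_self c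

theorem cocycle_4b (H : IsSymbol h) {a b c p r s : Fˣ} (e0 : c = (-1) * (b / r)) (e1 : s = a / r) :
    h (p / a) (p / b) + h (s / p) (s / c) = h (s / a) (s / r) + h (r / b) (r / c) := by
  subst e1 e0
  have ma : h a (-1) = -h a a := eq_neg_of_add_eq_zero_left (H.mul_neg_one a)
  have sab : h b a = -h a b := eq_neg_of_add_eq_zero_right (H.skew a b)
  have sap : h p a = -h a p := eq_neg_of_add_eq_zero_right (H.skew a p)
  have sar : h r a = -h a r := eq_neg_of_add_eq_zero_right (H.skew a r)
  have mb : h b (-1) = -h b b := eq_neg_of_add_eq_zero_left (H.mul_neg_one b)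
  have sbp : h p b = -h b p := eq_neg_of_add_eq_zero_right (H.skew b p)
  have sbr : h r b = -h b r := eq_neg_of_add_eq_zero_right (H.skew b r)
  have mp : h p (-1) = -h p p := eq_neg_of_add_eq_zero_left (H.mul_neg_one p)
  have spr : h r p = -h p r := eq_neg_of_add_eq_zero_right (H.skew p r)
  have mr : h r (-1) = -h r r := eq_neg_of_add_eq_zero_left (H.mul_neg_one r)
  simp only [H.div_left, H.div_right, H.mul_left, H.mul_right]
  simp only [ma, H.neg_one_mul a, sab, sap, sar, mb, H.neg_one_mul b, sbp, sbr, mp, H.neg_one_mul p, spr, mr, H.neg_one_mul r]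
  linear_combination (norm := module) (1 : ℤ) • H.self_add_self a - (3 : ℤ) • H.self_add_self r

theorem cocycle_4c (H : IsSymbol h) {a b c p r s : Fˣ} (e0 : c = r * p / a) :
    h (p / a) (p / b) + h (s / p) (s / c) = h (s / a) (s / r) + h (r / b) (r / c) := by
  subst e0
  have := H.skew a b
  have := H.skew a p
  have := H.skew b p
  have := H.skew a r
  have := H.skew b r
  have := H.skew p r
  have := H.skew a s
  have := H.skew p s
  have := H.skew r s
  have := H.self_add_self a
  have := H.self_add_self b
  have := H.self_add_self p
  have := H.self_add_self r
  simp only [H.div_left, H.div_right, H.mul_left, H.mul_right] at *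
  grind

end IsSymbol

end Cocycle

/-! ### The covering group -/

section Cover

open Matrix

variable {F : Type*} [Field F]

/-- `X(g)` is the lower left entry of `g` if this is nonzero and the lower right one otherwise. -/
def kubotaX (g : SpecialLinearGroup (Fin 2) F) : Fˣ :=
  open Classical in
  if h : g 1 0 = 0 then
    Units.mk0 (g 1 1) (fun h' => by
      have := g.det_coe
      rw [Matrix.det_fin_two, h, h'] at this
      simp at this)
  else Units.mk0 (g 1 0) h

theorem kubotaX_of_eq {g : SpecialLinearGroup (Fin 2) F} (h : g 1 0 = 0) :
    (kubotaX g : F) = g 1 1 := by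
  simp [kubotaX, h]

theorem kubotaX_of_ne {g : SpecialLinearGroup (Fin 2) F} (h : g 1 0 ≠ 0) :
    (kubotaX g : F) = g 1 0 := by
  simp [kubotaX, h]

theorem kubotaX_one : kubotaX (1 : SpecialLinearGroup (Fin 2) F) = 1 := by
  apply Units.ext
  rw [kubotaX_of_eq (by simp)]
  simp

theorem det_eq (g : SpecialLinearGroup (Fin 2) F) : g 0 0 * g 1 1 - g 0 1 * g 1 0 = 1 := by
  have := g.det_coe
  rwa [Matrix.det_fin_two] at this

theorem mul_entry (g k : SpecialLinearGroup (Fin 2) F) (i j : Fin 2) :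
    (g * k) i j = g i 0 * k 0 j + g i 1 * k 1 j := by
  change (g.1 * k.1) i j = _
  rw [Matrix.mul_apply, Fin.sum_univ_two]

theorem kubotaX_mul_of_left {g k : SpecialLinearGroup (Fin 2) F} (h : g 1 0 = 0) :
    kubotaX (g * k) = kubotaX g * kubotaX k := by
  apply Units.ext
  rw [Units.val_mul, kubotaX_of_eq h]
  have hd : g 1 1 ≠ 0 := by rw [← kubotaX_of_eq h]; exact Units.ne_zero _
  by_cases hk : k 1 0 = 0
  · rw [kubotaX_of_eq hk, kubotaX_of_eq (by rw [mul_entry, h, hk]; ring), mul_entry, h]; ring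
  · have : (g * k) 1 0 ≠ 0 := by
      rw [mul_entry, h]; simpa using ⟨hd, hk⟩
    rw [kubotaX_of_ne hk, kubotaX_of_ne this, mul_entry, h]; ring

theorem kubotaX_mul_of_right {g k : SpecialLinearGroup (Fin 2) F} (h : k 1 0 = 0)
    (hg : g 1 0 ≠ 0) : kubotaX (g * k) = kubotaX g / kubotaX k := by
  apply Units.ext
  have hd : k 1 1 ≠ 0 := by rw [← kubotaX_of_eq h]; exact Units.ne_zero _
  have hdet : k 0 0 * k 1 1 = 1 := by have := det_eq k; rw [h] at this; linear_combination this
  have ha : k 0 0 ≠ 0 := left_ne_zero_of_mul_eq_one hdet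
  have : (g * k) 1 0 ≠ 0 := by
    rw [mul_entry, h]; simpa using ⟨hg, ha⟩
  rw [kubotaX_of_ne this, Units.val_div_eq_div_val, kubotaX_of_eq h, kubotaX_of_ne hg,
    mul_entry, h, eq_div_iff hd]
  linear_combination (g 1 0) * hdet

/-- The cocycle relation for Kubota's formula. -/
theorem kubota_cocycle {A : Type*} [AddCommGroup A] {h : Fˣ → Fˣ → A} (H : IsSymbol h)
    (g₁ g₂ g₃ : SpecialLinearGroup (Fin 2) F) :
    h (kubotaX (g₁ * g₂) / kubotaX g₁) (kubotaX (g₁ * g₂) / kubotaX g₂) +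
      h (kubotaX (g₁ * g₂ * g₃) / kubotaX (g₁ * g₂)) (kubotaX (g₁ * g₂ * g₃) / kubotaX g₃) =
    h (kubotaX (g₁ * g₂ * g₃) / kubotaX g₁) (kubotaX (g₁ * g₂ * g₃) / kubotaX (g₂ * g₃)) +
      h (kubotaX (g₂ * g₃) / kubotaX g₂) (kubotaX (g₂ * g₃) / kubotaX g₃) := by
  by_cases h1 : g₁ 1 0 = 0
  · apply H.cocycle_1
    · exact kubotaX_mul_of_left h1
    · rw [mul_assoc]; exact kubotaX_mul_of_left h1
  by_cases h3 : g₃ 1 0 = 0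
  · by_cases h2 : g₂ 1 0 = 0
    · have h12 : (g₁ * g₂) 1 0 ≠ 0 := by
        intro h0
        have e := kubotaX_mul_of_right h2 h1
        have hdet : g₂ 0 0 * g₂ 1 1 = 1 := by
          have := det_eq g₂; rw [h2] at this; linear_combination this
        rw [mul_entry, h2] at h0
        have : g₁ 1 0 * g₂ 0 0 = 0 := by linear_combination h0
        rcases mul_eq_zero.1 this with h' | h'
        · exact h1 h'
        · rw [h'] at hdet; simp at hdet
      exact H.cocycle_2b (kubotaX_mul_of_right h2 h1) (kubotaX_mul_of_left h2)
        (kubotaX_mul_of_right h3 h12)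
    · by_cases h12 : (g₁ * g₂) 1 0 = 0
      · refine H.cocycle_2c ?_ (kubotaX_mul_of_right h3 h2) (kubotaX_mul_of_left h12)
        apply Units.ext
        push_cast
        rw [kubotaX_of_eq h12, kubotaX_of_ne h1, kubotaX_of_ne h2, mul_entry]
        rw [mul_entry] at h12
        field_simp
        linear_combination (g₂ 1 1) * h12 - (g₁ 1 0) * det_eq g₂
      · exact H.cocycle_2a (kubotaX_mul_of_right h3 h2) (kubotaX_mul_of_right h3 h12)
  by_cases h2 : g₂ 1 0 = 0
  · exact H.cocycle_3 (kubotaX_mul_of_right h2 h1) (kubotaX_mul_of_left h2)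
  have key : (g₁ * g₂ * g₃) 1 0 * g₂ 1 0 + g₁ 1 0 * g₃ 1 0 = (g₂ * g₃) 1 0 * (g₁ * g₂) 1 0 := by
    simp only [mul_entry]
    linear_combination (-(g₁ 1 0 * g₃ 1 0)) * det_eq g₂
  by_cases h12 : (g₁ * g₂) 1 0 = 0
  · refine H.cocycle_4a ?_ (kubotaX_mul_of_left h12)
    apply Units.ext
    push_cast
    rw [kubotaX_of_eq h12, kubotaX_of_ne h1, kubotaX_of_ne h2, mul_entry]
    rw [mul_entry] at h12
    field_simp
    linear_combination (g₂ 1 1) * h12 - (g₁ 1 0) * det_eq g₂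
  by_cases h23 : (g₂ * g₃) 1 0 = 0
  · have hs : kubotaX (g₁ * g₂ * g₃) = kubotaX g₁ / kubotaX (g₂ * g₃) := by
      rw [mul_assoc]; exact kubotaX_mul_of_right h23 h1
    refine H.cocycle_4b ?_ hs
    have hne : (g₂ * g₃) 1 1 ≠ 0 := by rw [← kubotaX_of_eq h23]; exact Units.ne_zero _
    apply Units.ext
    push_cast
    rw [kubotaX_of_ne h3, kubotaX_of_ne h2, kubotaX_of_eq h23]
    field_simp
    simp only [mul_entry] at h23 ⊢
    linear_combination (g₃ 1 1) * h23 - (g₂ 1 0) * det_eq g₃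
  by_cases h123 : (g₁ * g₂ * g₃) 1 0 = 0
  · apply H.cocycle_4c
    apply Units.ext
    push_cast
    rw [kubotaX_of_ne h3, kubotaX_of_ne h1, kubotaX_of_ne h12, kubotaX_of_ne h23, eq_div_iff h1,
      ← key, h123]
    ring
  · apply H.cocycle_generic
    rw [kubotaX_of_ne h3, kubotaX_of_ne h1, kubotaX_of_ne h12, kubotaX_of_ne h23,
      kubotaX_of_ne h2, kubotaX_of_ne h123]
    exact key

end Cover

section MetaGroup

open Matrix

variable {F : Type*} [Field F] [ValuativeRel F] [TopologicalSpace F] [IsNonarchimedeanLocalField F]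

theorem isSymbol_hilbert (n : ℕ) [Fact (n ∣ Nat.card 𝓀[F] - 1)] :
    IsSymbol (fun a b : Fˣ => Additive.ofMul (hilbert n a b)) where
  mul_left a b c := by rw [map_mul, MonoidHom.mul_apply, ofMul_mul]
  mul_right a b c := by rw [map_mul, ofMul_mul]
  self_neg a := by rw [hilbert_self_neg, ofMul_one]
  steinberg a b h := by rw [hilbert_steinberg n h, ofMul_one]

/-- Kubota's cocycle `β(g₁, g₂) = (X(g₁g₂)/X(g₁), X(g₁g₂)/X(g₂))ₙ`. -/
def kubota (n : ℕ) [Fact (n ∣ Nat.card 𝓀[F] - 1)] (g₁ g₂ : SpecialLinearGroup (Fin 2) F) :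
    rootsOfUnity n 𝓀[F] :=
  hilbert n (kubotaX (g₁ * g₂) / kubotaX g₁) (kubotaX (g₁ * g₂) / kubotaX g₂)

theorem kubota_mul (n : ℕ) [Fact (n ∣ Nat.card 𝓀[F] - 1)]
    (g₁ g₂ g₃ : SpecialLinearGroup (Fin 2) F) :
    kubota n g₁ g₂ * kubota n (g₁ * g₂) g₃ = kubota n g₁ (g₂ * g₃) * kubota n g₂ g₃ := by
  have h := kubota_cocycle (isSymbol_hilbert n) g₁ g₂ g₃
  simp only [← ofMul_mul, EmbeddingLike.apply_eq_iff_eq] at h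
  unfold kubota
  rw [← mul_assoc g₁ g₂ g₃]
  exact h

theorem kubota_one_left (n : ℕ) [Fact (n ∣ Nat.card 𝓀[F] - 1)]
    (g : SpecialLinearGroup (Fin 2) F) : kubota n 1 g = 1 := by
  simp [kubota]

theorem kubota_one_right (n : ℕ) [Fact (n ∣ Nat.card 𝓀[F] - 1)]
    (g : SpecialLinearGroup (Fin 2) F) : kubota n g 1 = 1 := by
  simp [kubota]

variable (F) in
/-- The `n`-fold covering group of `SL₂(F)`: the set `SL₂(F) × μₙ`, with the multiplication
`(g₁, ζ₁)(g₂, ζ₂) = (g₁g₂, β(g₁, g₂)ζ₁ζ₂)`. -/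
@[ext]
structure MetaSL2 (n : ℕ) where
  /-- the underlying matrix -/
  base : SpecialLinearGroup (Fin 2) F
  /-- the root of unity -/
  root : rootsOfUnity n 𝓀[F]

namespace MetaSL2

variable {n : ℕ} [Fact (n ∣ Nat.card 𝓀[F] - 1)]

instance : Mul (MetaSL2 F n) :=
  ⟨fun x y => ⟨x.base * y.base, kubota n x.base y.base * x.root * y.root⟩⟩

instance : One (MetaSL2 F n) := ⟨⟨1, 1⟩⟩

instance : Inv (MetaSL2 F n) :=
  ⟨fun x => ⟨x.base⁻¹, (kubota n x.base⁻¹ x.base * x.root)⁻¹⟩⟩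

theorem base_mul (x y : MetaSL2 F n) : (x * y).base = x.base * y.base := rfl

theorem root_mul (x y : MetaSL2 F n) :
    (x * y).root = kubota n x.base y.base * x.root * y.root := rfl

theorem base_one : (1 : MetaSL2 F n).base = 1 := rfl

theorem root_one : (1 : MetaSL2 F n).root = 1 := rfl

theorem base_inv (x : MetaSL2 F n) : x⁻¹.base = x.base⁻¹ := rfl

theorem root_inv (x : MetaSL2 F n) :
    x⁻¹.root = (kubota n x.base⁻¹ x.base * x.root)⁻¹ := rfl

instance : Group (MetaSL2 F n) :=
  Group.ofLeftAxioms
    (fun x y z => by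
      apply MetaSL2.ext
      · simp only [base_mul, mul_assoc]
      · simp only [root_mul, base_mul]
        have h := kubota_mul n x.base y.base z.base
        calc _ = (kubota n x.base y.base * kubota n (x.base * y.base) z.base) *
              (x.root * y.root * z.root) := by ac_rfl
          _ = _ := by rw [h]; ac_rfl)
    (fun x => by
      apply MetaSL2.ext
      · simp only [base_mul, base_one, one_mul]
      · simp only [root_mul, base_one, root_one, kubota_one_left, one_mul])
    (fun x => by
      apply MetaSL2.ext
      · simp only [base_mul, base_inv, base_one, inv_mul_cancel]
      · simp only [root_mul, base_inv, root_inv, root_one]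
        rw [mul_right_comm, mul_inv_cancel])

variable (F n) in
/-- The projection `𝗉` onto `SL₂(F)`. -/
def proj : MetaSL2 F n →* SpecialLinearGroup (Fin 2) F where
  toFun := base
  map_one' := rfl
  map_mul' _ _ := rfl

variable (F n) in
/-- The inclusion `𝗂` of `μₙ`. -/
def incl : rootsOfUnity n 𝓀[F] →* MetaSL2 F n where
  toFun ζ := ⟨1, ζ⟩
  map_one' := rfl
  map_mul' a b := by
    apply MetaSL2.ext
    · simp only [base_mul, one_mul]
    · simp only [root_mul, kubota_one_left, one_mul]

end MetaSL2

end MetaGroup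

/-! ### Splitting over the maximal compact subgroup -/

section Splitting

open Matrix

variable {F : Type*} [Field F] [ValuativeRel F] [TopologicalSpace F] [IsNonarchimedeanLocalField F]
variable {n : ℕ} [Fact (n ∣ Nat.card 𝓀[F] - 1)]

variable (F) in
/-- `K¹ = SL₂(𝒪)`, as a subgroup of `SL₂(F)`. -/
def maxCompact : Subgroup (SpecialLinearGroup (Fin 2) F) :=
  (SpecialLinearGroup.map (algebraMap 𝒪[F] F)).range

variable (F) in
/-- `K¹ⱼ = {g ∈ SL₂(𝒪) | g ≡ 1 mod 𝔭ʲ}`, as a subgroup of `SL₂(F)`. -/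
def congruence (j : ℕ+) : Subgroup (SpecialLinearGroup (Fin 2) F) :=
  (SpecialLinearGroup.map (Ideal.Quotient.mk (𝓂[F] ^ (j : ℕ)))).ker.map
    (SpecialLinearGroup.map (algebraMap 𝒪[F] F))

theorem congruence_le (j : ℕ+) : congruence F j ≤ maxCompact F := by
  rintro _ ⟨g, -, rfl⟩
  exact ⟨g, rfl⟩

theorem congruence_anti {i j : ℕ+} (h : i ≤ j) : congruence F j ≤ congruence F i := by
  rintro _ ⟨g, hg, rfl⟩
  refine ⟨g, ?_, rfl⟩
  have hle : 𝓂[F] ^ (j : ℕ) ≤ 𝓂[F] ^ (i : ℕ) := Ideal.pow_le_pow_right h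
  rw [SetLike.mem_coe, MonoidHom.mem_ker] at hg ⊢
  have e : SpecialLinearGroup.map (n := Fin 2) (Ideal.Quotient.mk (𝓂[F] ^ (i : ℕ))) =
      (SpecialLinearGroup.map (Ideal.Quotient.factor hle)).comp
        (SpecialLinearGroup.map (Ideal.Quotient.mk (𝓂[F] ^ (j : ℕ)))) := by
    ext; simp
  rw [e, MonoidHom.comp_apply, hg, map_one]

theorem congruence_conj {j : ℕ+} {k g : SpecialLinearGroup (Fin 2) F} (hk : k ∈ maxCompact F)
    (hg : g ∈ congruence F j) : k * g * k⁻¹ ∈ congruence F j := by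
  obtain ⟨k, rfl⟩ := hk
  obtain ⟨g, hg, rfl⟩ := hg
  exact ⟨k * g * k⁻¹, Subgroup.Normal.conj_mem inferInstance g hg k, by simp⟩

theorem mem_maxCompact_iff {g : SpecialLinearGroup (Fin 2) F} :
    g ∈ maxCompact F ↔ ∀ i j, valuation F (g i j) ≤ 1 := by
  constructor
  · rintro ⟨k, rfl⟩ i j
    exact (k i j).2
  · intro h
    let M : Matrix (Fin 2) (Fin 2) 𝒪[F] := fun i j => ⟨g i j, h i j⟩
    refine ⟨⟨M, ?_⟩, ?_⟩
    · apply Subtype.ext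
      rw [Matrix.det_fin_two]
      have := det_eq g
      simpa [M] using this
    · ext i j; rfl

theorem mem_congruence_iff {j : ℕ+} {g : SpecialLinearGroup (Fin 2) F} :
    g ∈ congruence F j ↔ ∀ i k, ∃ x ∈ 𝓂[F] ^ (j : ℕ), (x : F) = g i k - (1 : Matrix _ _ F) i k := by
  constructor
  · rintro ⟨m, hm, rfl⟩ i k
    refine ⟨m i k - (1 : Matrix _ _ 𝒪[F]) i k, ?_, ?_⟩
    · rw [← Ideal.Quotient.eq]
      have := congrArg (fun s : SpecialLinearGroup (Fin 2) (𝒪[F] ⧸ 𝓂[F] ^ (j : ℕ)) => s.1 i k) hm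
      rw [Matrix.one_apply]
      have h2 : Ideal.Quotient.mk (𝓂[F] ^ (j : ℕ)) (m i k) = (1 : Matrix _ _ _) i k := this
      rw [h2, Matrix.one_apply]
      split_ifs <;> simp
    · have : ((1 : Matrix (Fin 2) (Fin 2) 𝒪[F]) i k : F) = (1 : Matrix _ _ F) i k := by
        rw [Matrix.one_apply, Matrix.one_apply]; split_ifs <;> simp
      rw [← this]; rfl
  · intro h
    choose x hx hxe using h
    have hle : ∀ i k, valuation F (g i k) ≤ 1 := by
      intro i k
      have : g i k = ((x i k + (1 : Matrix _ _ 𝒪[F]) i k : 𝒪[F]) : F) := by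
        have h1 : ((1 : Matrix (Fin 2) (Fin 2) 𝒪[F]) i k : F) = (1 : Matrix _ _ F) i k := by
          rw [Matrix.one_apply, Matrix.one_apply]; split_ifs <;> simp
        push_cast
        rw [hxe, h1]; ring
      rw [this]
      exact (x i k + (1 : Matrix _ _ 𝒪[F]) i k).2
    obtain ⟨m, rfl⟩ := mem_maxCompact_iff.2 hle
    refine ⟨m, ?_, rfl⟩
    rw [SetLike.mem_coe, MonoidHom.mem_ker]
    ext i k
    change Ideal.Quotient.mk (𝓂[F] ^ (j : ℕ)) (m i k) = (1 : Matrix _ _ _) i k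
    have h1 : m i k = x i k + (1 : Matrix _ _ 𝒪[F]) i k := by
      apply Subtype.ext
      have h1 : ((1 : Matrix (Fin 2) (Fin 2) 𝒪[F]) i k : F) = (1 : Matrix _ _ F) i k := by
        rw [Matrix.one_apply, Matrix.one_apply]; split_ifs <;> simp
      push_cast
      rw [hxe, h1]
      change (m i k : F) = (m i k : F) - _ + _
      ring
    rw [h1, map_add, Ideal.Quotient.eq_zero_iff_mem.2 (hx i k), zero_add, Matrix.one_apply,
      Matrix.one_apply]
    split_ifs <;> simp

theorem valuation_lt_one_of_mem {x : 𝒪[F]} {j : ℕ+} (hx : x ∈ 𝓂[F] ^ (j : ℕ)) :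
    valuation F (x : F) < 1 := by
  have h := Ideal.pow_le_self j.ne_zero hx
  rw [IsLocalRing.mem_maximalIdeal, mem_nonunits_iff,
    Valuation.Integer.not_isUnit_iff_valuation_lt_one] at h
  exact h

theorem hilbert_congr (x : Fˣ) {u u' : Fˣ} (hu : valuation F (u' : F) = 1)
    (h : valuation F ((u : F) - u') < 1) : hilbert n x u = hilbert n x u' := by
  have e : u = u / u' * u' := by simp
  have h1 : hilbert n x (u / u') = 1 := by
    apply hilbert_one_add
    have : ((u / u' : Fˣ) : F) - 1 = (u - u') / u' := by
      rw [Units.val_div_eq_div_val, sub_div, div_self u'.ne_zero]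
    rw [this, map_div₀, hu, div_one]
    exact h
  rw [e, map_mul, h1, one_mul]

variable (n) in
/-- `(c, d)ₙ` if `0 < val c < ∞`, and `1` otherwise. -/
def sec (g : SpecialLinearGroup (Fin 2) F) : rootsOfUnity n 𝓀[F] :=
  open Classical in
  if h : g 1 0 ≠ 0 ∧ g 1 1 ≠ 0 ∧ valuation F (g 1 0) < 1 then
    hilbert n (Units.mk0 (g 1 0) h.1) (Units.mk0 (g 1 1) h.2.1) else 1

theorem sec_of_unit {g : SpecialLinearGroup (Fin 2) F} (h : valuation F (g 1 0) = 1) :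
    sec n g = 1 := by
  rw [sec, dif_neg]; rintro ⟨-, -, h'⟩; exact h'.ne h

theorem sec_of_zero {g : SpecialLinearGroup (Fin 2) F} (h : g 1 0 = 0) : sec n g = 1 := by
  rw [sec, dif_neg]; rintro ⟨h', -⟩; exact h' h

theorem sec_of {g : SpecialLinearGroup (Fin 2) F} (h0 : g 1 0 ≠ 0)
    (h : valuation F (g 1 0) < 1) (d : Fˣ) (hd : (d : F) = g 1 1) :
    sec n g = hilbert n (kubotaX g) d := by
  have h1 : g 1 1 ≠ 0 := by rw [← hd]; exact d.ne_zero
  rw [sec, dif_pos ⟨h0, h1, h⟩]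
  congr 1
  · congr 1
    apply Units.ext
    rw [kubotaX_of_ne h0]; rfl
  · apply Units.ext; exact hd.symm

theorem lt_one_left {x y : ValueGroupWithZero F} (hx : x < 1) (hy : y ≤ 1) : x * y < 1 :=
  mul_lt_one_of_nonneg_of_lt_one_left zero_le hx hy

theorem lt_one_right {x y : ValueGroupWithZero F} (hx : x ≤ 1) (hy : y < 1) : x * y < 1 :=
  mul_lt_one_of_nonneg_of_lt_one_right hx zero_le hy

theorem diag_unit {g : SpecialLinearGroup (Fin 2) F} (hg : g ∈ maxCompact F)
    (h : valuation F (g 1 0) < 1) :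
    valuation F (g 0 0) = 1 ∧ valuation F (g 1 1) = 1 := by
  rw [mem_maxCompact_iff] at hg
  have h1 : valuation F (g 0 0 * g 1 1) = 1 := by
    have e : g 0 0 * g 1 1 = 1 + g 0 1 * g 1 0 := by linear_combination det_eq g
    rw [e]
    apply Valuation.map_one_add_of_lt
    rw [map_mul]
    exact lt_one_right (hg 0 1) h
  rw [map_mul] at h1
  exact ⟨le_antisymm (hg 0 0) (by
      by_contra hlt
      exact absurd h1 (lt_one_left (not_le.1 hlt) (hg 1 1)).ne),
    le_antisymm (hg 1 1) (by
      by_contra hlt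
      exact absurd h1 (lt_one_right (hg 0 0) (not_le.1 hlt)).ne)⟩

theorem kubotaX_unit {g : SpecialLinearGroup (Fin 2) F} (hg : g ∈ maxCompact F)
    (h : g 1 0 = 0 ∨ valuation F (g 1 0) = 1) : val (kubotaX g) = 0 := by
  rw [val_eq_zero_iff]
  by_cases h0 : g 1 0 = 0
  · rw [kubotaX_of_eq h0]
    exact (diag_unit hg (by simp [h0])).2
  · rw [kubotaX_of_ne h0]
    exact h.resolve_left h0

set_option maxHeartbeats 1000000 in
theorem kubota_mul_sec {g k : SpecialLinearGroup (Fin 2) F} (hg : g ∈ maxCompact F)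
    (hk : k ∈ maxCompact F) : kubota n g k * sec n g * sec n k = sec n (g * k) := by
  have hgk := mul_mem hg hk
  have hg' := mem_maxCompact_iff.1 hg
  have hk' := mem_maxCompact_iff.1 hk
  have hgk' := mem_maxCompact_iff.1 hgk
  have H := isSymbol_hilbert (F := F) n
  set h : Fˣ → Fˣ → Additive (rootsOfUnity n 𝓀[F]) :=
    fun a b => Additive.ofMul (hilbert n a b) with hh
  have hu : ∀ {a b : Fˣ}, val a = 0 → val b = 0 → h a b = 0 := fun ha hb => by
    simp only [hh]; rw [hilbert_unit_unit n ha hb, ofMul_one]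
  have hc : ∀ (x : Fˣ) {u u' : Fˣ}, valuation F (u' : F) = 1 →
      valuation F ((u : F) - u') < 1 → h x u = h x u' := fun x u u' h1 h2 => by
    simp only [hh]; rw [hilbert_congr x h1 h2]
  apply Additive.ofMul.injective
  rw [ofMul_mul, ofMul_mul]
  have hβ : Additive.ofMul (kubota n g k) =
    h (kubotaX (g * k) / kubotaX g) (kubotaX (g * k) / kubotaX k) := rfl
  have hsu : ∀ {g : SpecialLinearGroup (Fin 2) F}, (g 1 0 = 0 ∨ valuation F (g 1 0) = 1) →
      Additive.ofMul (sec n g) = 0 := fun h => by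
    rcases h with h | h
    · rw [sec_of_zero h, ofMul_one]
    · rw [sec_of_unit h, ofMul_one]
  have hss : ∀ {g : SpecialLinearGroup (Fin 2) F}, g 1 0 ≠ 0 → valuation F (g 1 0) < 1 →
      ∀ d : Fˣ, (d : F) = g 1 1 → Additive.ofMul (sec n g) = h (kubotaX g) d :=
    fun h0 h1 d hd => by rw [sec_of h0 h1 d hd]
  have hd12 : (g * k) 1 1 = g 1 0 * k 0 1 + g 1 1 * k 1 1 := mul_entry g k 1 1
  have hc12 : (g * k) 1 0 = g 1 0 * k 0 0 + g 1 1 * k 1 0 := mul_entry g k 1 0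
  rw [hβ]
  clear_value h
  rcases (hg' 1 0).lt_or_eq with h1 | h1
  · obtain ⟨ha1, hd1⟩ := diag_unit hg h1
    have hd1' : g 1 1 ≠ 0 := fun h0 => by simp [h0] at hd1
    set d1 : Fˣ := Units.mk0 (g 1 1) hd1' with hd1e
    have hd1v : val d1 = 0 := (val_eq_zero_iff _).2 hd1
    rcases (hk' 1 0).lt_or_eq with h2 | h2
    · obtain ⟨ha2, hd2⟩ := diag_unit hk h2
      have hd2' : k 1 1 ≠ 0 := fun h0 => by simp [h0] at hd2
      have ha2' : k 0 0 ≠ 0 := fun h0 => by simp [h0] at ha2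
      set d2 : Fˣ := Units.mk0 (k 1 1) hd2' with hd2e
      set a2 : Fˣ := Units.mk0 (k 0 0) ha2' with ha2e
      have hd2v : val d2 = 0 := (val_eq_zero_iff _).2 hd2
      have ha2v : val a2 = 0 := (val_eq_zero_iff _).2 ha2
      have h12 : valuation F ((g * k) 1 0) < 1 := by
        rw [hc12]
        refine (Valuation.map_add_lt _ ?_ ?_)
        · rw [map_mul]; exact lt_one_left h1 (hk' 0 0)
        · rw [map_mul]; exact lt_one_right (hg' 1 1) h2
      obtain ⟨-, hd12u⟩ := diag_unit hgk h12
      have hd12' : (g * k) 1 1 ≠ 0 := fun h0 => by simp [h0] at hd12u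
      set d12 : Fˣ := Units.mk0 ((g * k) 1 1) hd12' with hd12e
      have hd12v : val d12 = 0 := (val_eq_zero_iff _).2 hd12u
      have hdd : ∀ x, h x d12 = h x d1 + h x d2 := fun x => by
        rw [← H.mul_right]
        refine hc x ?_ ?_
        · rw [Units.val_mul, map_mul]; simp [hd1e, hd2e, hd1, hd2]
        · have : (d12 : F) - (d1 * d2 : Fˣ) = g 1 0 * k 0 1 := by
            simp [hd12e, hd1e, hd2e, hd12]
          rw [this, map_mul]; exact lt_one_left h1 (hk' 0 1)
      have had : ∀ x, h x a2 + h x d2 = 0 := fun x => by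
        rw [← H.mul_right, ← H.one_right x]
        refine hc x (by simp) ?_
        have : ((a2 * d2 : Fˣ) : F) - (1 : Fˣ) = k 0 1 * k 1 0 := by
          simp [ha2e, hd2e]; linear_combination det_eq k
        rw [this, map_mul]; exact lt_one_right (hk' 0 1) h2
      by_cases z1 : g 1 0 = 0
      · have hx : kubotaX g = d1 := Units.ext (by rw [kubotaX_of_eq z1]; rfl)
        have hz := kubotaX_mul_of_left (k := k) z1
        rw [hsu (Or.inl z1)]
        by_cases z2 : k 1 0 = 0
        · rw [hsu (Or.inl z2), hsu (g := g * k) (Or.inl (by rw [hc12, z1, z2]; ring)), hu]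
          · simp
          · rw [hz, val_div, val_mul]; have := kubotaX_unit hk (Or.inl z2); omega
          · rw [hz, val_div, val_mul, hx]; omega
        · rw [hss z2 h2 d2 rfl, hss (by rw [hc12, z1]; simpa using ⟨hd1', z2⟩) h12 d12 rfl, hdd,
            hz, hx]
          simp only [H.mul_left, H.mul_right, H.div_left, H.div_right]
          rw [hu hd1v hd1v, hu hd1v hd2v]
          grind
      by_cases z2 : k 1 0 = 0
      · have hy : kubotaX k = d2 := Units.ext (by rw [kubotaX_of_eq z2]; rfl)
        have hz := kubotaX_mul_of_right z2 z1
        rw [hsu (Or.inl z2), hss z1 h1 d1 rfl,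
          hss (by rw [hc12, z2]; simpa using ⟨z1, ha2'⟩) h12 d12 rfl, hdd, hz, hy]
        have e1 := H.skew d2 (kubotaX g)
        have e2 := hu hd2v hd2v
        have e3 := hu hd2v hd1v
        simp only [H.mul_left, H.mul_right, H.div_left, H.div_right]
        rw [e2, e3]
        grind
      rw [hss z1 h1 d1 rfl, hss z2 h2 d2 rfl]
      by_cases z12 : (g * k) 1 0 = 0
      · have hz : kubotaX (g * k) = d12 := Units.ext (by rw [kubotaX_of_eq z12]; rfl)
        have hy : kubotaX k = (-kubotaX g) * a2 / d1 := by
          apply Units.ext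
          rw [Units.val_div_eq_div_val, eq_div_iff d1.ne_zero]
          push_cast
          rw [kubotaX_of_ne z2, kubotaX_of_ne z1]
          simp only [hd1e, ha2e, Units.val_mk0]
          rw [hc12] at z12
          linear_combination z12
        rw [hsu (Or.inl z12), hz, hy]
        have e1 := hu hd12v hd12v
        have e2 := H.skew d12 (kubotaX g)
        have e3 := hu hd12v ha2v
        have e4 := hu hd12v hd1v
        have e5 := hu hd1v hd2v
        have e6 := hu ha2v hd2v
        have e7 := had (kubotaX g)
        have e8 := hdd (kubotaX g)
        have e9 := hu (a := d12) (b := -1) hd12v ((val_eq_zero_iff _).2 (by simp))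
        have e10 := H.self_neg (kubotaX g)
        have e11 := hu (a := -1) (b := d2) ((val_eq_zero_iff _).2 (by simp)) hd2v
        have e12 : -kubotaX g = (-1) * kubotaX g := by rw [neg_one_mul]
        rw [e12] at e10 ⊢
        try simp only [H.mul_left, H.mul_right, H.div_left, H.div_right] at e1
        try simp only [H.mul_left, H.mul_right, H.div_left, H.div_right] at e2
        try simp only [H.mul_left, H.mul_right, H.div_left, H.div_right] at e3
        try simp only [H.mul_left, H.mul_right, H.div_left, H.div_right] at e4
        try simp only [H.mul_left, H.mul_right, H.div_left, H.div_right] at e5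
        try simp only [H.mul_left, H.mul_right, H.div_left, H.div_right] at e6
        try simp only [H.mul_left, H.mul_right, H.div_left, H.div_right] at e7
        try simp only [H.mul_left, H.mul_right, H.div_left, H.div_right] at e8
        try simp only [H.mul_left, H.mul_right, H.div_left, H.div_right] at e9
        try simp only [H.mul_left, H.mul_right, H.div_left, H.div_right] at e10
        try simp only [H.mul_left, H.mul_right, H.div_left, H.div_right] at e11
        try simp only [H.mul_left, H.mul_right, H.div_left, H.div_right] at e12
        simp only [H.mul_left, H.mul_right, H.div_left, H.div_right]
        clear hβ hsu hss hc hu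
        grind
      · rw [hss z12 h12 d12 rfl]
        have hst : h (kubotaX g * a2 / kubotaX (g * k)) (d1 * kubotaX k / kubotaX (g * k)) = 0 := by
          apply H.steinberg
          push_cast
          rw [← add_div, div_eq_one_iff_eq (Units.ne_zero _), kubotaX_of_ne z12, kubotaX_of_ne z1,
            kubotaX_of_ne z2, hc12]
          rfl
        have e0 := hdd (kubotaX (g * k))
        have e1 := had (kubotaX k)
        have e2 := had (kubotaX (g * k))
        have e3 := hu ha2v hd1v
        have e4 := H.skew a2 (kubotaX k)
        have e5 := H.skew a2 (kubotaX (g * k))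
        have e6 := H.skew d1 (kubotaX (g * k))
        try simp only [H.mul_left, H.mul_right, H.div_left, H.div_right] at hst
        try simp only [H.mul_left, H.mul_right, H.div_left, H.div_right] at e0
        try simp only [H.mul_left, H.mul_right, H.div_left, H.div_right] at e1
        try simp only [H.mul_left, H.mul_right, H.div_left, H.div_right] at e2
        try simp only [H.mul_left, H.mul_right, H.div_left, H.div_right] at e3
        try simp only [H.mul_left, H.mul_right, H.div_left, H.div_right] at e4
        try simp only [H.mul_left, H.mul_right, H.div_left, H.div_right] at e5
        try simp only [H.mul_left, H.mul_right, H.div_left, H.div_right] at e6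
        simp only [H.mul_left, H.mul_right, H.div_left, H.div_right]
        clear hβ hsu hss hc hu
        grind
    · -- `k` has a unit in its lower left corner
      have h12 : valuation F ((g * k) 1 0) = 1 := by
        rw [hc12, Valuation.map_add_eq_of_lt_right]
        · rw [map_mul, hd1, h2, one_mul]
        · rw [map_mul, map_mul, hd1, h2, one_mul]; exact lt_one_left h1 (hk' 0 0)
      have hzv := kubotaX_unit hgk (Or.inr h12)
      have hyv := kubotaX_unit hk (Or.inr h2)
      rw [hsu (Or.inr h12), hsu (Or.inr h2)]
      by_cases z1 : g 1 0 = 0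
      · have hxv := kubotaX_unit hg (Or.inl z1)
        rw [hsu (Or.inl z1), hu]
        · simp
        · rw [val_div]; omega
        · rw [val_div]; omega
      · rw [hss z1 h1 d1 rfl]
        have hz0 : (g * k) 1 0 ≠ 0 := fun h0 => by simp [h0] at h12
        have hk0 : k 1 0 ≠ 0 := fun h0 => by simp [h0] at h2
        have e1 : h (kubotaX g) (kubotaX (g * k)) = h (kubotaX g) (d1 * kubotaX k) := by
          refine hc _ ?_ ?_
          · rw [Units.val_mul, map_mul, kubotaX_of_ne hk0, h2, mul_one]; exact hd1
          · have : (kubotaX (g * k) : F) - (d1 * kubotaX k : Fˣ) = g 1 0 * k 0 0 := by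
              rw [Units.val_mul, kubotaX_of_ne hz0, kubotaX_of_ne hk0, hc12]
              simp [hd1e]
            rw [this, map_mul]; exact lt_one_left h1 (hk' 0 0)
        have e2 := hu hzv hzv
        have e3 := hu hzv hyv
        try simp only [H.mul_left, H.mul_right, H.div_left, H.div_right] at e1
        try simp only [H.mul_left, H.mul_right, H.div_left, H.div_right] at e2
        try simp only [H.mul_left, H.mul_right, H.div_left, H.div_right] at e3
        simp only [H.mul_left, H.mul_right, H.div_left, H.div_right]
        clear hβ hsu hss hc hu
        grind
  · have hxv := kubotaX_unit hg (Or.inr h1)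
    have hg0 : g 1 0 ≠ 0 := fun h0 => by simp [h0] at h1
    rw [hsu (Or.inr h1)]
    rcases (hk' 1 0).lt_or_eq with h2 | h2
    · obtain ⟨ha2, hd2⟩ := diag_unit hk h2
      have hd2' : k 1 1 ≠ 0 := fun h0 => by simp [h0] at hd2
      set d2 : Fˣ := Units.mk0 (k 1 1) hd2' with hd2e
      have hd2v : val d2 = 0 := (val_eq_zero_iff _).2 hd2
      have h12 : valuation F ((g * k) 1 0) = 1 := by
        rw [hc12, Valuation.map_add_eq_of_lt_left]
        · rw [map_mul, ha2, h1, one_mul]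
        · rw [map_mul, map_mul, ha2, h1, one_mul]; exact lt_one_right (hg' 1 1) h2
      have hz0 : (g * k) 1 0 ≠ 0 := fun h0 => by simp [h0] at h12
      have hzv := kubotaX_unit hgk (Or.inr h12)
      rw [hsu (Or.inr h12)]
      by_cases z2 : k 1 0 = 0
      · have hyv := kubotaX_unit hk (Or.inl z2)
        rw [hsu (Or.inl z2), hu]
        · simp
        · rw [val_div]; omega
        · rw [val_div]; omega
      · rw [hss z2 h2 d2 rfl]
        have e1 : h (kubotaX k) (kubotaX (g * k) * d2) = h (kubotaX k) (kubotaX g) := by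
          refine hc _ ?_ ?_
          · rw [kubotaX_of_ne hg0]; exact h1
          · have : ((kubotaX (g * k) * d2 : Fˣ) : F) - kubotaX g =
                (g 1 0 * k 0 1 + g 1 1 * k 1 1) * k 1 0 := by
              rw [Units.val_mul, kubotaX_of_ne hz0, kubotaX_of_ne hg0, hc12]
              simp only [hd2e, Units.val_mk0]
              linear_combination (g 1 0) * det_eq k
            rw [this, ← hd12, map_mul]; exact lt_one_right (hgk' 1 1) h2
        have e2 := hu hzv hzv
        have e3 := hu hxv hzv
        have e4 := H.skew (kubotaX k) (kubotaX (g * k))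
        have e5 := H.skew (kubotaX k) (kubotaX g)
        try simp only [H.mul_left, H.mul_right, H.div_left, H.div_right] at e1
        try simp only [H.mul_left, H.mul_right, H.div_left, H.div_right] at e2
        try simp only [H.mul_left, H.mul_right, H.div_left, H.div_right] at e3
        try simp only [H.mul_left, H.mul_right, H.div_left, H.div_right] at e4
        try simp only [H.mul_left, H.mul_right, H.div_left, H.div_right] at e5
        simp only [H.mul_left, H.mul_right, H.div_left, H.div_right]
        clear hβ hsu hss hc hu
        grind
    · have hk0 : k 1 0 ≠ 0 := fun h0 => by simp [h0] at h2
      have hyv := kubotaX_unit hk (Or.inr h2)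
      rw [hsu (Or.inr h2)]
      by_cases h12 : (g * k) 1 0 = 0 ∨ valuation F ((g * k) 1 0) = 1
      · have hzv := kubotaX_unit hgk h12
        rw [hsu h12, hu]
        · simp
        · rw [val_div]; omega
        · rw [val_div]; omega
      · push Not at h12
        have h12' := lt_of_le_of_ne (hgk' 1 0) h12.2
        obtain ⟨-, hd12u⟩ := diag_unit hgk h12'
        have hd12' : (g * k) 1 1 ≠ 0 := fun h0 => by simp [h0] at hd12u
        set d12 : Fˣ := Units.mk0 ((g * k) 1 1) hd12' with hd12e
        rw [hss h12.1 h12' d12 rfl]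
        have e1 : h (kubotaX (g * k)) (d12 * kubotaX k) =
            h (kubotaX (g * k)) ((-1) * kubotaX g) := by
          refine hc _ ?_ ?_
          · push_cast
            rw [neg_one_mul, Valuation.map_neg, kubotaX_of_ne hg0]; exact h1
          · have : ((d12 * kubotaX k : Fˣ) : F) - ((-1) * kubotaX g : Fˣ) =
                (g * k) 1 0 * k 1 1 := by
              push_cast
              rw [kubotaX_of_ne hg0, kubotaX_of_ne hk0, hc12]
              simp only [hd12e, Units.val_mk0, hd12]
              linear_combination -(g 1 0) * det_eq k
            rw [this, map_mul]; exact lt_one_left h12' (hk' 1 1)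
        have e2 := hu hxv hyv
        have e3 := H.skew (kubotaX g) (kubotaX (g * k))
        have e4 := H.mul_neg_one (kubotaX (g * k))
        have e5 := H.self_add_self (kubotaX (g * k))
        have e6 : h (kubotaX (g * k)) (-1) = h (kubotaX (g * k)) (kubotaX (g * k)) :=
          (eq_neg_of_add_eq_zero_left e4).trans (neg_eq_of_add_eq_zero_left e5)
        simp only [H.mul_left, H.mul_right, H.div_left, H.div_right, e6] at e1 ⊢
        linear_combination (norm := module) (-1 : ℤ) • e1 - (1 : ℤ) • e3 + (1 : ℤ) • e2

end Splitting

/-! ### Subgroups of the covering group and its topology -/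

section Subgroups

open Matrix

variable {F : Type*} [Field F] [ValuativeRel F] [TopologicalSpace F] [IsNonarchimedeanLocalField F]

theorem sl2_ext {F : Type*} [Field F] {g k : SpecialLinearGroup (Fin 2) F} (h00 : g 0 0 = k 0 0)
    (h01 : g 0 1 = k 0 1) (h10 : g 1 0 = k 1 0) (h11 : g 1 1 = k 1 1) : g = k := by
  apply Subtype.ext
  ext i j
  fin_cases i <;> fin_cases j
  exacts [h00, h01, h10, h11]

/-- The matrix `diag(t, t⁻¹)`. -/
def dgMat {F : Type*} [Field F] (t : Fˣ) : SpecialLinearGroup (Fin 2) F :=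
  ⟨!![(t : F), 0; 0, ((t⁻¹ : Fˣ) : F)], by simp [Matrix.det_fin_two]⟩

theorem dgMat_mul {F : Type*} [Field F] (a b : Fˣ) : dgMat (a * b) = dgMat a * dgMat b := by
  apply sl2_ext <;> rw [mul_entry]
  · change ((a * b : Fˣ) : F) = a * b + 0 * 0
    push_cast; ring
  · change (0 : F) = a * 0 + 0 * ((b⁻¹ : Fˣ) : F)
    ring
  · change (0 : F) = 0 * b + ((a⁻¹ : Fˣ) : F) * 0
    ring
  · change (((a * b)⁻¹ : Fˣ) : F) = 0 * 0 + ((a⁻¹ : Fˣ) : F) * ((b⁻¹ : Fˣ) : F)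
    rw [mul_inv, Units.val_mul]; ring

/-- `dg(t) = diag(t, t⁻¹)`, as a homomorphism. -/
def dg {F : Type*} [Field F] : Fˣ →* SpecialLinearGroup (Fin 2) F :=
  MonoidHom.mk' dgMat dgMat_mul

theorem dg_00 {F : Type*} [Field F] (t : Fˣ) : dg t 0 0 = (t : F) := rfl

theorem dg_01 {F : Type*} [Field F] (t : Fˣ) : dg t 0 1 = (0 : F) := rfl

theorem dg_10 {F : Type*} [Field F] (t : Fˣ) : dg t 1 0 = (0 : F) := rfl

theorem dg_11 {F : Type*} [Field F] (t : Fˣ) : dg t 1 1 = ((t⁻¹ : Fˣ) : F) := rfl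

theorem kubotaX_dg (t : Fˣ) : kubotaX (dg t) = t⁻¹ :=
  Units.ext (by rw [kubotaX_of_eq (dg_10 t), dg_11])

/-- The standard Borel subgroup `B¹` of upper triangular matrices. -/
def borel (F : Type*) [Field F] : Subgroup (SpecialLinearGroup (Fin 2) F) where
  carrier := {g | g 1 0 = 0}
  one_mem' := by simp
  mul_mem' {a b} ha hb := by
    simp only [Set.mem_ofPred_eq] at *
    rw [mul_entry, ha, hb]; ring
  inv_mem' {a} ha := by
    simp only [Set.mem_ofPred_eq] at *
    rw [SpecialLinearGroup.SL2_inv_expl]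
    simpa using ha

theorem mem_borel {F : Type*} [Field F] {g : SpecialLinearGroup (Fin 2) F} :
    g ∈ borel F ↔ g 1 0 = 0 := Iff.rfl

variable (F) in
/-- The inverse image `T̃¹` of the diagonal torus. -/
def torusCover (n : ℕ) [Fact (n ∣ Nat.card 𝓀[F] - 1)] : Subgroup (MetaSL2 F n) :=
  (dg (F := F)).range.comap (MetaSL2.proj F n)

variable (F) in
/-- The inverse image `B̃¹` of the standard Borel subgroup. -/
def borelCover (n : ℕ) [Fact (n ∣ Nat.card 𝓀[F] - 1)] : Subgroup (MetaSL2 F n) :=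
  (borel F).comap (MetaSL2.proj F n)

variable (F) in
/-- The inverse image `K̃¹` of `K¹ = SL₂(𝒪)`. -/
def compactCover (n : ℕ) [Fact (n ∣ Nat.card 𝓀[F] - 1)] : Subgroup (MetaSL2 F n) :=
  (maxCompact F).comap (MetaSL2.proj F n)

variable {n : ℕ} [Fact (n ∣ Nat.card 𝓀[F] - 1)]

theorem sec_congruence {j : ℕ+} {g : SpecialLinearGroup (Fin 2) F} (hg : g ∈ congruence F j) :
    sec n g = 1 := by
  by_cases h0 : g 1 0 = 0
  · exact sec_of_zero h0
  have hc : valuation F (g 1 0) < 1 := by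
    obtain ⟨x, hx, he⟩ := mem_congruence_iff.1 hg 1 0
    have := valuation_lt_one_of_mem hx
    rw [he] at this
    simpa using this
  have hd : valuation F (g 1 1 - 1) < 1 := by
    obtain ⟨x, hx, he⟩ := mem_congruence_iff.1 hg 1 1
    have := valuation_lt_one_of_mem hx
    rw [he] at this
    simpa using this
  have hd' := (diag_unit (congruence_le j hg) hc).2
  have hne : g 1 1 ≠ 0 := fun h => by simp [h] at hd'
  rw [sec_of h0 hc (Units.mk0 _ hne) rfl]
  exact hilbert_one_add n _ hd

variable (F n) in
/-- `K¹ⱼ`, identified with the subgroup `K¹ⱼ × {1}` of the covering group. -/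
def congruenceCover (j : ℕ+) : Subgroup (MetaSL2 F n) where
  carrier := {x | x.base ∈ congruence F j ∧ x.root = 1}
  one_mem' := ⟨one_mem _, rfl⟩
  mul_mem' {x y} hx hy := by
    refine ⟨mul_mem hx.1 hy.1, ?_⟩
    have h := kubota_mul_sec (n := n) (congruence_le j hx.1) (congruence_le j hy.1)
    rw [sec_congruence hx.1, sec_congruence hy.1, sec_congruence (mul_mem hx.1 hy.1),
      mul_one, mul_one] at h
    rw [MetaSL2.root_mul, hx.2, hy.2, h]; simp
  inv_mem' {x} hx := by
    refine ⟨inv_mem hx.1, ?_⟩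
    have h := kubota_mul_sec (n := n) (congruence_le j (inv_mem hx.1)) (congruence_le j hx.1)
    rw [sec_congruence hx.1, sec_congruence (inv_mem hx.1),
      sec_congruence (mul_mem (inv_mem hx.1) hx.1), mul_one, mul_one] at h
    rw [MetaSL2.root_inv, hx.2, h]; simp

theorem mem_congruenceCover {j : ℕ+} {x : MetaSL2 F n} :
    x ∈ congruenceCover F n j ↔ x.base ∈ congruence F j ∧ x.root = 1 := Iff.rfl

theorem congruenceCover_anti {i j : ℕ+} (h : i ≤ j) :
    congruenceCover F n j ≤ congruenceCover F n i :=
  fun _ hx => ⟨congruence_anti h hx.1, hx.2⟩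

theorem congruenceCover_conj {j : ℕ+} {k x : MetaSL2 F n} (hk : k ∈ compactCover F n)
    (hx : x ∈ congruenceCover F n j) : k * x * k⁻¹ ∈ congruenceCover F n j := by
  have hk' : k.base ∈ maxCompact F := hk
  have hy : k.base * x.base * k.base⁻¹ ∈ congruence F j := congruence_conj hk' hx.1
  have e : k * x = ⟨k.base * x.base * k.base⁻¹, 1⟩ * k := by
    apply MetaSL2.ext
    · simp [MetaSL2.base_mul]
    · rw [MetaSL2.root_mul, MetaSL2.root_mul, hx.2, mul_one, mul_one]
      congr 1
      have h1 := kubota_mul_sec (n := n) hk' (congruence_le j hx.1)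
      have h2 := kubota_mul_sec (n := n) (congruence_le j hy) hk'
      rw [sec_congruence hx.1, mul_one] at h1
      rw [sec_congruence hy, mul_one, inv_mul_cancel_right, ← h1] at h2
      exact (mul_right_cancel h2).symm
  rw [e, mul_inv_cancel_right]
  exact ⟨hy, rfl⟩

instance (j : ℕ+) : ((congruenceCover F n j).subgroupOf (compactCover F n)).Normal where
  conj_mem x hx k := by
    rw [Subgroup.mem_subgroupOf] at hx ⊢
    exact congruenceCover_conj k.2 hx

/-- Conjugation by an element of the torus maps a small congruence subgroup into a given one. -/
theorem congruenceCover_conj_torus (t : Fˣ) (ζ : rootsOfUnity n 𝓀[F]) (j : ℕ+) :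
    ∃ j' : ℕ+, ∀ x ∈ congruenceCover F n j',
      (⟨dg t, ζ⟩ : MetaSL2 F n) * x * (⟨dg t, ζ⟩ : MetaSL2 F n)⁻¹ ∈ congruenceCover F n j := by
  obtain ⟨p, hp⟩ := IsDiscreteValuationRing.exists_irreducible 𝒪[F]
  have hm : 𝓂[F] = Ideal.span {p} := hp.maximalIdeal_eq
  -- `t²` and `t⁻²` become integral after multiplication by a power of the uniformizer
  have key : ∀ u : Fˣ, ∃ N : ℕ, ∀ M : ℕ, N + M ≥ N → ∀ x ∈ 𝓂[F] ^ (N + M),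
      ∃ y ∈ 𝓂[F] ^ M, (y : F) = u * x := by
    intro u
    obtain ⟨a, b, hb, hab⟩ := IsFractionRing.div_surjective (A := 𝒪[F]) (u : F)
    have hb0 : b ≠ 0 := nonZeroDivisors.ne_zero hb
    obtain ⟨N, v, hv⟩ := IsDiscreteValuationRing.eq_unit_mul_pow_irreducible hb0 hp
    refine ⟨N, fun M _ x hx => ?_⟩
    rw [hm, Ideal.span_singleton_pow, Ideal.mem_span_singleton] at hx
    obtain ⟨c, rfl⟩ := hx
    refine ⟨a * (v⁻¹ : 𝒪[F]ˣ) * p ^ M * c, ?_, ?_⟩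
    · rw [hm, Ideal.span_singleton_pow, Ideal.mem_span_singleton]
      exact ⟨a * (v⁻¹ : 𝒪[F]ˣ) * c, by ring⟩
    · have hbF : (b : F) ≠ 0 := fun h => hb0 (Subtype.ext h)
      have e1 : (u : F) * b = a := by
        rw [← hab]; exact div_mul_cancel₀ _ hbF
      have e2 : (a * (v⁻¹ : 𝒪[F]ˣ) * p ^ M * c : 𝒪[F]) * b = a * (p ^ (N + M) * c) := by
        rw [hv]
        have : ((v⁻¹ : 𝒪[F]ˣ) : 𝒪[F]) * v = 1 := by simp
        linear_combination (a * p ^ M * c * p ^ N) * this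
      have e3 := congrArg (Subtype.val) e2
      apply mul_right_cancel₀ hbF
      calc _ = (((a * (v⁻¹ : 𝒪[F]ˣ) * p ^ M * c : 𝒪[F]) * b : 𝒪[F]) : F) := rfl
        _ = _ := by rw [e3]; push_cast; rw [← e1]; ring
  obtain ⟨N₁, h₁⟩ := key (t ^ 2)
  obtain ⟨N₂, h₂⟩ := key ((t ^ 2)⁻¹)
  refine ⟨⟨N₁ + N₂ + j, by positivity⟩, fun x hx => ?_⟩
  set y : SpecialLinearGroup (Fin 2) F := dg t * x.base * (dg t)⁻¹ with hy
  have hxe := mem_congruence_iff.1 hx.1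
  have y00 : y 0 0 = x.base 0 0 := by
    rw [hy, ← map_inv]; simp only [mul_entry, dg_00, dg_01, dg_10, dg_11, inv_inv]; push_cast; field_simp; ring
  have y11 : y 1 1 = x.base 1 1 := by
    rw [hy, ← map_inv]; simp only [mul_entry, dg_00, dg_01, dg_10, dg_11, inv_inv]; push_cast; field_simp; ring
  have y01 : y 0 1 = t ^ 2 * x.base 0 1 := by
    rw [hy, ← map_inv]; simp only [mul_entry, dg_00, dg_01, dg_10, dg_11, inv_inv]; push_cast; ring
  have y10 : y 1 0 = ((t ^ 2)⁻¹ : Fˣ) * x.base 1 0 := by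
    rw [hy, ← map_inv]; simp only [mul_entry, dg_00, dg_01, dg_10, dg_11, inv_inv]; push_cast; ring
  have hyj : y ∈ congruence F j := by
    rw [mem_congruence_iff]
    intro i k
    obtain ⟨z, hz, hze⟩ := hxe i k
    have hz1 : z ∈ 𝓂[F] ^ (j : ℕ) := Ideal.pow_le_pow_right (by simp) hz
    fin_cases i <;> fin_cases k
    · exact ⟨z, hz1, by rw [hze]; simp [y00]⟩
    · obtain ⟨w, hw, hwe⟩ := h₁ (N₂ + j) (by simp) z (by simpa [add_assoc] using hz)
      refine ⟨w, Ideal.pow_le_pow_right (by simp) hw, ?_⟩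
      rw [hwe, hze]; simp [y01]
    · obtain ⟨w, hw, hwe⟩ := h₂ (N₁ + j) (by simp) z (by
        have e : N₂ + (N₁ + (j : ℕ)) = N₁ + N₂ + j := by ring
        rw [e]; exact hz)
      refine ⟨w, Ideal.pow_le_pow_right (by simp) hw, ?_⟩
      rw [hwe, hze]; simp [y10]
    · exact ⟨z, hz1, by rw [hze]; simp [y11]⟩
  have e : (⟨dg t, ζ⟩ : MetaSL2 F n) * x = ⟨y, 1⟩ * ⟨dg t, ζ⟩ := by
    apply MetaSL2.ext
    · simp [MetaSL2.base_mul, hy]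
    · rw [MetaSL2.root_mul, MetaSL2.root_mul, hx.2, mul_one, mul_one]
      congr 1
      have hyd : y * dg t = dg t * x.base := by rw [hy, inv_mul_cancel_right]
      have hX : kubotaX (dg t * x.base) = t⁻¹ * kubotaX x.base := by
        rw [kubotaX_mul_of_left (dg_10 t), kubotaX_dg]
      change hilbert n _ _ = hilbert n _ _
      simp only [hyd, hX, kubotaX_dg]
      have s1 : t⁻¹ * kubotaX x.base / t⁻¹ = kubotaX x.base := by
        rw [mul_div_assoc, mul_div_cancel]
      have s2 : t⁻¹ * kubotaX x.base / kubotaX x.base = t⁻¹ := by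
        rw [mul_div_assoc, div_self', mul_one]
      rw [s1, s2]
      have hsk := hilbert_skew n (kubotaX x.base) t⁻¹
      by_cases h0 : x.base 1 0 = 0
      · have hXy : kubotaX y = kubotaX x.base := Units.ext (by
          rw [kubotaX_of_eq h0, kubotaX_of_eq (by rw [y10, h0, mul_zero]), y11])
        rw [hXy, s2]
        have h1 : ∀ s, hilbert n s (kubotaX x.base) = 1 := fun s => by
          apply hilbert_one_add
          rw [kubotaX_of_eq h0]
          obtain ⟨z, hz, hze⟩ := hxe 1 1
          have := valuation_lt_one_of_mem hz
          rw [hze] at this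
          simpa using this
        rw [h1, mul_one] at hsk
        rw [h1, hsk]
      · have hXy : kubotaX y = (t ^ 2)⁻¹ * kubotaX x.base := Units.ext (by
          have hne : y 1 0 ≠ 0 := by rw [y10]; exact mul_ne_zero (Units.ne_zero _) h0
          rw [Units.val_mul, kubotaX_of_ne hne, kubotaX_of_ne h0, y10])
        have s3 : t⁻¹ * kubotaX x.base / kubotaX y = t := by
          rw [hXy, mul_div_mul_right_eq_div]
          rw [div_inv_eq_mul, pow_two, inv_mul_cancel_left]
        rw [s3]
        rw [map_inv]
        exact inv_eq_of_mul_eq_one_right (hilbert_skew n _ t)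
  rw [e, mul_inv_cancel_right]
  exact ⟨hyj, rfl⟩

/-- The upper unipotent matrix with entry `b`. -/
def upper {F : Type*} [Field F] (b : F) : SpecialLinearGroup (Fin 2) F :=
  ⟨!![1, b; 0, 1], by simp [Matrix.det_fin_two]⟩

theorem upper_00 {F : Type*} [Field F] (b : F) : upper b 0 0 = 1 := rfl

theorem upper_01 {F : Type*} [Field F] (b : F) : upper b 0 1 = b := rfl

theorem upper_10 {F : Type*} [Field F] (b : F) : upper b 1 0 = 0 := rfl

theorem upper_11 {F : Type*} [Field F] (b : F) : upper b 1 1 = 1 := rfl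

theorem congruenceCover_conj_all (x : MetaSL2 F n) (j : ℕ+) :
    ∃ j' : ℕ+, ∀ y ∈ congruenceCover F n j', x * y * x⁻¹ ∈ congruenceCover F n j := by
  let P : MetaSL2 F n → Prop := fun x => ∀ j : ℕ+, ∃ j' : ℕ+, ∀ y ∈ congruenceCover F n j',
    x * y * x⁻¹ ∈ congruenceCover F n j
  have Pmul : ∀ a b, P a → P b → P (a * b) := fun a b ha hb j => by
    obtain ⟨j₁, h₁⟩ := ha j
    obtain ⟨j₂, h₂⟩ := hb j₁
    refine ⟨j₂, fun y hy => ?_⟩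
    have := h₁ _ (h₂ y hy)
    rw [_root_.mul_inv_rev]
    simpa only [mul_assoc] using this
  have PK : ∀ a ∈ compactCover F n, P a := fun a ha j => ⟨j, fun y hy =>
    congruenceCover_conj ha hy⟩
  have PT : ∀ (t : Fˣ) ζ, P ⟨dg t, ζ⟩ := fun t ζ j => congruenceCover_conj_torus t ζ j
  -- being in `P` only depends on the matrix
  let Q : SpecialLinearGroup (Fin 2) F → Prop := fun g => ∀ x : MetaSL2 F n, x.base = g → P x
  have Qof : ∀ a : MetaSL2 F n, P a → Q a.base := fun a ha x hx => by
    have : x = a * (⟨1, a.root⁻¹ * x.root⟩ : MetaSL2 F n) := by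
      apply MetaSL2.ext
      · rw [MetaSL2.base_mul, mul_one, hx]
      · rw [MetaSL2.root_mul, kubota_one_right]; simp
    rw [this]
    exact Pmul _ _ ha (PK _ (one_mem (maxCompact F)))
  have Qmul : ∀ a b, Q a → Q b → Q (a * b) := fun a b ha hb =>
    Qof (⟨a, 1⟩ * ⟨b, 1⟩) (Pmul _ _ (ha _ rfl) (hb _ rfl))
  have QK : ∀ k ∈ maxCompact F, Q k := fun k hk => Qof ⟨k, 1⟩ (PK _ hk)
  have QT : ∀ t, Q (dg t) := fun t => Qof ⟨dg t, 1⟩ (PT t 1)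
  have QN : ∀ b : F, Q (upper b) := fun b => by
    by_cases hb : valuation F b ≤ 1
    · apply QK
      rw [mem_maxCompact_iff]
      intro i k
      fin_cases i <;> fin_cases k <;> simp [upper, hb]
    · have hb0 : b ≠ 0 := fun h => hb (by simp [h])
      have hbi : valuation F (b⁻¹) ≤ 1 := by
        rw [map_inv₀]; exact inv_le_one_of_one_le₀ (not_le.1 hb).le
      have e : upper b = dg (Units.mk0 b hb0) * upper b⁻¹ * dg (Units.mk0 b hb0)⁻¹ := by
        apply sl2_ext <;> simp only [mul_entry, dg_00, dg_01, dg_10, dg_11, upper_00, upper_01, upper_10, upper_11] <;> simp [hb0]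
      rw [e]
      refine Qmul _ _ (Qmul _ _ (QT _) (QK _ ?_)) (QT _)
      rw [mem_maxCompact_iff]
      intro i k
      rw [map_inv₀] at hbi
      fin_cases i <;> fin_cases k <;> simp [upper, hbi]
  have Qall : ∀ g, Q g := fun g => by
    by_cases h0 : g 1 0 = 0
    · have hdet : g 0 0 * g 1 1 = 1 := by have := det_eq g; rw [h0] at this; linear_combination this
      have ha : g 0 0 ≠ 0 := left_ne_zero_of_mul_eq_one hdet
      have hd : g 1 1 = (g 0 0)⁻¹ := eq_inv_of_mul_eq_one_right hdet
      have e : g = dg (Units.mk0 (g 0 0) ha) * upper ((g 0 0)⁻¹ * g 0 1) := by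
        apply sl2_ext <;> simp only [mul_entry, dg_00, dg_01, dg_10, dg_11, upper_00, upper_01, upper_10, upper_11] <;> simp [h0, hd, ha]
      rw [e]
      exact Qmul _ _ (QT _) (QN _)
    · let w : SpecialLinearGroup (Fin 2) F := ⟨!![0, 1; -1, 0], by simp [Matrix.det_fin_two]⟩
      have hw : w ∈ maxCompact F := by
        rw [mem_maxCompact_iff]
        intro i k
        fin_cases i <;> fin_cases k <;> simp [w]
      have e : g = upper (g 0 0 / g 1 0) * dg (-(Units.mk0 (g 1 0) h0)⁻¹) * w *
          upper (g 1 1 / g 1 0) := by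
        have hdet := det_eq g
        have w00 : w 0 0 = 0 := rfl
        have w01 : w 0 1 = 1 := rfl
        have w10 : w 1 0 = -1 := rfl
        have w11 : w 1 1 = 0 := rfl
        apply sl2_ext <;> simp only [mul_entry, dg_00, dg_01, dg_10, dg_11, upper_00, upper_01, upper_10, upper_11, w00, w01, w10, w11, inv_neg, inv_inv] <;>
          push_cast <;> simp only [Units.val_mk0] <;> field_simp <;> try ring1
        linear_combination -(g 1 0) * hdet
      rw [e]
      exact Qmul _ _ (Qmul _ _ (Qmul _ _ (QN _) (QT _)) (QK _ hw)) (QN _)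
  exact Qall x.base x rfl j

variable (F n) in
/-- The subgroups `K¹ⱼ` form a basis of neighbourhoods of `1` for a group topology. -/
@[reducible]
def congruenceBasis : GroupFilterBasis (MetaSL2 F n) where
  sets := {S | ∃ j : ℕ+, S = congruenceCover F n j}
  nonempty := ⟨_, 1, rfl⟩
  inter_sets := by
    rintro _ _ ⟨i, rfl⟩ ⟨j, rfl⟩
    exact ⟨_, ⟨max i j, rfl⟩, fun x hx => ⟨congruenceCover_anti (le_max_left i j) hx,
      congruenceCover_anti (le_max_right i j) hx⟩⟩
  one' := by rintro _ ⟨j, rfl⟩; exact one_mem _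
  mul' := by
    rintro _ ⟨j, rfl⟩
    refine ⟨_, ⟨j, rfl⟩, ?_⟩
    rintro _ ⟨x, hx, y, hy, rfl⟩
    exact mul_mem hx hy
  inv' := by
    rintro _ ⟨j, rfl⟩
    exact ⟨_, ⟨j, rfl⟩, fun x hx => inv_mem (show x ∈ congruenceCover F n j from hx)⟩
  conj' := by
    rintro x _ ⟨j, rfl⟩
    obtain ⟨j', h⟩ := congruenceCover_conj_all x j
    exact ⟨_, ⟨j', rfl⟩, fun y hy => h y hy⟩

/-- The topology of the covering group, in which the `K¹ⱼ`, `j ≥ 1`, form a basis of (compact open)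
neighbourhoods of the identity. -/
instance : TopologicalSpace (MetaSL2 F n) := (congruenceBasis F n).topology

instance : IsTopologicalGroup (MetaSL2 F n) := (congruenceBasis F n).isTopologicalGroup

end Subgroups

/-! ### The torus and its characters -/

section Torus

open Matrix

variable {F : Type*} [Field F] [ValuativeRel F] [TopologicalSpace F] [IsNonarchimedeanLocalField F]
variable {n : ℕ} [Fact (n ∣ Nat.card 𝓀[F] - 1)]

/-- The projection `B̃¹ → T̃¹` with kernel the unipotent radical `N¹ × {1}`; it is the identity on
`T̃¹`. Inflation along it extends a representation of `T̃¹` trivially over `N¹`. -/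
def torusProj : borelCover F n →* torusCover F n where
  toFun b := ⟨⟨dg (kubotaX b.1.base)⁻¹, b.1.root⟩, ⟨_, rfl⟩⟩
  map_one' := by
    apply Subtype.ext
    apply MetaSL2.ext
    · change dg (kubotaX 1)⁻¹ = 1
      rw [kubotaX_one, inv_one, map_one]
    · rfl
  map_mul' a b := by
    have ha : a.1.base 1 0 = 0 := a.2
    have e := kubotaX_mul_of_left (k := b.1.base) ha
    apply Subtype.ext
    apply MetaSL2.ext
    · change dg (kubotaX (a.1.base * b.1.base))⁻¹ = dg _ * dg _
      rw [e, mul_inv, map_mul]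
    · change kubota n a.1.base b.1.base * a.1.root * b.1.root =
        kubota n (dg _) (dg _) * a.1.root * b.1.root
      congr 2
      unfold kubota
      rw [e, ← map_mul, kubotaX_dg, kubotaX_dg, kubotaX_dg, ← mul_inv, inv_inv, inv_inv, inv_inv]

theorem torusProj_eq_self (b : borelCover F n) (hb : b.1 ∈ torusCover F n) :
    (torusProj b : MetaSL2 F n) = b := by
  obtain ⟨t, ht⟩ := hb
  apply MetaSL2.ext
  · have ht' : dg t = b.1.base := ht
    change dg (kubotaX b.1.base)⁻¹ = b.1.base
    rw [← ht', kubotaX_dg, inv_inv]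
  · rfl

variable (F n) in
/-- The coordinate `(dg(t), ζ) ↦ t` on `T̃¹`. -/
def torusCoord : torusCover F n →* Fˣ where
  toFun x := (kubotaX x.1.base)⁻¹
  map_one' := by
    change (kubotaX 1)⁻¹ = 1
    rw [kubotaX_one, inv_one]
  map_mul' x y := by
    obtain ⟨t, ht⟩ := x.2
    have ht' : dg t = x.1.base := ht
    change (kubotaX (x.1.base * y.1.base))⁻¹ = _
    rw [kubotaX_mul_of_left (by rw [← ht']; exact dg_10 t), mul_inv]

theorem dg_torusCoord (x : torusCover F n) : dg (torusCoord F n x) = x.1.base := by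
  obtain ⟨t, ht⟩ := x.2
  have ht' : dg t = x.1.base := ht
  change dg (kubotaX x.1.base)⁻¹ = _
  rw [← ht', kubotaX_dg, inv_inv]

theorem torusCoord_unit (x : torusCover F n) (hx : x.1 ∈ compactCover F n) :
    val (torusCoord F n x) = 0 := by
  have hx' : x.1.base ∈ maxCompact F := hx
  change val (kubotaX x.1.base)⁻¹ = 0
  rw [val_inv, kubotaX_unit hx' (Or.inl ?_), neg_zero]
  rw [← dg_torusCoord]; exact dg_10 _

variable (F n) in
/-- The group `A = C_{T̃¹}(T̃¹ ∩ K̃¹)`, as a subgroup of `T̃¹`. -/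
def centA : Subgroup (torusCover F n) :=
  Subgroup.centralizer {x | (x : MetaSL2 F n) ∈ compactCover F n}

theorem center_le_centA : Subgroup.center (torusCover F n) ≤ centA F n :=
  Subgroup.center_le_centralizer _

theorem mem_centA_of_compact (x : torusCover F n) (hx : x.1 ∈ compactCover F n) :
    x ∈ centA F n := by
  rw [centA, Subgroup.mem_centralizer_iff]
  intro y hy
  have hxv := torusCoord_unit x hx
  have hyv := torusCoord_unit y hy
  have h : ∀ s t : torusCover F n, val (torusCoord F n s) = 0 → val (torusCoord F n t) = 0 →
      kubota n s.1.base t.1.base = 1 := fun s t hs ht => by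
    unfold kubota
    rw [← dg_torusCoord, ← dg_torusCoord, ← map_mul, kubotaX_dg, kubotaX_dg, kubotaX_dg]
    apply hilbert_unit_unit <;> rw [val_div, val_inv, val_inv, val_mul, hs, ht] <;> rfl
  apply Subtype.ext
  apply MetaSL2.ext
  · change y.1.base * x.1.base = x.1.base * y.1.base
    rw [← dg_torusCoord, ← dg_torusCoord, ← map_mul, mul_comm, map_mul]
  · change kubota n y.1.base x.1.base * y.1.root * x.1.root =
      kubota n x.1.base y.1.base * x.1.root * y.1.root
    rw [h x y hxv hyv, h y x hyv hxv, mul_right_comm]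

variable (F n) in
/-- The inclusion of `μₙ` in `T̃¹`. -/
def inclTorus : rootsOfUnity n 𝓀[F] →* torusCover F n :=
  (MetaSL2.incl F n).codRestrict _ fun _ => ⟨1, map_one _⟩

variable (F n) in
/-- The inclusion of `μₙ` in `A`. -/
def inclA : rootsOfUnity n 𝓀[F] →* centA F n :=
  (inclTorus F n).codRestrict _ fun _ => mem_centA_of_compact _ (one_mem (maxCompact F))

theorem dg_mem_maxCompact (u : integerUnits F) : dg (u : Fˣ) ∈ maxCompact F := by
  rw [mem_maxCompact_iff]
  intro i j
  have h1 := (val_eq_zero_iff _).1 u.2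
  have h2 := (val_eq_zero_iff _).1 (u⁻¹).2
  fin_cases i <;> fin_cases j
  · exact h1.le
  · exact (map_zero (valuation F)).trans_le zero_le
  · exact (map_zero (valuation F)).trans_le zero_le
  · exact h2.le

variable (n) in
/-- The element `(dg(u), 1)` of `A`, for a unit `u`. -/
def unitTorus (u : integerUnits F) : centA F n :=
  ⟨⟨⟨dg u, 1⟩, ⟨u, rfl⟩⟩, mem_centA_of_compact _ (dg_mem_maxCompact u)⟩

/-- The unit `a ϖ^{-val a}`, as an element of `Fˣ`. -/
def unitPart (ϖ : Fˣ) : Fˣ →* Fˣ where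
  toFun a := a * ϖ ^ (-val a)
  map_one' := by simp [val_one]
  map_mul' a b := by
    rw [val_mul, neg_add, _root_.zpow_add]
    exact mul_mul_mul_comm _ _ _ _

/-- The character `χᵢ(dg(a ϖ^{rn̲}), ζ) = χ₀(dg(a ϖ^{rn̲}), (ϖ, a)ₙ^{2i} ζ)` of `A`, with `a` a unit. -/
def twist (χ₀ : centA F n →* ℂˣ) (ϖ : Fˣ) (i : ℕ) : centA F n →* ℂˣ :=
  χ₀ * χ₀.comp ((inclA F n).comp
    (((hilbert n ϖ).comp ((unitPart ϖ).comp ((torusCoord F n).comp (centA F n).subtype))) ^ (2 * i)))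

theorem twist_apply (χ₀ : centA F n →* ℂˣ) (ϖ : Fˣ) (i : ℕ) (x y : centA F n)
    (hb : y.1.1.base = x.1.1.base)
    (hr : y.1.1.root =
      hilbert n ϖ (torusCoord F n x.1 * ϖ ^ (-val (torusCoord F n x.1))) ^ (2 * i) * x.1.1.root) :
    twist χ₀ ϖ i x = χ₀ y := by
  have : y = x * inclA F n
      (hilbert n ϖ (torusCoord F n x.1 * ϖ ^ (-val (torusCoord F n x.1))) ^ (2 * i)) := by
    apply Subtype.ext
    apply Subtype.ext
    apply MetaSL2.ext
    · change _ = x.1.1.base * 1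
      rw [hb, mul_one]
    · change _ = kubota n x.1.1.base 1 * x.1.1.root * _
      rw [hr, kubota_one_right, one_mul, mul_comm]
      rfl
  rw [this, map_mul]
  rfl

end Torus

/-! ### Representations -/

section Representations

variable {G H V : Type*} [Group G] [TopologicalSpace G] [IsTopologicalGroup G]
  [AddCommGroup V] [Module ℂ V]

/-- A representation is smooth if every vector is fixed by a neighbourhood of `1`. -/
def IsSmooth (π : Representation ℂ G V) : Prop :=
  ∀ v, ∀ᶠ g in nhds (1 : G), π g v = v

/-- The subrepresentation of smooth vectors. -/
def smoothVectors (π : Representation ℂ G V) : Subrepresentation π where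
  toSubmodule :=
    { carrier := {v | ∀ᶠ g in nhds (1 : G), π g v = v}
      zero_mem' := Filter.Eventually.of_forall fun g => map_zero _
      add_mem' := fun {v w} hv hw => by
        filter_upwards [hv, hw] with g h1 h2
        rw [map_add, h1, h2]
      smul_mem' := fun c v hv => by
        filter_upwards [hv] with g h
        rw [map_smul, h] }
  apply_mem_toSubmodule g v hv := by
    have hc : Filter.Tendsto (fun h : G => g⁻¹ * h * g) (nhds 1) (nhds 1) := by
      have : Continuous (fun h : G => g⁻¹ * h * g) := by fun_prop
      simpa using this.tendsto 1
    filter_upwards [hc.eventually hv] with h hh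
    calc π h (π g v) = π g (π (g⁻¹ * h * g) v) := by
          rw [← Module.End.mul_apply, ← Module.End.mul_apply, ← map_mul, ← map_mul]
          congr 2
          group
      _ = π g v := by rw [hh]

/-- The space of the smooth (non-normalised) induction of `σ` from a subgroup `S`: the smooth vectors
in the space of functions `f` with `f (h g) = σ(h) f(g)` for `h` in `S`, acted upon by right
translations. -/
def SmoothIndSpace (S : Subgroup G) (σ : Representation ℂ S V) : Type _ :=
  (smoothVectors (Representation.coind S.subtype σ)).toSubmodule

instance (S : Subgroup G) (σ : Representation ℂ S V) : AddCommGroup (SmoothIndSpace S σ) :=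
  inferInstanceAs (AddCommGroup (smoothVectors (Representation.coind S.subtype σ)).toSubmodule)

instance (S : Subgroup G) (σ : Representation ℂ S V) : Module ℂ (SmoothIndSpace S σ) :=
  inferInstanceAs (Module ℂ (smoothVectors (Representation.coind S.subtype σ)).toSubmodule)

/-- Smooth (non-normalised) induction. -/
def smoothInd (S : Subgroup G) (σ : Representation ℂ S V) :
    Representation ℂ G (SmoothIndSpace S σ) :=
  (smoothVectors (Representation.coind S.subtype σ)).toRepresentation

/-- The one-dimensional representation attached to a character. -/
def charRep [Group H] (γ : H →* ℂˣ) : Representation ℂ H ℂ :=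
  (Algebra.lmul ℂ ℂ : ℂ →* Module.End ℂ ℂ).comp ((Units.coeHom ℂ).comp γ)

/-- `π` is the direct sum of two irreducible subrepresentations. -/
def SplitsInTwo [Group H] (π : Representation ℂ H V) : Prop :=
  ∃ P Q : Subrepresentation π, IsCompl P Q ∧
    P.toRepresentation.IsIrreducible ∧ Q.toRepresentation.IsIrreducible

/-- The space of vectors fixed by the subgroup `S`. -/
abbrev fixedVectors [Group H] (π : Representation ℂ H V) (S : Subgroup H) : Submodule ℂ V :=
  Representation.invariants (π.comp S.subtype)

/-- The representation on the vectors fixed by the normal subgroup `S`. -/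
abbrev onFixed [Group H] (π : Representation ℂ H V) (S : Subgroup H) [S.Normal] :
    Representation ℂ H (fixedVectors π S) :=
  π.toInvariants S

/-- The quotient of the vectors fixed by `S` by those which are also fixed by `T`. -/
abbrev fixedQuotient [Group H] (π : Representation ℂ H V) (S T : Subgroup H) [S.Normal]
    [T.Normal] :
    Representation ℂ H (fixedVectors π S ⧸ (fixedVectors π T).submoduleOf (fixedVectors π S)) :=
  (onFixed π S).quotient _ fun g _ hv => Representation.le_comap_invariants π T g hv

end Representations

/-! ### Principal series and its restriction to the maximal compact subgroup -/

section PrincipalSeries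

variable {F : Type*} [Field F] [ValuativeRel F] [TopologicalSpace F] [IsNonarchimedeanLocalField F]
variable {n : ℕ} [Fact (n ∣ Nat.card 𝓀[F] - 1)] {V : Type*} [AddCommGroup V] [Module ℂ V]

/-- The principal series representation `Ind_{B̃¹}^{G̃¹} ρ`. -/
abbrev principalSeries (ρ : Representation ℂ (torusCover F n) V) :=
  smoothInd (borelCover F n) (ρ.comp torusProj)

/-- The restriction of the principal series to `K̃¹`. -/
abbrev resPrincipalSeries (ρ : Representation ℂ (torusCover F n) V) :=
  (principalSeries ρ).comp (compactCover F n).subtype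

variable (F n) in
/-- The projection `B̃¹ ∩ K̃¹ → T̃¹ ∩ K̃¹ ≤ A`. -/
def compactTorusProj : (borelCover F n).subgroupOf (compactCover F n) →* centA F n :=
  (torusProj.comp ((compactCover F n).subtype.subgroupComap (borelCover F n))).codRestrict _
    fun b => by
      apply mem_centA_of_compact
      have hb : b.1.1.base ∈ maxCompact F := b.1.2
      have h0 : b.1.1.base 1 0 = 0 := b.2
      have hv := kubotaX_unit hb (Or.inl h0)
      exact dg_mem_maxCompact ⟨(kubotaX b.1.1.base)⁻¹, by rw [mem_integerUnits, val_inv, hv]; rfl⟩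

/-- `Vᵢ = Ind_{B̃¹ ∩ K̃¹}^{K̃¹} χᵢ`, where `χᵢ` is extended trivially over `N¹ ∩ K¹`. -/
abbrev compactInd (χ₀ : centA F n →* ℂˣ) (ϖ : Fˣ) (i : ℕ) :=
  smoothInd ((borelCover F n).subgroupOf (compactCover F n))
    (charRep ((twist χ₀ ϖ i).comp (compactTorusProj F n)))

/-- The representation of `K̃¹` on the space `Vᵢ^{K¹ₗ}` of `K¹ₗ`-fixed vectors in `Vᵢ`. -/
abbrev fixedRep (χ₀ : centA F n →* ℂˣ) (ϖ : Fˣ) (i : ℕ) (l : ℕ+) :=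
  onFixed (compactInd χ₀ ϖ i) ((congruenceCover F n l).subgroupOf (compactCover F n))

/-- The representation `W̃ᵢ,ₗ = Vᵢ^{K¹ₗ} / Vᵢ^{K¹ₗ₋₁}` of `K̃¹`, for `l > 1`. -/
abbrev levelRep (χ₀ : centA F n →* ℂˣ) (ϖ : Fˣ) (i : ℕ) (l : ℕ+) :=
  fixedQuotient (compactInd χ₀ ϖ i) ((congruenceCover F n l).subgroupOf (compactCover F n))
    ((congruenceCover F n (l - 1)).subgroupOf (compactCover F n))

/-- The condition that `χ₀ = ε ∘ (ϖ, ·)ₙ^{-2i}` on `(T¹ ∩ K¹)²`. -/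
def Exceptional (χ₀ : centA F n →* ℂˣ) (ε : rootsOfUnity n 𝓀[F] →* ℂˣ) (ϖ : Fˣ) (i : ℕ) : Prop :=
  ∀ t : integerUnits F, χ₀ (unitTorus n (t ^ 2)) =
    ε (hilbert n ϖ ((t ^ 2 : integerUnits F) : Fˣ) ^ (-(2 * (i : ℤ))))

end PrincipalSeries

/-- `n̲ = n` if `n` is odd and `n / 2` if `n` is even. -/
def underline (n : ℕ) : ℕ := if Odd n then n else n / 2

end

end KTypes

/-! The proof decomposes the restriction of the torus representation, transports the result to `K̃¹`
by the Iwasawa decomposition, and then counts the irreducible constituents of each piece by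
computing eigenvectors of `B̃¹ ∩ K̃¹`.

Torus. Two elements of `T̃¹` commute up to the square of a Hilbert symbol (`torus_mul_comm`).
Translating an eigenvector of `T̃¹ ∩ K̃¹` in `ρ` by a power `xⁱ` of a lift of `dg(ϖ)` therefore
multiplies its character by `ε((ϖ,·)ₙ)^{2i}`. Since `x^{n̲}` is central, `ρ` has a basis of
eigenvectors with the characters `χᵢ`, `0 ≤ i < n̲`, one for each (`exists_basis_twist`). As `G̃¹ =
B̃¹K̃¹`, the restricted principal series is the direct sum of the `Vᵢ`
(`nonempty_equiv_resPrincipalSeries`).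

Counting constituents. Averaging over finite quotients splits `Vᵢ` as the sum of `Vᵢ^{K_m}` and of
the successive quotients (`IsSmoothFor.nonempty_equiv`). Each piece is a direct summand preserved by
all endomorphisms of `Vᵢ` (`IsRetract`). Evaluation `λ` at `1` is a form on which `B̃¹ ∩ K̃¹` acts
by `ψ = χᵢ`, and its translates separate points. Averaging against `ψ⁻¹` shows that every nonzero
subrepresentation contains a `ψ`-eigenvector on which `λ` does not vanish. So a nonzero piece whose
`ψ`-eigenspace has dimension at most one is irreducible (`IsWhittaker.isIrreducible`). If the
dimension is two, some eigenvector `f ≠ 0` has `λ(f) = 0`, while Frobenius reciprocity gives an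
endomorphism `T` with `λ(Tf) ≠ 0`. Then `T` is not a scalar, the piece is reducible by Schur, and
each of two complementary parts takes up one dimension (`IsWhittaker.splitsInTwo`).

Computing eigenspaces. The cover splits over `SL₂(𝒪)`, so a `ψ`-eigenvector is a function on
`SL₂(𝒪)` which is equivariant on both sides under the Borel subgroup for `θ`, the restriction of
`χᵢ` to `𝒪ˣ` (`IsBiEquivariant`). Such a function is determined by its values at the Weyl element
and at the lower unipotents with entry `c`, and the latter depend on `c` only up to squares of
units. Since `q` is odd, `1 + 𝔭` has odd order modulo any power of `𝔭`, so its elements count as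
squares. Primitivity kills the values with `0 < val c < m`
(`IsBiEquivariant.lower_eq_zero_of_notMem`). The value at the Weyl element vanishes unless `θ² = 1`,
which forces `m = 1`. At level `m` there remains the value at `1`, together with the value at the
Weyl element when `m = 1` and `θ² = 1`. Each further level adds exactly two parameters, one for each
square class of units times a power of a uniformizer.

Finally `(Eᵢ)` says that `θ² = 1` for `χᵢ` (`exceptional_iff_sq`), and once `(Eᵢ)` holds, `(E_k)`
amounts to `n ∣ 4(i - k)` (`exceptional_iff_dvd`). -/

namespace KTypes

noncomputable section

set_option linter.unusedSectionVars false

/-! ### Averaging over subgroups of finite index -/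

section Average

variable {H X : Type*} [Group H] [AddCommGroup X] [Module ℂ X] (σ : Representation ℂ H X)

/-- The average of the translates by representatives of the cosets of `N`. -/
def averageOver (N : Subgroup H) [N.FiniteIndex] : X →ₗ[ℂ] X :=
  letI := N.fintypeQuotientOfFiniteIndex
  (N.index : ℂ)⁻¹ • ∑ q : H ⧸ N, σ q.out

variable {N : Subgroup H} [N.FiniteIndex]

theorem averageOver_apply (x : X) :
    letI := N.fintypeQuotientOfFiniteIndex
    averageOver σ N x = (N.index : ℂ)⁻¹ • ∑ q : H ⧸ N, σ q.out x := by
  simp [averageOver, LinearMap.sum_apply]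

/-- `averageOver` is built from chosen coset representatives. On a vector fixed by `N` the choice
does not matter, which is what allows the sum over cosets to be reindexed. -/
theorem apply_out {x : X} (hx : ∀ g ∈ N, σ g x = x) (h : H) :
    σ (h : H ⧸ N).out x = σ h x := by
  obtain ⟨g, hg⟩ := QuotientGroup.mk_out_eq_mul N h
  rw [hg, map_mul, Module.End.mul_apply, hx g g.2]

theorem averageOver_of_fixed {x : X} (hx : ∀ h, σ h x = x) : averageOver σ N x = x := by
  let := N.fintypeQuotientOfFiniteIndex
  rw [averageOver_apply]
  simp only [hx, Finset.sum_const, Finset.card_univ]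
  rw [← Nat.card_eq_fintype_card, ← Subgroup.index, ← Nat.cast_smul_eq_nsmul ℂ, smul_smul,
    inv_mul_cancel₀ (Nat.cast_ne_zero.2 Subgroup.FiniteIndex.index_ne_zero), one_smul]

/-- Left translation permutes the cosets `gN`, whether or not `N` is normal. -/
theorem apply_averageOver {x : X} (hx : ∀ g ∈ N, σ g x = x) (h : H) :
    σ h (averageOver σ N x) = averageOver σ N x := by
  let := N.fintypeQuotientOfFiniteIndex
  rw [averageOver_apply, map_smul, map_sum]
  congr 1
  refine Fintype.sum_equiv (MulAction.toPerm h) _ _ fun q => ?_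
  induction q using QuotientGroup.induction_on with
  | H g =>
    rw [apply_out σ hx, MulAction.toPerm_apply]
    change _ = σ ((h * g : H) : H ⧸ N).out x
    rw [apply_out σ hx, map_mul, Module.End.mul_apply]

/-- Right translation permutes the cosets only for normal `N`. Normality also keeps the translated
vector fixed by `N`. -/
theorem averageOver_apply_apply [hN : N.Normal] {x : X} (hx : ∀ g ∈ N, σ g x = x) (h : H) :
    averageOver σ N (σ h x) = averageOver σ N x := by
  let := N.fintypeQuotientOfFiniteIndex
  have hx' : ∀ g ∈ N, σ g (σ h x) = σ h x := fun g hg => by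
    rw [← Module.End.mul_apply, ← map_mul]
    have e : g * h = h * (h⁻¹ * g * h) := by group
    rw [e, map_mul, Module.End.mul_apply, hx]
    simpa using hN.conj_mem g hg h⁻¹
  rw [averageOver_apply, averageOver_apply]
  congr 1
  refine Fintype.sum_equiv (Equiv.mulRight (h : H ⧸ N)) _ _ fun q => ?_
  induction q using QuotientGroup.induction_on with
  | H g =>
    rw [apply_out σ hx', Equiv.coe_mulRight]
    change _ = σ ((g * h : H) : H ⧸ N).out x
    rw [apply_out σ hx, map_mul, Module.End.mul_apply]

theorem averageOver_induction {x : X} {P : Submodule ℂ X} (hP : ∀ h, σ h x ∈ P) :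
    averageOver σ N x ∈ P := by
  let := N.fintypeQuotientOfFiniteIndex
  rw [averageOver_apply]
  exact P.smul_mem _ (P.sum_mem fun q _ => hP _)

theorem map_averageOver {Y : Type*} [AddCommGroup Y] [Module ℂ Y] (f : X →ₗ[ℂ] Y) {x : X} {y : Y}
    (hf : ∀ h, f (σ h x) = y) : f (averageOver σ N x) = y := by
  let := N.fintypeQuotientOfFiniteIndex
  rw [averageOver_apply, map_smul, map_sum]
  simp only [hf, Finset.sum_const, Finset.card_univ]
  rw [← Nat.card_eq_fintype_card, ← Subgroup.index, ← Nat.cast_smul_eq_nsmul ℂ, smul_smul,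
    inv_mul_cancel₀ (Nat.cast_ne_zero.2 Subgroup.FiniteIndex.index_ne_zero), one_smul]

end Average

/-! ### Eigenvectors of a subgroup and irreducibility -/

section Eigen

variable {Γ Y : Type*} [Group Γ] [AddCommGroup Y] [Module ℂ Y] (τ : Representation ℂ Γ Y)
  {B : Subgroup Γ} (ψ : B →* ℂˣ)

/-- The vectors on which `B` acts by the character `ψ`. -/
def eigenspace : Submodule ℂ Y where
  carrier := {y | ∀ b : B, τ b y = (ψ b : ℂ) • y}
  zero_mem' b := by simp
  add_mem' {x y} hx hy b := by rw [map_add, hx, hy, smul_add]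
  smul_mem' c x hx b := by rw [map_smul, hx, smul_comm]

/-- The representation `ψ⁻¹ ⊗ τ` of `B`. -/
def untwist : Representation ℂ B Y where
  toFun b := ((ψ b)⁻¹ : ℂˣ) • τ b
  map_one' := by simp
  map_mul' a b := by
    ext y
    simp only [map_mul, mul_inv, LinearMap.smul_apply, Module.End.mul_apply, map_smul,
      Subgroup.coe_mul, Units.smul_def, mul_smul]
    exact smul_comm _ _ _

theorem untwist_apply (b : B) (y : Y) :
    untwist τ ψ b y = (((ψ b)⁻¹ : ℂˣ) : ℂ) • τ b y := rfl

/-- Eigenvectors become invariants of the twisted action, so averaging that action produces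
eigenvectors. -/
theorem untwist_fixed {y : Y} : (∀ b, untwist τ ψ b y = y) ↔ y ∈ eigenspace τ ψ := by
  refine forall_congr' fun b => ?_
  rw [untwist_apply]
  constructor
  · intro h
    conv_rhs => rw [← h]
    rw [smul_smul, Units.mul_inv, one_smul]
  · intro h
    rw [h, smul_smul, Units.inv_mul, one_smul]

/-- A linear form on which `B` acts by `ψ` and all of whose translates vanish simultaneously only
at zero. -/
structure IsWhittaker (lam : Y →ₗ[ℂ] ℂ) : Prop where
  equivariant : ∀ (b : B) y, lam (τ b y) = ψ b * lam y
  separating : ∀ y, (∀ g, lam (τ g y) = 0) → y = 0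

variable {τ ψ} {L : Subgroup Γ} [L.FiniteIndex] {lam : Y →ₗ[ℂ] ℂ}

/-- Maschke's theorem for the finite group `Γ ⧸ L`, through which the representation factors with
the same lattice of subrepresentations. -/
theorem isSemisimple_of_trivial [L.Normal] (hL : ∀ g ∈ L, ∀ y, τ g y = y) :
    τ.IsSemisimpleRepresentation := by
  have : Representation.IsTrivial (τ.comp L.subtype) := ⟨fun g => LinearMap.ext fun y => hL g g.2 y⟩
  have : Finite (Γ ⧸ L) := Subgroup.finite_quotient_of_finiteIndex
  have h : (τ.ofQuotient L).IsSemisimpleRepresentation := inferInstance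
  let e : Subrepresentation (τ.ofQuotient L) ≃o Subrepresentation τ :=
    { toFun := fun P => ⟨P.toSubmodule, fun g _ hv => P.apply_mem_toSubmodule (g : Γ ⧸ L) hv⟩
      invFun := fun P => ⟨P.toSubmodule, fun g v hv => by
        induction g using QuotientGroup.induction_on with
        | H g => exact P.apply_mem_toSubmodule g hv⟩
      left_inv := fun P => rfl
      right_inv := fun P => rfl
      map_rel_iff' := Iff.rfl }
  exact e.complementedLattice_iff.1 h

/-- The translates of a nonzero vector by representatives of the finitely many cosets of `L` span a
nonzero subrepresentation. -/
theorem finiteDimensional_of_irreducible (hL : ∀ g ∈ L, ∀ y, τ g y = y) (hirr : τ.IsIrreducible) :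
    FiniteDimensional ℂ Y := by
  have : Finite (Γ ⧸ L) := Subgroup.finite_quotient_of_finiteIndex
  have : Nontrivial (Subrepresentation τ) := hirr.toNontrivial
  obtain ⟨y, hy⟩ : ∃ y : Y, y ≠ 0 := by
    by_contra! h
    refine bot_ne_top (α := Subrepresentation τ) (SetLike.ext fun y => ?_)
    rw [h y]
    exact iff_of_true (Submodule.zero_mem _) trivial
  let P : Subrepresentation τ :=
    { toSubmodule := Submodule.span ℂ (Set.range fun q : Γ ⧸ L => τ q.out y)
      apply_mem_toSubmodule := fun g v hv => by
        induction hv using Submodule.span_induction with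
        | mem x h =>
          obtain ⟨q, rfl⟩ := h
          apply Submodule.subset_span
          refine ⟨(g * q.out : Γ), ?_⟩
          dsimp only
          rw [apply_out τ (fun g hg => hL g hg y), map_mul, Module.End.mul_apply]
        | zero => rw [map_zero]; exact Submodule.zero_mem _
        | add x z _ _ h1 h2 => rw [map_add]; exact Submodule.add_mem _ h1 h2
        | smul c x _ h => rw [map_smul]; exact Submodule.smul_mem _ _ h }
  have hP : P = ⊤ := by
    refine (hirr.eq_bot_or_eq_top P).resolve_left fun h => hy ?_
    have h1 : y ∈ P := by
      apply Submodule.subset_span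
      refine ⟨((1 : Γ) : Γ ⧸ L), ?_⟩
      dsimp only
      rw [apply_out τ (fun g hg => hL g hg y), map_one, Module.End.one_apply]
    rw [h] at h1
    exact h1
  have : (⊤ : Submodule ℂ Y) = Submodule.span ℂ (Set.range fun q : Γ ⧸ L => τ q.out y) :=
    (congrArg Subrepresentation.toSubmodule hP).symm
  refine ⟨this ▸ Submodule.fg_span (Set.finite_range _)⟩

namespace IsWhittaker

/-- On `B ∩ L` the representation is trivial, so equivariance reads `λ = ψ(b)λ` at a vector where `λ
≠ 0`. Hence averages of `ψ⁻¹ ⊗ τ` over `B` reduce to a finite quotient. -/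
theorem character_eq_one (h : IsWhittaker τ ψ lam) (hL : ∀ g ∈ L, ∀ y, τ g y = y) [Nontrivial Y]
    (b : B) (hb : (b : Γ) ∈ L) : ψ b = 1 := by
  obtain ⟨y, hy⟩ := exists_ne (0 : Y)
  have : ∃ g, lam (τ g y) ≠ 0 := by
    by_contra! h0
    exact hy (h.separating y h0)
  obtain ⟨g, hg⟩ := this
  have e := h.equivariant b (τ g y)
  rw [hL b hb] at e
  apply Units.ext
  exact (mul_right_cancel₀ hg ((one_mul _).trans e)).symm

theorem untwist_trivial (h : IsWhittaker τ ψ lam) (hL : ∀ g ∈ L, ∀ y, τ g y = y) [Nontrivial Y]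
    (y : Y) : ∀ b ∈ L.subgroupOf B, untwist τ ψ b y = y := fun b hb => by
  rw [untwist_apply, h.character_eq_one hL b hb, hL b hb]
  simp

/-- The lemma behind both counting criteria. Some translate of a nonzero vector of `P` has nonzero
`λ`. Averaging this translate for `ψ⁻¹ ⊗ τ` keeps it in `P`, makes it an eigenvector, and does not
change `λ`, because `λ` is invariant for the twisted action. -/
theorem exists_mem_eigenspace (h : IsWhittaker τ ψ lam) (hL : ∀ g ∈ L, ∀ y, τ g y = y)
    (P : Subrepresentation τ) (hP : P ≠ ⊥) : ∃ y ∈ P, y ∈ eigenspace τ ψ ∧ lam y ≠ 0 := by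
  obtain ⟨y, hyP, hy⟩ : ∃ y ∈ P, y ≠ 0 := by
    by_contra! h0
    refine hP (SetLike.ext fun y => ⟨fun hy => h0 y hy, fun hy => ?_⟩)
    have : y = 0 := hy
    rw [this]; exact P.toSubmodule.zero_mem
  have : Nontrivial Y := ⟨y, 0, hy⟩
  have : ∃ g, lam (τ g y) ≠ 0 := by
    by_contra! h0
    exact hy (h.separating y h0)
  obtain ⟨g, hg⟩ := this
  have hgP : τ g y ∈ P := P.apply_mem_toSubmodule g hyP
  refine ⟨averageOver (untwist τ ψ) (L.subgroupOf B) (τ g y), ?_, ?_, ?_⟩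
  · exact averageOver_induction (P := P.toSubmodule) _ fun b =>
      P.toSubmodule.smul_mem _ (P.apply_mem_toSubmodule _ hgP)
  · exact (untwist_fixed τ ψ).1 (apply_averageOver _ (h.untwist_trivial hL _))
  · rw [map_averageOver (untwist τ ψ) lam (y := lam (τ g y))]
    · exact hg
    · intro b
      rw [untwist_apply, map_smul, h.equivariant, smul_eq_mul, Units.inv_mul_cancel_left]

/-- The form `ξ` is injective on the `ψ`-eigenspace, so this has dimension at most one. Two
complementary nonzero subrepresentations would each contain an eigenvector, and these would be
proportional. -/
theorem isIrreducible [L.Normal] (h : IsWhittaker τ ψ lam) (hL : ∀ g ∈ L, ∀ y, τ g y = y)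
    [Nontrivial Y] (ξ : Y →ₗ[ℂ] ℂ) (hξ : ∀ y ∈ eigenspace τ ψ, ξ y = 0 → y = 0) :
    τ.IsIrreducible := by
  have := isSemisimple_of_trivial hL
  have : Nontrivial (Subrepresentation τ) := by
    refine ⟨⊥, ⊤, fun e => ?_⟩
    obtain ⟨y, hy⟩ := exists_ne (0 : Y)
    have : y ∈ (⊥ : Subrepresentation τ) := by rw [e]; trivial
    exact hy this
  refine ⟨fun P => ?_⟩
  obtain ⟨Q, hQ⟩ := exists_isCompl P
  by_contra! hne
  have hQ0 : Q ≠ ⊥ := fun e => hne.2 (by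
    have := hQ.sup_eq_top
    rwa [e, sup_bot_eq] at this)
  obtain ⟨p, hpP, hpE, hp⟩ := h.exists_mem_eigenspace hL P hne.1
  obtain ⟨q, hqQ, hqE, hq⟩ := h.exists_mem_eigenspace hL Q hQ0
  have hcomb : ξ q • p - ξ p • q = 0 := by
    apply hξ
    · exact sub_mem (Submodule.smul_mem _ _ hpE) (Submodule.smul_mem _ _ hqE)
    · simp [mul_comm]
  have hq0 : ξ q ≠ 0 := fun e => hq (by rw [hξ q hqE e, map_zero])
  have hmem : ξ q • p ∈ P ⊓ Q := by
    refine ⟨P.toSubmodule.smul_mem _ hpP, ?_⟩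
    rw [sub_eq_zero.1 hcomb]
    exact Q.toSubmodule.smul_mem _ hqQ
  rw [hQ.inf_eq_bot] at hmem
  have h0 : ξ q • p = 0 := hmem
  rw [smul_eq_zero, or_iff_right hq0] at h0
  exact hp (by rw [h0, map_zero])

theorem restrict (h : IsWhittaker τ ψ lam) (P : Subrepresentation τ) :
    IsWhittaker P.toRepresentation ψ (lam ∘ₗ P.toSubmodule.subtype) where
  equivariant b y := h.equivariant b y
  separating y hy := Subtype.ext (h.separating y hy)

/-- Here `ξ` identifies the `ψ`-eigenspace with `ℂ²`, and `hU` is Frobenius reciprocity: every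
`ψ`-equivariant form factors as `λ ∘ T` with `T` an intertwiner. A plane of eigenvectors gives too
many endomorphisms for irreducibility, while `exists_mem_eigenspace` leaves room for only two
summands. -/
theorem splitsInTwo [L.Normal] (h : IsWhittaker τ ψ lam) (hL : ∀ g ∈ L, ∀ y, τ g y = y)
    (hU : ∀ μ : Y →ₗ[ℂ] ℂ, (∀ (b : B) y, μ (τ b y) = ψ b * μ y) →
      ∃ T : Y →ₗ[ℂ] Y, (∀ g y, T (τ g y) = τ g (T y)) ∧ ∀ y, lam (T y) = μ y)
    (ξ : Y →ₗ[ℂ] ℂ × ℂ) (hξ : ∀ y ∈ eigenspace τ ψ, ξ y = 0 → y = 0)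
    (hξ' : ∀ z, ∃ y ∈ eigenspace τ ψ, ξ y = z) : SplitsInTwo τ := by
  obtain ⟨f₁, h₁, e₁⟩ := hξ' (1, 0)
  obtain ⟨f₂, h₂, e₂⟩ := hξ' (0, 1)
  have : Nontrivial Y := ⟨f₁, 0, fun e => by rw [e, map_zero] at e₁; simp [Prod.ext_iff] at e₁⟩
  -- The form `λ` has a nonzero kernel on the two-dimensional eigenspace.
  obtain ⟨f, hf, hf0, hfl⟩ : ∃ f ∈ eigenspace τ ψ, f ≠ 0 ∧ lam f = 0 := by
    by_cases hl : lam f₁ = 0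
    · exact ⟨f₁, h₁, fun e => by rw [e, map_zero] at e₁; simp [Prod.ext_iff] at e₁, hl⟩
    · refine ⟨lam f₂ • f₁ - lam f₁ • f₂,
        sub_mem (Submodule.smul_mem _ _ h₁) (Submodule.smul_mem _ _ h₂), fun e => ?_, ?_⟩
      · have := congrArg (fun y => (ξ y).2) e
        simp only [map_sub, map_smul, e₁, e₂, map_zero] at this
        simp at this
        exact hl this
      · simp [mul_comm]
  have hss := isSemisimple_of_trivial hL
  have hnirr : ¬ τ.IsIrreducible := by
    intro hirr
    have := finiteDimensional_of_irreducible hL hirr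
    obtain ⟨ν, hν⟩ : ∃ ν : Y →ₗ[ℂ] ℂ, ν f ≠ 0 := by
      by_contra! h0
      exact hf0 ((Module.forall_dual_apply_eq_zero_iff ℂ f).1 h0)
    let A := averageOver (untwist τ ψ) (L.subgroupOf B)
    -- The equivariant form `ν ∘ A` takes the value `ν(f) ≠ 0` at `f`. If `τ` were irreducible, `T`
    -- would be a scalar, and `λ(Tf)` would vanish together with `λ(f)`.
    obtain ⟨T, hT, hTl⟩ := hU (ν ∘ₗ A) (fun b y => by
      have e := averageOver_apply_apply (untwist τ ψ) (h.untwist_trivial hL y) b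
      rw [untwist_apply, map_smul] at e
      rw [LinearMap.comp_apply, LinearMap.comp_apply]
      change ν (averageOver (untwist τ ψ) (L.subgroupOf B) (τ b y)) =
        ψ b * ν (averageOver (untwist τ ψ) (L.subgroupOf B) y)
      rw [← e, map_smul, smul_eq_mul, Units.mul_inv_cancel_left])
    obtain ⟨c, hc⟩ := Module.End.exists_eigenvalue T
    let P : Subrepresentation τ :=
      { toSubmodule := Module.End.eigenspace T c
        apply_mem_toSubmodule := fun g v hv => by
          rw [Module.End.mem_eigenspace_iff] at hv ⊢
          rw [hT, hv, map_smul] }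
    have hP : P = ⊤ := by
      refine (hirr.eq_bot_or_eq_top P).resolve_left fun e => hc ?_
      exact congrArg Subrepresentation.toSubmodule e
    have hfP : f ∈ P := by rw [hP]; trivial
    have hTf : T f = c • f := Module.End.mem_eigenspace_iff.1 hfP
    have := hTl f
    rw [hTf, map_smul, hfl, LinearMap.comp_apply] at this
    have hAf : A f = f := averageOver_of_fixed _ ((untwist_fixed τ ψ).2 hf)
    rw [hAf, smul_zero] at this
    exact hν this.symm
  have hntr : Nontrivial (Subrepresentation τ) := by
    refine ⟨⊥, ⊤, fun e => ?_⟩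
    have : f ∈ (⊥ : Subrepresentation τ) := by rw [e]; trivial
    exact hf0 this
  obtain ⟨P, hP0, hP1⟩ : ∃ P : Subrepresentation τ, P ≠ ⊥ ∧ P ≠ ⊤ := by
    by_contra! h0
    exact hnirr ⟨fun P => or_iff_not_imp_left.2 fun hP => h0 P hP⟩
  obtain ⟨Q, hQ⟩ := exists_isCompl P
  have hQ0 : Q ≠ ⊥ := fun e => hP1 (by
    have := hQ.sup_eq_top
    rwa [e, sup_bot_eq] at this)
  have key : ∀ P Q : Subrepresentation τ, IsCompl P Q → P ≠ ⊥ → Q ≠ ⊥ →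
      P.toRepresentation.IsIrreducible := by
    intro P Q hPQ hP hQ
    obtain ⟨p, hpP, hpE, hp⟩ := h.exists_mem_eigenspace hL P hP
    obtain ⟨q, hqQ, hqE, hq⟩ := h.exists_mem_eigenspace hL Q hQ
    have : Nontrivial P.toSubmodule :=
      ⟨⟨p, hpP⟩, 0, fun e => hp (by
        have e' : p = 0 := congrArg Subtype.val e
        rw [e', map_zero])⟩
    have hq0 : ξ q ≠ 0 := fun e => hq (by rw [hξ q hqE e, map_zero])
    -- The chosen form vanishes exactly on the line through `ξ q`. An eigenvector of `P` killed by
    -- it is thus a multiple of `q ∈ Q`, hence lies in `P ⊓ Q`.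
    refine (h.restrict P).isIrreducible (L := L) (fun g hg y => Subtype.ext (hL g hg y))
      (((ξ q).2 • LinearMap.fst ℂ ℂ ℂ - (ξ q).1 • LinearMap.snd ℂ ℂ ℂ) ∘ₗ ξ ∘ₗ
        P.toSubmodule.subtype) ?_
    rintro ⟨y, hyP⟩ hyE hy
    have hyE' : y ∈ eigenspace τ ψ := fun b => congrArg Subtype.val (hyE b)
    have hy' : (ξ q).2 * (ξ y).1 - (ξ q).1 * (ξ y).2 = 0 := hy
    obtain ⟨c, hc⟩ : ∃ c : ℂ, ξ y = c • ξ q := by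
      by_cases h1 : (ξ q).1 = 0
      · have h2 : (ξ q).2 ≠ 0 := fun e => hq0 (Prod.ext h1 e)
        refine ⟨(ξ y).2 / (ξ q).2, Prod.ext ?_ ?_⟩
        · rw [h1, zero_mul, sub_zero, mul_eq_zero, or_iff_right h2] at hy'
          simp [h1, hy']
        · simp [h2]
      · refine ⟨(ξ y).1 / (ξ q).1, Prod.ext ?_ ?_⟩
        · simp [h1]
        · simp only [Prod.smul_snd, smul_eq_mul]
          field_simp
          linear_combination -hy'
    have hyc : y - c • q = 0 := by
      apply hξ
      · exact sub_mem hyE' (Submodule.smul_mem _ _ hqE)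
      · rw [map_sub, map_smul, hc, sub_self]
    have hmem : y ∈ P ⊓ Q := by
      refine ⟨hyP, ?_⟩
      rw [sub_eq_zero.1 hyc]
      exact Q.toSubmodule.smul_mem _ hqQ
    rw [hPQ.inf_eq_bot] at hmem
    exact Subtype.ext hmem
  exact ⟨P, Q, hQ, key P Q hQ hP0 hQ0, key Q P hQ.symm hQ0 hP0⟩

end IsWhittaker

end Eigen

end

end KTypes

namespace KTypes

noncomputable section

set_option linter.unusedSectionVars false

/-! ### Retracts -/

section Retract

variable {Γ X Y : Type*} [Group Γ] [AddCommGroup X] [Module ℂ X] [AddCommGroup Y] [Module ℂ Y]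

/-- `Y` is a direct summand of `X`, preserved by all endomorphisms of the representation `X`. -/
structure IsRetract (π : Representation ℂ Γ X) (τ : Representation ℂ Γ Y) (ι : Y →ₗ[ℂ] X)
    (p : X →ₗ[ℂ] Y) : Prop where
  incl_comm : ∀ g y, ι (τ g y) = π g (ι y)
  proj_comm : ∀ g x, p (π g x) = τ g (p x)
  proj_incl : ∀ y, p (ι y) = y
  central : ∀ T : X →ₗ[ℂ] X, (∀ g x, T (π g x) = π g (T x)) → ∀ x, T (ι (p x)) = ι (p (T x))

namespace IsRetract

variable {π : Representation ℂ Γ X} {τ : Representation ℂ Γ Y} {ι : Y →ₗ[ℂ] X} {p : X →ₗ[ℂ] Y}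
  {B : Subgroup Γ} {ψ : B →* ℂˣ} {lam : X →ₗ[ℂ] ℂ}

theorem isWhittaker (h : IsRetract π τ ι p) (hw : IsWhittaker π ψ lam) :
    IsWhittaker τ ψ (lam ∘ₗ ι) where
  equivariant b y := by
    rw [LinearMap.comp_apply, h.incl_comm, hw.equivariant]; rfl
  separating y hy := by
    rw [← h.proj_incl y, hw.separating (ι y), map_zero]
    intro g
    rw [← h.incl_comm]
    exact hy g

theorem mem_eigenspace_incl (h : IsRetract π τ ι p) {y : Y} (hy : y ∈ eigenspace τ ψ) :
    ι y ∈ eigenspace π ψ := fun b => by rw [← h.incl_comm, hy b, map_smul]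

theorem mem_eigenspace_proj (h : IsRetract π τ ι p) {x : X} (hx : x ∈ eigenspace π ψ) :
    p x ∈ eigenspace τ ψ := fun b => by rw [← h.proj_comm, hx b, map_smul]

variable {L : Subgroup Γ} [L.FiniteIndex] [L.Normal]

/-- The criterion in a form that is checked inside the big representation `X`: the eigenvectors of
`Y` are those of `X` fixed by the idempotent `ι ∘ p`. -/
theorem isIrreducible (h : IsRetract π τ ι p) (hw : IsWhittaker π ψ lam)
    (hL : ∀ g ∈ L, ∀ y, τ g y = y) [Nontrivial Y] (ξ : X →ₗ[ℂ] ℂ)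
    (hξ : ∀ x ∈ eigenspace π ψ, ι (p x) = x → ξ x = 0 → x = 0) : τ.IsIrreducible := by
  refine (h.isWhittaker hw).isIrreducible hL (ξ ∘ₗ ι) fun y hy h0 => ?_
  rw [← h.proj_incl y, hξ (ι y) (h.mem_eigenspace_incl hy) (by rw [h.proj_incl]) h0, map_zero]

/-- Frobenius reciprocity is known for the induced representation `X`, not for its summand `Y`. It
passes to `Y` by extending a form along `p` and compressing the resulting endomorphism to `p ∘ T ∘
ι`. -/
theorem splitsInTwo (h : IsRetract π τ ι p) (hw : IsWhittaker π ψ lam)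
    (hL : ∀ g ∈ L, ∀ y, τ g y = y)
    (hU : ∀ μ : X →ₗ[ℂ] ℂ, (∀ (b : B) x, μ (π b x) = ψ b * μ x) →
      ∃ T : X →ₗ[ℂ] X, (∀ g x, T (π g x) = π g (T x)) ∧ ∀ x, lam (T x) = μ x)
    (ξ : X →ₗ[ℂ] ℂ × ℂ) (hξ : ∀ x ∈ eigenspace π ψ, ι (p x) = x → ξ x = 0 → x = 0)
    (hξ' : ∀ z, ∃ x ∈ eigenspace π ψ, ι (p x) = x ∧ ξ x = z) : SplitsInTwo τ := by
  refine (h.isWhittaker hw).splitsInTwo hL (fun μ hμ => ?_) (ξ ∘ₗ ι) (fun y hy h0 => ?_)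
    fun z => ?_
  · obtain ⟨T, hT, hTl⟩ := hU (μ ∘ₗ p) fun b x => by
      rw [LinearMap.comp_apply, h.proj_comm, hμ]; rfl
    refine ⟨p ∘ₗ T ∘ₗ ι, fun g y => ?_, fun y => ?_⟩
    · simp only [LinearMap.comp_apply]
      rw [h.incl_comm, hT, h.proj_comm]
    · simp only [LinearMap.comp_apply]
      -- Since `T` commutes with `ι ∘ p`, the compression does not alter the value of `λ`.
      rw [← h.central T hT, h.proj_incl, hTl, LinearMap.comp_apply, h.proj_incl]
  · rw [← h.proj_incl y, hξ (ι y) (h.mem_eigenspace_incl hy) (by rw [h.proj_incl]) h0, map_zero]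
  · obtain ⟨x, hx, e1, e2⟩ := hξ' z
    exact ⟨p x, h.mem_eigenspace_proj hx, by rw [LinearMap.comp_apply, e1, e2]⟩

end IsRetract

end Retract

/-- The map from the direct sum is injective because `p j` extracts the `j`-th component and kills
the others as well as the image of `ι₀`. The summand `Y₀` needs no projection: once the other
components vanish, injectivity of `ι₀` suffices. -/
theorem nonempty_equiv_of_orthogonal {Γ X Y₀ J : Type*} [Group Γ] [AddCommGroup X] [Module ℂ X]
    [AddCommGroup Y₀] [Module ℂ Y₀] {Y : J → Type*} [∀ j, AddCommGroup (Y j)]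
    [∀ j, Module ℂ (Y j)] (π : Representation ℂ Γ X) (τ₀ : Representation ℂ Γ Y₀)
    (ι₀ : Y₀ →ₗ[ℂ] X) (τ : ∀ j, Representation ℂ Γ (Y j)) (ι : ∀ j, Y j →ₗ[ℂ] X)
    (p : ∀ j, X →ₗ[ℂ] Y j) (h₀ : ∀ g y, ι₀ (τ₀ g y) = π g (ι₀ y))
    (hι : ∀ j g y, ι j (τ j g y) = π g (ι j y)) (hinj : Function.Injective ι₀)
    (hp : ∀ j y, p j (ι j y) = y) (hp' : ∀ j l, j ≠ l → ∀ y, p j (ι l y) = 0)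
    (hp₀ : ∀ j y, p j (ι₀ y) = 0)
    (hspan : ∀ P : Submodule ℂ X, (∀ y, ι₀ y ∈ P) → (∀ j y, ι j y ∈ P) → ∀ x, x ∈ P) :
    Nonempty (Representation.Equiv π (τ₀.prod (Representation.directSum τ))) := by
  classical
  let S : (DirectSum J Y) →ₗ[ℂ] X := DirectSum.toModule ℂ J X ι
  have hS : ∀ l y, S (DirectSum.lof ℂ J Y l y) = ι l y := fun l y => DirectSum.toModule_lof ℂ l y
  let Φ : Y₀ × DirectSum J Y →ₗ[ℂ] X := LinearMap.coprod ι₀ S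
  have hΦ : ∀ z, Φ z = ι₀ z.1 + S z.2 := fun z => rfl
  have hcomp : ∀ j, p j ∘ₗ S = DirectSum.component ℂ J Y j := fun j => by
    refine DirectSum.linearMap_ext ℂ fun l => LinearMap.ext fun y => ?_
    rw [LinearMap.comp_apply, LinearMap.comp_apply, hS, LinearMap.comp_apply]
    by_cases hjl : j = l
    · subst hjl
      rw [hp, DirectSum.component.lof_self]
    · rw [hp' j l hjl, DirectSum.component.of, dif_neg (fun e => hjl e.symm)]
  have hΦi : Function.Injective Φ := by
    rw [injective_iff_map_eq_zero]
    rintro ⟨x, w⟩ hxw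
    rw [hΦ] at hxw
    dsimp only at hxw
    have hw : w = 0 := by
      refine DFinsupp.ext fun j => ?_
      have h1 := congrArg (p j) hxw
      rw [map_add, hp₀, zero_add, map_zero, ← LinearMap.comp_apply, hcomp] at h1
      exact h1
    subst hw
    rw [map_zero, add_zero] at hxw
    rw [hinj (hxw.trans (map_zero _).symm)]
    rfl
  have hΦs : Function.Surjective Φ := hspan (LinearMap.range Φ)
    (fun y => ⟨(y, 0), by rw [hΦ, map_zero, add_zero]⟩)
    (fun j y => ⟨(0, DirectSum.lof ℂ J Y j y), by rw [hΦ, hS, map_zero, zero_add]⟩)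
  refine ⟨(Representation.Equiv.mk (LinearEquiv.ofBijective Φ ⟨hΦi, hΦs⟩) fun g => ?_).symm⟩
  refine LinearMap.ext fun z => ?_
  have hSg : S ∘ₗ (Representation.directSum τ g) = π g ∘ₗ S := by
    refine DirectSum.linearMap_ext ℂ fun l => LinearMap.ext fun y => ?_
    have e : Representation.directSum τ g (DirectSum.lof ℂ J Y l y) =
        DirectSum.lof ℂ J Y l (τ l g y) := DirectSum.lmap_lof (fun l => τ l g) l y
    simp only [LinearMap.comp_apply]
    rw [e, hS, hS, hι]
  change Φ _ = π g (Φ z)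
  rw [hΦ, hΦ, map_add, ← h₀]
  congr 1
  exact LinearMap.congr_fun hSg z.2

/-! ### Filtration by the vectors fixed by smaller and smaller subgroups -/

section Filtration

variable {Γ X : Type*} [Group Γ] [AddCommGroup X] [Module ℂ X]

/-- The space spanned by the `g x - x` with `g ∈ S`. -/
abbrev movedVectors (π : Representation ℂ Γ X) (S : Subgroup Γ) : Submodule ℂ X :=
  Representation.Coinvariants.ker (π.comp S.subtype)

/-- Every vector is fixed by a member of the decreasing sequence `L`. -/
structure IsSmoothFor (π : Representation ℂ Γ X) (L : ℕ+ → Subgroup Γ) : Prop where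
  antitone : Antitone L
  exists_fixed : ∀ x, ∃ j, x ∈ fixedVectors π (L j)

theorem mem_fixedVectors {π : Representation ℂ Γ X} {S : Subgroup Γ} {x : X} :
    x ∈ fixedVectors π S ↔ ∀ g ∈ S, π g x = x :=
  ⟨fun h g hg => h ⟨g, hg⟩, fun h g => h g g.2⟩

theorem fixedVectors_anti {π : Representation ℂ Γ X} {S T : Subgroup Γ} (h : S ≤ T) :
    fixedVectors π T ≤ fixedVectors π S := fun _ hx g => hx ⟨g, h g.2⟩

theorem movedVectors_mono {π : Representation ℂ Γ X} {S T : Subgroup Γ} (h : S ≤ T) :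
    movedVectors π S ≤ movedVectors π T := by
  apply Submodule.span_le.2
  rintro _ ⟨⟨g, x⟩, rfl⟩
  exact Submodule.subset_span ⟨(⟨g, h g.2⟩, x), rfl⟩

namespace IsSmoothFor

variable {π : Representation ℂ Γ X} {L : ℕ+ → Subgroup Γ} [∀ j, (L j).Normal]
  [∀ j, (L j).FiniteIndex]

theorem eventually_fixed (h : IsSmoothFor π L) (x : X) :
    ∃ N, ∀ j ≥ N, ∀ g ∈ L j, π g x = x := by
  obtain ⟨N, hN⟩ := h.exists_fixed x
  exact ⟨N, fun j hj g hg => hN ⟨g, h.antitone hj hg⟩⟩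

/-- A finite average replaces integration over the compact group: for `j` large, every vector
involved is fixed by `L j`, and the average over `L l` modulo `L j` is then invariant under
translation. -/
theorem eventually_average_eq_zero (h : IsSmoothFor π L) (l : ℕ+) {x : X}
    (hx : x ∈ movedVectors π (L l)) :
    ∃ N, ∀ j ≥ N, averageOver (π.comp (L l).subtype) ((L j).subgroupOf (L l)) x = 0 := by
  induction hx using Submodule.span_induction with
  | mem x hx =>
    obtain ⟨⟨g, y⟩, rfl⟩ := hx
    obtain ⟨N, hN⟩ := h.eventually_fixed y
    refine ⟨N, fun j hj => ?_⟩
    dsimp only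
    rw [map_sub, averageOver_apply_apply, sub_self]
    exact fun g hg => hN j hj g hg
  | zero => exact ⟨1, fun j _ => map_zero _⟩
  | add x y _ _ hx hy =>
    obtain ⟨N, hN⟩ := hx
    obtain ⟨M, hM⟩ := hy
    refine ⟨max N M, fun j hj => ?_⟩
    rw [map_add, hN j (le_of_max_le_left hj), hM j (le_of_max_le_right hj), add_zero]
  | smul c x _ hx =>
    obtain ⟨N, hN⟩ := hx
    exact ⟨N, fun j hj => by rw [map_smul, hN j hj, smul_zero]⟩

/-- A vector is its average over `L l`, which is fixed, plus a difference lying in the span of the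
`g x - x`. The sum is direct since averages fix the first space and eventually kill the second. -/
theorem isCompl (h : IsSmoothFor π L) (l : ℕ+) :
    IsCompl (fixedVectors π (L l)) (movedVectors π (L l)) := by
  constructor
  · rw [Submodule.disjoint_def]
    intro x hx hx'
    obtain ⟨N, hN⟩ := h.eventually_average_eq_zero l hx'
    rw [← hN N le_rfl, averageOver_of_fixed _ hx]
  · rw [codisjoint_iff, eq_top_iff]
    intro x _
    obtain ⟨N, hN⟩ := h.eventually_fixed x
    have hN' : ∀ g ∈ (L N).subgroupOf (L l), (π.comp (L l).subtype) g x = x :=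
      fun g hg => hN N le_rfl g hg
    refine Submodule.mem_sup.2
      ⟨averageOver (π.comp (L l).subtype) ((L N).subgroupOf (L l)) x, ?_,
        x - averageOver (π.comp (L l).subtype) ((L N).subgroupOf (L l)) x, ?_, ?_⟩
    · exact fun g => apply_averageOver _ hN' g
    · rw [← Submodule.Quotient.mk_eq_zero, Submodule.Quotient.mk_sub, sub_eq_zero]
      symm
      refine map_averageOver _ (movedVectors π (L l)).mkQ fun g => ?_
      exact (Submodule.Quotient.eq _).2 (Representation.Coinvariants.sub_mem_ker g x)
    · abel

/-- The projection onto the vectors fixed by `L l`. -/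
def proj (h : IsSmoothFor π L) (l : ℕ+) : X →ₗ[ℂ] fixedVectors π (L l) :=
  Submodule.projectionOnto _ _ (h.isCompl l)

theorem proj_of_mem (h : IsSmoothFor π L) {l : ℕ+} {x : X} (hx : x ∈ fixedVectors π (L l)) :
    (h.proj l x : X) = x :=
  congrArg Subtype.val (Submodule.projectionOnto_apply_of_mem_left (h.isCompl l) hx)

theorem proj_eq_zero_iff (h : IsSmoothFor π L) {l : ℕ+} {x : X} :
    h.proj l x = 0 ↔ x ∈ movedVectors π (L l) :=
  Submodule.projectionOnto_apply_eq_zero_iff (h.isCompl l)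

theorem sub_proj_mem (h : IsSmoothFor π L) (l : ℕ+) (x : X) :
    x - h.proj l x ∈ movedVectors π (L l) := by
  rw [← h.proj_eq_zero_iff, map_sub]
  apply Subtype.ext
  rw [AddSubgroupClass.coe_sub, h.proj_of_mem (h.proj l x).2]
  exact sub_self _

/-- For `j ≤ l` the group `L l` lies in `L j`, so what the projection of level `l` discards is also
discarded at level `j`. -/
theorem proj_proj (h : IsSmoothFor π L) {j l : ℕ+} (hjl : j ≤ l) (x : X) :
    h.proj j (h.proj l x : X) = h.proj j x := by
  have := (h.proj_eq_zero_iff (l := j)).2 (movedVectors_mono (h.antitone hjl) (h.sub_proj_mem l x))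
  rw [map_sub, sub_eq_zero] at this
  exact this.symm

/-- An operator which normalises the action of `L l` preserves both the fixed and the moved vectors.
The hypotheses cover at once the elements of `Γ`, as `L l` is normal, and the intertwiners, with `g'
= g`. -/
theorem proj_map (h : IsSmoothFor π L) (l : ℕ+) (T : X →ₗ[ℂ] X)
    (hT : ∀ g ∈ L l, ∀ x, ∃ g' ∈ L l, T (π g x) = π g' (T x))
    (hT' : ∀ g ∈ L l, ∃ g' ∈ L l, ∀ x, π g (T x) = T (π g' x)) (x : X) :
    (h.proj l (T x) : X) = T (h.proj l x) := by
  have h1 : T (h.proj l x) ∈ fixedVectors π (L l) := by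
    rw [mem_fixedVectors]
    intro g hg
    obtain ⟨g', hg', e⟩ := hT' g hg
    rw [e, mem_fixedVectors.1 (h.proj l x).2 g' hg']
  have h2 : T (x - h.proj l x) ∈ movedVectors π (L l) := by
    have h3 := h.sub_proj_mem l x
    generalize x - (h.proj l x : X) = y at h3
    induction h3 using Submodule.span_induction with
    | mem x hx =>
      obtain ⟨⟨g, y⟩, rfl⟩ := hx
      obtain ⟨g', hg', e⟩ := hT g g.2 y
      have : T ((π.comp (L l).subtype) g y - y) = π g' (T y) - T y := by
        rw [map_sub, ← e]; rfl
      dsimp only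
      rw [this]
      exact Submodule.subset_span ⟨(⟨g', hg'⟩, T y), rfl⟩
    | zero => rw [map_zero]; exact Submodule.zero_mem _
    | add x y _ _ hx hy => rw [map_add]; exact Submodule.add_mem _ hx hy
    | smul c x _ hx => rw [map_smul]; exact Submodule.smul_mem _ _ hx
  rw [← h.proj_eq_zero_iff, map_sub, map_sub, sub_eq_zero] at h2
  rw [h2, h.proj_of_mem h1]

theorem proj_apply (h : IsSmoothFor π L) (l : ℕ+) (g : Γ) (x : X) :
    (h.proj l (π g x) : X) = π g (h.proj l x) := by
  have hN : (L l).Normal := inferInstance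
  refine h.proj_map l (π g) (fun k hk x => ⟨g * k * g⁻¹, hN.conj_mem k hk g, ?_⟩)
    (fun k hk => ⟨g⁻¹ * k * g, by simpa using hN.conj_mem k hk g⁻¹, fun x => ?_⟩) x
  · simp only [← Module.End.mul_apply, ← map_mul, inv_mul_cancel_right]
  · simp only [← Module.End.mul_apply, ← map_mul]
    congr 2; group

theorem proj_comm (h : IsSmoothFor π L) (l : ℕ+) (T : X →ₗ[ℂ] X)
    (hT : ∀ g x, T (π g x) = π g (T x)) (x : X) : (h.proj l (T x) : X) = T (h.proj l x) :=
  h.proj_map l T (fun g hg x => ⟨g, hg, hT g x⟩) (fun g hg => ⟨g, hg, fun x => (hT g x).symm⟩) x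

theorem isRetract_fixed (h : IsSmoothFor π L) (l : ℕ+) :
    IsRetract π (onFixed π (L l)) (fixedVectors π (L l)).subtype (h.proj l) where
  incl_comm _ _ := rfl
  proj_comm g x := Subtype.ext (h.proj_apply l g x)
  proj_incl y := Subtype.ext (h.proj_of_mem y.2)
  central T hT x := (h.proj_comm l T hT x).symm

/-- The inclusion of the quotient `X^{L l} / X^{L j}` in `X`, as a complement of `X^{L j}`. -/
def inclQuotient (h : IsSmoothFor π L) (l j : ℕ+) :
    (fixedVectors π (L l) ⧸ (fixedVectors π (L j)).submoduleOf (fixedVectors π (L l))) →ₗ[ℂ] X :=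
  Submodule.liftQ _ ((LinearMap.id - (fixedVectors π (L j)).subtype ∘ₗ h.proj j) ∘ₗ
    (fixedVectors π (L l)).subtype) fun x hx => by
      have hx' : (x : X) ∈ fixedVectors π (L j) := hx
      rw [LinearMap.mem_ker]
      change (x : X) - h.proj j x = 0
      rw [h.proj_of_mem hx', sub_self]

theorem inclQuotient_mk (h : IsSmoothFor π L) (l j : ℕ+) (x : fixedVectors π (L l)) :
    h.inclQuotient l j (Submodule.Quotient.mk x) = (x : X) - h.proj j (x : X) := rfl

/-- The projection of `X` onto `X^{L l} / X^{L j}`. -/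
def projQuotient (h : IsSmoothFor π L) (l j : ℕ+) :
    X →ₗ[ℂ] (fixedVectors π (L l) ⧸ (fixedVectors π (L j)).submoduleOf (fixedVectors π (L l))) :=
  Submodule.mkQ _ ∘ₗ h.proj l

theorem inclQuotient_projQuotient (h : IsSmoothFor π L) {l j : ℕ+} (hjl : j ≤ l) (x : X) :
    h.inclQuotient l j (h.projQuotient l j x) = h.proj l x - h.proj j x := by
  change h.inclQuotient l j (Submodule.Quotient.mk (h.proj l x)) = _
  rw [inclQuotient_mk, h.proj_proj hjl]

theorem isRetract_quotient (h : IsSmoothFor π L) {l j : ℕ+} (hjl : j ≤ l) :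
    IsRetract π (fixedQuotient π (L l) (L j)) (h.inclQuotient l j) (h.projQuotient l j) where
  incl_comm g y := by
    induction y using Submodule.Quotient.induction_on with
    | H y =>
      rw [inclQuotient_mk, map_sub, ← h.proj_apply]
      rfl
  proj_comm g x := by
    change Submodule.Quotient.mk (h.proj l (π g x)) =
      Submodule.Quotient.mk (onFixed π (L l) g (h.proj l x))
    congr 1
    exact Subtype.ext (h.proj_apply l g x)
  proj_incl y := by
    induction y using Submodule.Quotient.induction_on with
    | H y =>
      rw [inclQuotient_mk]
      refine (Submodule.Quotient.eq _).2 ?_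
      change (h.proj l ((y : X) - h.proj j (y : X)) : X) - y ∈ fixedVectors π (L j)
      have h1 := h.proj_of_mem (sub_mem y.2 (fixedVectors_anti (h.antitone hjl) (h.proj j (y : X)).2))
      rw [h1, sub_sub_cancel_left]
      exact neg_mem (h.proj j (y : X)).2
  central T hT x := by
    rw [h.inclQuotient_projQuotient hjl, h.inclQuotient_projQuotient hjl, map_sub,
      h.proj_comm l T hT, h.proj_comm j T hT]

theorem quotient_trivial (l j : ℕ+) (g : Γ) (hg : g ∈ L l)
    (y : fixedVectors π (L l) ⧸ (fixedVectors π (L j)).submoduleOf (fixedVectors π (L l))) :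
    fixedQuotient π (L l) (L j) g y = y := by
  induction y using Submodule.Quotient.induction_on with
  | H y =>
    change Submodule.Quotient.mk (onFixed π (L l) g y) = _
    congr 1
    exact Subtype.ext (mem_fixedVectors.1 y.2 g hg)

theorem pnat_sub_one_add_one {l : ℕ+} (hl : 1 < l) : l - 1 + 1 = l := by
  rw [add_comm]; exact PNat.add_sub_of_lt hl

theorem projQuotient_inclQuotient_of_lt (h : IsSmoothFor π L) {l j l' j' : ℕ+} (hjl : j ≤ l)
    (hlj : l ≤ j')
    (y : fixedVectors π (L l) ⧸ (fixedVectors π (L j)).submoduleOf (fixedVectors π (L l))) :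
    h.projQuotient l' j' (h.inclQuotient l j y) = 0 := by
  induction y using Submodule.Quotient.induction_on with
  | H y =>
    rw [inclQuotient_mk]
    refine (Submodule.Quotient.mk_eq_zero _).2 ?_
    change (h.proj l' ((y : X) - h.proj j (y : X)) : X) ∈ fixedVectors π (L j')
    have h1 : (y : X) - h.proj j (y : X) ∈ fixedVectors π (L j') :=
      sub_mem (fixedVectors_anti (h.antitone hlj) y.2)
        (fixedVectors_anti (h.antitone (hjl.trans hlj)) (h.proj j (y : X)).2)
    rcases le_total l' j' with h2 | h2
    · exact fixedVectors_anti (h.antitone h2) (h.proj l' _).2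
    · rw [h.proj_of_mem (fixedVectors_anti (h.antitone h2) h1)]
      exact h1

theorem projQuotient_inclQuotient_of_gt (h : IsSmoothFor π L) {l j l' j' : ℕ+}
    (hlj : l' ≤ j)
    (y : fixedVectors π (L l) ⧸ (fixedVectors π (L j)).submoduleOf (fixedVectors π (L l))) :
    h.projQuotient l' j' (h.inclQuotient l j y) = 0 := by
  induction y using Submodule.Quotient.induction_on with
  | H y =>
    rw [inclQuotient_mk]
    refine (Submodule.Quotient.mk_eq_zero _).2 ?_
    change (h.proj l' ((y : X) - h.proj j (y : X)) : X) ∈ fixedVectors π (L j')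
    rw [map_sub, h.proj_proj hlj, sub_self]
    exact zero_mem _

theorem projQuotient_of_mem (h : IsSmoothFor π L) {l j : ℕ+} (hjl : j ≤ l) {x : X}
    (hx : x ∈ fixedVectors π (L j)) : h.projQuotient l j x = 0 := by
  refine (Submodule.Quotient.mk_eq_zero _).2 ?_
  change (h.proj l x : X) ∈ fixedVectors π (L j)
  rw [h.proj_of_mem (fixedVectors_anti (h.antitone hjl) hx)]
  exact hx

theorem pnat_sub_one_lt {l : ℕ+} (hl : 1 < l) : l - 1 < l := by
  conv_rhs => rw [← pnat_sub_one_add_one hl]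
  exact PNat.lt_add_right _ _

theorem le_pnat_sub_one {m l : ℕ+} (hl : m < l) : m ≤ l - 1 := by
  rwa [← PNat.lt_add_one_iff, pnat_sub_one_add_one (one_le.trans_lt hl)]

/-- A smooth representation is the direct sum of the successive quotients of its filtration. -/
theorem nonempty_equiv (h : IsSmoothFor π L) (m : ℕ+) :
    Nonempty (Representation.Equiv π ((onFixed π (L m)).prod
      (Representation.directSum fun l : {l : ℕ+ // m < l} =>
        fixedQuotient π (L l) (L (l - 1))))) := by
  have hlt : ∀ l : {l : ℕ+ // m < l}, (l : ℕ+) - 1 ≤ l := fun l =>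
    (pnat_sub_one_lt (one_le.trans_lt l.2)).le
  refine nonempty_equiv_of_orthogonal π (onFixed π (L m)) (fixedVectors π (L m)).subtype
    (fun l : {l : ℕ+ // m < l} => fixedQuotient π (L l) (L (l - 1)))
    (fun l => h.inclQuotient l (l - 1)) (fun l => h.projQuotient l (l - 1)) (fun _ _ => rfl)
    (fun l => (h.isRetract_quotient (hlt l)).incl_comm) Subtype.val_injective
    (fun l => (h.isRetract_quotient (hlt l)).proj_incl) ?_ ?_ ?_
  · intro j l hjl y
    rcases lt_or_gt_of_ne (fun e => hjl (Subtype.ext e)) with hc | hc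
    · exact h.projQuotient_inclQuotient_of_gt (le_pnat_sub_one hc) y
    · exact h.projQuotient_inclQuotient_of_lt (hlt l) (le_pnat_sub_one hc) y
  · intro j y
    exact h.projQuotient_of_mem (hlt j)
      (fixedVectors_anti (h.antitone (le_pnat_sub_one j.2)) y.2)
  · intro P h0 h1 x
    -- Induction on the level: a vector fixed by `L (N + 1)` is its component in the quotient of
    -- that level plus its projection to level `N`. The case `N = 1` is not vacuous only for `m =
    -- 1`, where it belongs to the first summand.
    have key : ∀ N : ℕ+, m ≤ N → fixedVectors π (L N) ≤ P := by
      intro N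
      induction N with
      | one => exact fun hN x hx => h0 ⟨x, fixedVectors_anti (h.antitone (one_le (a := m))) hx⟩
      | succ N ih =>
        intro hN x hx
        rcases hN.lt_or_eq with hmN | rfl
        · have hs : N + 1 - 1 = N :=
            add_right_cancel (pnat_sub_one_add_one (one_le.trans_lt hmN))
          have h2 : x - h.proj (N + 1 - 1) x ∈ P :=
            h1 ⟨N + 1, hmN⟩ (Submodule.Quotient.mk ⟨x, hx⟩)
          rw [hs] at h2
          simpa using add_mem (ih (PNat.lt_add_one_iff.1 hmN) (h.proj N x).2) h2
        · exact h0 ⟨x, hx⟩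
    obtain ⟨N, hN⟩ := h.exists_fixed x
    exact key (max m N) (le_max_left _ _) (fixedVectors_anti (h.antitone (le_max_right _ _)) hN)

end IsSmoothFor

end Filtration

end

end KTypes

namespace KTypes

noncomputable section

set_option linter.unusedSectionVars false

/-! ### Bi-equivariant functions on `SL₂` of a discrete valuation ring -/

section BiEquivariant

open Matrix IsLocalRing

variable {R : Type*} [CommRing R]

theorem entry_mul (g k : SpecialLinearGroup (Fin 2) R) (i j : Fin 2) :
    (g * k) i j = g i 0 * k 0 j + g i 1 * k 1 j := by
  change (g.1 * k.1) i j = _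
  rw [Matrix.mul_apply, Fin.sum_univ_two]

theorem entry_det (g : SpecialLinearGroup (Fin 2) R) : g 0 0 * g 1 1 - g 0 1 * g 1 0 = 1 := by
  have := g.det_coe
  rwa [Matrix.det_fin_two] at this

theorem entry_ext {g k : SpecialLinearGroup (Fin 2) R} (h00 : g 0 0 = k 0 0)
    (h01 : g 0 1 = k 0 1) (h10 : g 1 0 = k 1 0) (h11 : g 1 1 = k 1 1) : g = k := by
  apply Subtype.ext
  ext i j
  fin_cases i <;> fin_cases j
  exacts [h00, h01, h10, h11]

/-- The upper triangular matrix with diagonal entries `a`, `a⁻¹` and upper right entry `x`. -/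
def borelElt (a : Rˣ) (x : R) : SpecialLinearGroup (Fin 2) R :=
  ⟨!![(a : R), x; 0, ((a⁻¹ : Rˣ) : R)], by simp [Matrix.det_fin_two]⟩

/-- The lower unipotent matrix with lower left entry `c`. -/
def lowerElt (c : R) : SpecialLinearGroup (Fin 2) R :=
  ⟨!![1, 0; c, 1], by simp [Matrix.det_fin_two]⟩

variable (R) in
/-- The nontrivial Weyl element. -/
def weylElt : SpecialLinearGroup (Fin 2) R :=
  ⟨!![0, -1; 1, 0], by simp [Matrix.det_fin_two]⟩

@[simp] theorem borelElt_00 (a : Rˣ) (x : R) : borelElt a x 0 0 = a := rfl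
@[simp] theorem borelElt_01 (a : Rˣ) (x : R) : borelElt a x 0 1 = x := rfl
@[simp] theorem borelElt_10 (a : Rˣ) (x : R) : borelElt a x 1 0 = 0 := rfl
@[simp] theorem borelElt_11 (a : Rˣ) (x : R) : borelElt a x 1 1 = ((a⁻¹ : Rˣ) : R) := rfl
@[simp] theorem lowerElt_00 (c : R) : lowerElt c 0 0 = 1 := rfl
@[simp] theorem lowerElt_01 (c : R) : lowerElt c 0 1 = 0 := rfl
@[simp] theorem lowerElt_10 (c : R) : lowerElt c 1 0 = c := rfl
@[simp] theorem lowerElt_11 (c : R) : lowerElt c 1 1 = 1 := rfl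
@[simp] theorem weylElt_00 : weylElt R 0 0 = 0 := rfl
@[simp] theorem weylElt_01 : weylElt R 0 1 = -1 := rfl
@[simp] theorem weylElt_10 : weylElt R 1 0 = 1 := rfl
@[simp] theorem weylElt_11 : weylElt R 1 1 = 0 := rfl

theorem lowerElt_zero : lowerElt (0 : R) = 1 := by
  apply entry_ext <;> simp

/-- Modulo the Borel subgroup on the left, a matrix is determined by its lower row up to a unit.
Over a local ring one of the two lower entries is a unit. This is the case of the lower right one;
the other case is the big cell. -/
theorem eq_borelElt_mul_lowerElt {g : SpecialLinearGroup (Fin 2) R} (d : Rˣ) (hd : (d : R) = g 1 1) :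
    g = borelElt d⁻¹ (g 0 1) * lowerElt (((d⁻¹ : Rˣ) : R) * g 1 0) := by
  have h := entry_det g
  have e : (d : R) * ((d⁻¹ : Rˣ) : R) = 1 := by simp
  rw [← hd] at h
  apply entry_ext <;> simp only [entry_mul, borelElt_00, borelElt_01, borelElt_10, borelElt_11,
    lowerElt_00, lowerElt_01, lowerElt_10, lowerElt_11, inv_inv]
  · linear_combination ((d⁻¹ : Rˣ) : R) * h - g 0 0 * e
  · ring
  · linear_combination -g 1 0 * e
  · rw [hd]; ring

theorem eq_borelElt_mul_weylElt {g : SpecialLinearGroup (Fin 2) R} (c : Rˣ) (hc : (c : R) = g 1 0) :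
    g = borelElt c⁻¹ (g 0 0) * (weylElt R * borelElt 1 (((c⁻¹ : Rˣ) : R) * g 1 1)) := by
  have h := entry_det g
  have e : (c : R) * ((c⁻¹ : Rˣ) : R) = 1 := by simp
  rw [← hc] at h
  apply entry_ext <;> simp only [entry_mul, borelElt_00, borelElt_01, borelElt_10, borelElt_11,
    weylElt_00, weylElt_01, weylElt_10, weylElt_11, inv_inv, inv_one, Units.val_one]
  · ring
  · linear_combination -((c⁻¹ : Rˣ) : R) * h - g 0 1 * e
  · rw [hc]; ring
  · linear_combination -g 1 1 * e

/-- The kernel of the reduction of `SL₂(R)` modulo the ideal `I`. -/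
abbrev congruenceKer (I : Ideal R) : Subgroup (SpecialLinearGroup (Fin 2) R) :=
  (SpecialLinearGroup.map (n := Fin 2) (Ideal.Quotient.mk I)).ker

theorem mem_congruenceKer {I : Ideal R} {k : SpecialLinearGroup (Fin 2) R} :
    k ∈ congruenceKer I ↔ k 0 0 - 1 ∈ I ∧ k 0 1 ∈ I ∧ k 1 0 ∈ I ∧ k 1 1 - 1 ∈ I := by
  rw [MonoidHom.mem_ker]
  have e : ∀ i j, (SpecialLinearGroup.map (n := Fin 2) (Ideal.Quotient.mk I) k) i j =
    Ideal.Quotient.mk I (k i j) := fun i j => rfl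
  simp only [← Ideal.Quotient.eq_zero_iff_mem (I := I), map_sub, map_one, sub_eq_zero]
  constructor
  · intro h
    refine ⟨?_, ?_, ?_, ?_⟩ <;> rw [← e, h] <;> simp
  · rintro ⟨h1, h2, h3, h4⟩
    apply entry_ext <;> rw [e] <;> simp [*]

variable [IsLocalRing R]

theorem isUnit_lower_row (g : SpecialLinearGroup (Fin 2) R) (h : ¬ IsUnit (g 1 1)) :
    IsUnit (g 1 0) := by
  by_contra h'
  have h1 : g 1 1 ∈ maximalIdeal R := h
  have h2 : g 1 0 ∈ maximalIdeal R := h'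
  have h3 : (1 : R) ∈ maximalIdeal R := by
    rw [← entry_det g]
    exact sub_mem (Ideal.mul_mem_left _ _ h1) (Ideal.mul_mem_left _ _ h2)
  exact h3 isUnit_one

theorem isUnit_of_sub_mem {a b : R} (ha : IsUnit a) (h : b - a ∈ maximalIdeal R) : IsUnit b := by
  by_contra h'
  have h1 : b ∈ maximalIdeal R := h'
  have h2 : a ∈ maximalIdeal R := by
    have := sub_mem h1 h
    rwa [sub_sub_cancel] at this
  exact h2 ha

theorem mem_of_mul_mem_pow {j : ℕ} {a : R} (d : R) (hd : IsUnit d)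
    (h : a * d ∈ maximalIdeal R ^ j) : a ∈ maximalIdeal R ^ j := by
  obtain ⟨u, rfl⟩ := hd
  have := Ideal.mul_mem_right ((u⁻¹ : Rˣ) : R) _ h
  rwa [mul_assoc, Units.mul_inv, mul_one] at this

/-- Powers of the maximal ideal with positive exponent consist of non-units. -/
theorem mem_max_of_mem_pow {j : ℕ} (hj : j ≠ 0) {a : R} (h : a ∈ maximalIdeal R ^ j) :
    a ∈ maximalIdeal R := Ideal.pow_le_self hj h

variable {θ : Rˣ →* ℂˣ} {l : ℕ} {φ : SpecialLinearGroup (Fin 2) R → ℂ}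

variable (θ l φ) in
/-- Functions on `SL₂(R)` which are equivariant for the character `θ` of the Borel subgroup on both
sides, and invariant under the principal congruence subgroup of level `l`. -/
structure IsBiEquivariant : Prop where
  left : ∀ a x g, φ (borelElt a x * g) = θ a * φ g
  right : ∀ a x g, φ (g * borelElt a x) = θ a * φ g
  invariant : ∀ g, ∀ k ∈ congruenceKer (maximalIdeal R ^ l), φ (g * k) = φ g

/-- Raising to the power `q` improves a congruence `u ≡ 1` by one power of `𝔪`: the geometric sum
has `q` terms congruent to `1`, and `q = 0` in the residue field. As `q` is odd, `u` is killed
modulo `𝔪ˡ` by an odd exponent, so it counts as a square there. -/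
theorem exists_odd_pow_sub_one_mem [Finite (ResidueField R)] (hodd : Odd (Nat.card (ResidueField R)))
    {u : R} (hu : u - 1 ∈ maximalIdeal R) (l : ℕ) :
    ∃ r : ℕ, u ^ (2 * r + 1) - 1 ∈ maximalIdeal R ^ l := by
  set q := Nat.card (ResidueField R) with hq
  have key : ∀ N : ℕ, u ^ (q ^ N) - 1 ∈ maximalIdeal R ^ (N + 1) := by
    intro N
    induction N with
    | zero => simpa using hu
    | succ N ih =>
      rw [pow_succ q N, pow_mul, ← mul_geom_sum, pow_succ (maximalIdeal R) (N + 1)]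
      refine Ideal.mul_mem_mul ih ?_
      rw [← residue_eq_zero_iff, map_sum]
      have h1 : residue R (u ^ q ^ N) = 1 := by
        rw [← sub_eq_zero, ← map_one (residue R), ← map_sub, residue_eq_zero_iff]
        exact Ideal.pow_le_self (Nat.succ_ne_zero N) ih
      simp only [map_pow] at h1 ⊢
      simp only [h1, one_pow, Finset.sum_const, Finset.card_range, nsmul_eq_mul, mul_one]
      let := Fintype.ofFinite (ResidueField R)
      rw [hq, Nat.card_eq_fintype_card]
      exact FiniteField.cast_card_eq_zero _
  obtain ⟨r, hr⟩ := hodd.pow (n := l)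
  exact ⟨r, hr ▸ Ideal.pow_le_pow_right (Nat.le_succ l) (key l)⟩

/-- A character of odd order of `1 + 𝔪`, of conductor dividing `𝔪ᵐ`, is determined by its square. -/
theorem sq_ne_one_of_ne_one [Finite (ResidueField R)] (hodd : Odd (Nat.card (ResidueField R)))
    {m : ℕ} (hθ : ∀ u : Rˣ, (u : R) - 1 ∈ maximalIdeal R ^ m → θ u = 1) {v : Rˣ}
    (hv : (v : R) - 1 ∈ maximalIdeal R) (h : θ v ≠ 1) : θ v ^ 2 ≠ 1 := by
  intro h2
  obtain ⟨r, hr⟩ := exists_odd_pow_sub_one_mem hodd hv m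
  apply h
  have := hθ (v ^ (2 * r + 1)) (by simpa using hr)
  rwa [map_pow, pow_succ, pow_mul, h2, one_pow, one_mul] at this

namespace IsBiEquivariant

theorem apply_of_unit_right (h : IsBiEquivariant θ l φ) {g : SpecialLinearGroup (Fin 2) R} (d : Rˣ)
    (hd : (d : R) = g 1 1) : φ g = θ d⁻¹ * φ (lowerElt (((d⁻¹ : Rˣ) : R) * g 1 0)) := by
  conv_lhs => rw [eq_borelElt_mul_lowerElt d hd]
  rw [h.left]

theorem apply_of_unit_left (h : IsBiEquivariant θ l φ) {g : SpecialLinearGroup (Fin 2) R} (c : Rˣ)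
    (hc : (c : R) = g 1 0) : φ g = θ c⁻¹ * φ (weylElt R) := by
  conv_lhs => rw [eq_borelElt_mul_weylElt c hc]
  rw [h.left, h.right, map_one, Units.val_one, one_mul]

/-- Moving `diag(s, s⁻¹)` across the lower unipotent multiplies its entry by `s²`. The factors
`θ(s)` from the left and the right cancel. -/
theorem lower_sq_mul (h : IsBiEquivariant θ l φ) (s : Rˣ) (c : R) :
    φ (lowerElt ((s : R) ^ 2 * c)) = φ (lowerElt c) := by
  have e : lowerElt c * borelElt s 0 = borelElt s 0 * lowerElt ((s : R) ^ 2 * c) := by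
    have e : (s : R) * ((s⁻¹ : Rˣ) : R) = 1 := by simp
    apply entry_ext <;> simp only [entry_mul, borelElt_00, borelElt_01, borelElt_10, borelElt_11,
      lowerElt_00, lowerElt_01, lowerElt_10, lowerElt_11]
    · ring
    · ring
    · linear_combination -(s * c) * e
    · ring
  have h1 := h.right s 0 (lowerElt c)
  rw [e, h.left] at h1
  exact mul_left_cancel₀ (Units.ne_zero _) h1

theorem lower_congr (h : IsBiEquivariant θ l φ) {c c' : R} (hc : c' - c ∈ maximalIdeal R ^ l) :
    φ (lowerElt c') = φ (lowerElt c) := by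
  have e : lowerElt c' = lowerElt c * lowerElt (c' - c) := by
    apply entry_ext <;> simp [entry_mul]
  rw [e]
  apply h.invariant
  rw [mem_congruenceKer]
  simpa using hc

/-- Right multiplication by a suitable upper unipotent keeps the lower left entry `c` and turns the
lower right entry into `v²`. The value is therefore multiplied by `θ(v)⁻²`, since the remaining
change of `c` by a square is harmless. -/
theorem lower_eq_zero (h : IsBiEquivariant θ l φ) {c : R} (v : Rˣ) (hv : c ∣ (v : R) - 1)
    (hθ : θ v ^ 2 ≠ 1) : φ (lowerElt c) = 0 := by
  obtain ⟨y, hy⟩ := hv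
  -- With `v = 1 + cy`, the entry `x = 2y + cy²` is the solution of `1 + cx = v²`.
  have h1 : φ (lowerElt c * borelElt 1 (2 * y + c * y ^ 2)) = φ (lowerElt c) := by
    rw [h.right, map_one, Units.val_one, one_mul]
  rw [h.apply_of_unit_right (v ^ 2) (by
    simp only [entry_mul, borelElt_01, borelElt_11, lowerElt_10, lowerElt_11]
    rw [inv_one, Units.val_one]
    push_cast
    linear_combination (v + 1 + c * y) * hy)] at h1
  have e : (lowerElt c * borelElt 1 (2 * y + c * y ^ 2) : SpecialLinearGroup (Fin 2) R) 1 0 = c := by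
    simp [entry_mul]
  rw [e, ← inv_pow, Units.val_pow_eq_pow_val, h.lower_sq_mul] at h1
  by_contra h0
  have h2 : ((θ (v⁻¹ ^ 2) : ℂˣ) : ℂ) = 1 := mul_right_cancel₀ h0 (h1.trans (one_mul _).symm)
  have h3 : θ (v⁻¹ ^ 2) = 1 := Units.ext h2
  rw [map_pow, map_inv, inv_pow, inv_eq_one] at h3
  exact hθ h3

/-- The Weyl element conjugates `diag(s, s⁻¹)` to its inverse, so a nonzero value forces `θ(s)⁻¹ =
θ(s)`. -/
theorem weyl_eq_zero (h : IsBiEquivariant θ l φ) (s : Rˣ) (hθ : θ s ^ 2 ≠ 1) :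
    φ (weylElt R) = 0 := by
  have e : weylElt R * borelElt s 0 = borelElt s⁻¹ 0 * weylElt R := by
    apply entry_ext <;> simp [entry_mul]
  have h1 := h.right s 0 (weylElt R)
  rw [e, h.left] at h1
  by_contra h0
  have h2 : θ s⁻¹ = θ s := Units.ext (mul_right_cancel₀ h0 h1)
  rw [map_inv, inv_eq_iff_mul_eq_one, ← pow_two] at h2
  exact hθ h2

theorem eq_zero (h : IsBiEquivariant θ l φ) (h1 : ∀ c, φ (lowerElt c) = 0)
    (h2 : φ (weylElt R) = 0) : φ = 0 := by
  funext g
  by_cases hd : IsUnit (g 1 1)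
  · rw [h.apply_of_unit_right hd.unit rfl, h1, mul_zero]; rfl
  · rw [h.apply_of_unit_left (isUnit_lower_row g hd).unit rfl, h2, mul_zero]; rfl

end IsBiEquivariant

/-- The function supported on matrices with unit lower right entry `d` for which the product of the
lower entries satisfies `P`, with value `θ(d)⁻¹`. -/
def lowerRowFun (θ : Rˣ →* ℂˣ) (P : R → Prop) (g : SpecialLinearGroup (Fin 2) R) : ℂ :=
  open Classical in
  if h : IsUnit (g 1 1) ∧ P (g 1 0 * g 1 1) then θ h.1.unit⁻¹ else 0

theorem lowerRowFun_of (P : R → Prop) {g : SpecialLinearGroup (Fin 2) R} (d : Rˣ)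
    (hd : (d : R) = g 1 1) (hP : P (g 1 0 * g 1 1)) : lowerRowFun θ P g = θ d⁻¹ := by
  have h : IsUnit (g 1 1) ∧ P (g 1 0 * g 1 1) := ⟨hd ▸ d.isUnit, hP⟩
  rw [lowerRowFun, dif_pos h]
  have : h.1.unit = d := Units.ext hd.symm
  rw [this]

theorem lowerRowFun_eq_zero (P : R → Prop) {g : SpecialLinearGroup (Fin 2) R}
    (h : ¬ (IsUnit (g 1 1) ∧ P (g 1 0 * g 1 1))) : lowerRowFun θ P g = 0 := by
  rw [lowerRowFun, dif_neg h]

theorem lowerRowFun_transform (P : R → Prop) {g g' : SpecialLinearGroup (Fin 2) R} (a : Rˣ)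
    (h : ∀ d : Rˣ, (d : R) = g 1 1 → P (g 1 0 * g 1 1) → ∃ d' : Rˣ, (d' : R) = g' 1 1 ∧
      P (g' 1 0 * g' 1 1) ∧ θ d'⁻¹ = θ a * θ d⁻¹)
    (h' : IsUnit (g' 1 1) → P (g' 1 0 * g' 1 1) → IsUnit (g 1 1) ∧ P (g 1 0 * g 1 1)) :
    lowerRowFun θ P g' = θ a * lowerRowFun θ P g := by
  by_cases hg : IsUnit (g 1 1) ∧ P (g 1 0 * g 1 1)
  · obtain ⟨d', h1, h2, h3⟩ := h hg.1.unit rfl hg.2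
    rw [lowerRowFun_of P d' h1 h2, lowerRowFun_of P hg.1.unit rfl hg.2, h3, Units.val_mul]
  · rw [lowerRowFun_eq_zero P hg, lowerRowFun_eq_zero P (fun h0 => hg (h' h0.1 h0.2)), mul_zero]

/-- For a lower row `(c, d)`, left translation by the Borel subgroup multiplies the product `cd` by
the square of a unit. Right translation by `borelElt a x` multiplies it by an element of `1 + 𝔪`,
and right translation by the congruence subgroup adds an element of `𝔪ˡ`. The conditions on `P` are
the stability under these changes; the value `θ(d)⁻¹` transforms correctly because `c ∈ 𝔪ʲ` and `θ`
is trivial on `1 + 𝔪ʲ`. -/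
theorem isBiEquivariant_lowerRowFun {j : ℕ} (hj : j ≠ 0) (hjl : j ≤ l)
    (hθ : ∀ u : Rˣ, (u : R) - 1 ∈ maximalIdeal R ^ j → θ u = 1) (P : R → Prop)
    (hP : ∀ r, P r → r ∈ maximalIdeal R ^ j)
    (hsq : ∀ (s : Rˣ) r, P r → P ((s : R) ^ 2 * r))
    (hmul : ∀ r, ∀ x ∈ maximalIdeal R, P r → P (r * (1 + x)))
    (hadd : ∀ r, ∀ y ∈ maximalIdeal R ^ l, P r → P (r + y)) :
    IsBiEquivariant θ l (lowerRowFun θ P) where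
  left a x g := by
    have e0 : (borelElt a x * g) 1 0 = ((a⁻¹ : Rˣ) : R) * g 1 0 := by simp [entry_mul]
    have e1 : (borelElt a x * g) 1 1 = ((a⁻¹ : Rˣ) : R) * g 1 1 := by simp [entry_mul]
    apply lowerRowFun_transform
    · intro d hd hPd
      refine ⟨a⁻¹ * d, by rw [e1, ← hd]; rfl, ?_, by simp [mul_comm]⟩
      have := hsq a⁻¹ _ hPd
      rw [e0, e1]
      convert this using 1
      ring
    · intro h1 h2
      rw [e1, IsUnit.mul_iff] at h1
      refine ⟨h1.2, ?_⟩
      have := hsq a _ h2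
      rw [e0, e1] at this
      convert this using 1
      have e : (a : R) * ((a⁻¹ : Rˣ) : R) = 1 := by simp
      linear_combination -(g 1 0 * g 1 1) * (1 + a * ((a⁻¹ : Rˣ) : R)) * e
  right a x g := by
    have key : ∀ (a : Rˣ) (x : R) (g : SpecialLinearGroup (Fin 2) R) (d : Rˣ), (d : R) = g 1 1 →
        P (g 1 0 * g 1 1) → ∃ d' : Rˣ, (d' : R) = (g * borelElt a x) 1 1 ∧
          P ((g * borelElt a x) 1 0 * (g * borelElt a x) 1 1) ∧ θ d'⁻¹ = θ a * θ d⁻¹ := by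
      intro a x g d hd hPd
      have e0 : (g * borelElt a x) 1 0 = g 1 0 * a := by simp [entry_mul]
      have e1 : (g * borelElt a x) 1 1 = g 1 0 * x + g 1 1 * ((a⁻¹ : Rˣ) : R) := by
        simp [entry_mul]
      have hc : g 1 0 ∈ maximalIdeal R ^ j := mem_of_mul_mem_pow _ (hd ▸ d.isUnit) (hP _ hPd)
      have ea : (a : R) * ((a⁻¹ : Rˣ) : R) = 1 := by simp
      have ed : (d : R) * ((d⁻¹ : Rˣ) : R) = 1 := by simp
      have hy : g 1 0 * x * a * ((d⁻¹ : Rˣ) : R) ∈ maximalIdeal R ^ j :=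
        Ideal.mul_mem_right _ _ (Ideal.mul_mem_right _ _ (Ideal.mul_mem_right _ _ hc))
      -- The new lower right entry is `a⁻¹d(1 + cxa/d)`, and the new product of the lower entries is
      -- `cd(1 + cxa/d)`.
      have hu : IsUnit (1 + g 1 0 * x * a * ((d⁻¹ : Rˣ) : R)) :=
        isUnit_of_sub_mem isUnit_one (by
          rw [add_sub_cancel_left]; exact mem_max_of_mem_pow hj hy)
      have hθu : θ hu.unit = 1 := hθ _ (by
        rw [IsUnit.unit_spec, add_sub_cancel_left]; exact hy)
      refine ⟨a⁻¹ * d * hu.unit, ?_, ?_, ?_⟩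
      · push_cast
        rw [e1, ← hd, IsUnit.unit_spec]
        linear_combination (g 1 0 * x) * ((a : R) * ((a⁻¹ : Rˣ) : R)) * ed + (g 1 0 * x) * ea
      · rw [e0, e1]
        convert hmul _ _ (mem_max_of_mem_pow hj hy) hPd using 1
        rw [← hd]
        linear_combination (g 1 0 * d) * ea - (g 1 0 ^ 2 * x * a) * ed
      · rw [mul_inv, mul_inv, map_mul, map_mul, map_inv θ hu.unit, hθu]
        simp
    apply lowerRowFun_transform
    · exact key a x g
    · intro h1 h2
      have hb : borelElt a x * borelElt a⁻¹ (-x) = 1 := by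
        apply entry_ext <;> simp [entry_mul, mul_comm]
      -- The support is preserved in the opposite direction by applying the same statement to the
      -- inverse translation.
      obtain ⟨d', h3, h4, -⟩ := key a⁻¹ (-x) (g * borelElt a x) h1.unit rfl h2
      rw [mul_assoc, hb, mul_one] at h3 h4
      exact ⟨h3 ▸ d'.isUnit, h4⟩
  invariant g k hk := by
    have key : ∀ k ∈ congruenceKer (maximalIdeal R ^ l), ∀ (g : SpecialLinearGroup (Fin 2) R)
        (d : Rˣ), (d : R) = g 1 1 → P (g 1 0 * g 1 1) → ∃ d' : Rˣ, (d' : R) = (g * k) 1 1 ∧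
          P ((g * k) 1 0 * (g * k) 1 1) ∧ θ d'⁻¹ = θ 1 * θ d⁻¹ := by
      intro k hk g d hd hPd
      obtain ⟨k00, k01, k10, k11⟩ := mem_congruenceKer.1 hk
      have e0 : (g * k) 1 0 = g 1 0 + (g 1 0 * (k 0 0 - 1) + g 1 1 * k 1 0) := by
        rw [entry_mul]; ring
      have e1 : (g * k) 1 1 = g 1 1 + (g 1 0 * k 0 1 + g 1 1 * (k 1 1 - 1)) := by
        rw [entry_mul]; ring
      have y0 : g 1 0 * (k 0 0 - 1) + g 1 1 * k 1 0 ∈ maximalIdeal R ^ l :=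
        add_mem (Ideal.mul_mem_left _ _ k00) (Ideal.mul_mem_left _ _ k10)
      have y1 : g 1 0 * k 0 1 + g 1 1 * (k 1 1 - 1) ∈ maximalIdeal R ^ l :=
        add_mem (Ideal.mul_mem_left _ _ k01) (Ideal.mul_mem_left _ _ k11)
      generalize g 1 0 * (k 0 0 - 1) + g 1 1 * k 1 0 = y at e0 y0
      generalize g 1 0 * k 0 1 + g 1 1 * (k 1 1 - 1) = z at e1 y1
      have ed : (d : R) * ((d⁻¹ : Rˣ) : R) = 1 := by simp
      have hz : z * ((d⁻¹ : Rˣ) : R) ∈ maximalIdeal R ^ j :=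
        Ideal.mul_mem_right _ _ (Ideal.pow_le_pow_right hjl y1)
      have hu : IsUnit (1 + z * ((d⁻¹ : Rˣ) : R)) :=
        isUnit_of_sub_mem isUnit_one (by
          rw [add_sub_cancel_left]; exact mem_max_of_mem_pow hj hz)
      have hθu : θ hu.unit = 1 := hθ _ (by
        rw [IsUnit.unit_spec, add_sub_cancel_left]; exact hz)
      refine ⟨d * hu.unit, ?_, ?_, ?_⟩
      · push_cast
        rw [e1, ← hd, IsUnit.unit_spec]
        linear_combination z * ed
      · have := hadd _ (g 1 0 * z + y * (g 1 1 + z))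
          (add_mem (Ideal.mul_mem_left _ _ y1) (Ideal.mul_mem_right _ _ y0)) hPd
        rw [e0, e1]
        convert this using 1
        ring
      · rw [mul_inv, map_mul, map_inv θ hu.unit, hθu]
        simp
    have := lowerRowFun_transform (θ := θ) P (g := g) (g' := g * k) 1 (key k hk g) (by
      intro h1 h2
      obtain ⟨d', h3, h4, -⟩ := key k⁻¹ (inv_mem hk) (g * k) h1.unit rfl h2
      rw [mul_inv_cancel_right] at h3 h4
      exact ⟨h3 ▸ d'.isUnit, h4⟩)
    rw [this, map_one, Units.val_one, one_mul]

/-- The function supported on the matrices with unit lower left entry `c`, with value `θ(c)⁻¹`. -/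
def bigCellFun (θ : Rˣ →* ℂˣ) (g : SpecialLinearGroup (Fin 2) R) : ℂ :=
  open Classical in
  if h : IsUnit (g 1 0) then θ h.unit⁻¹ else 0

theorem bigCellFun_of {g : SpecialLinearGroup (Fin 2) R} (c : Rˣ) (hc : (c : R) = g 1 0) :
    bigCellFun θ g = θ c⁻¹ := by
  have h : IsUnit (g 1 0) := hc ▸ c.isUnit
  rw [bigCellFun, dif_pos h]
  have : h.unit = c := Units.ext hc.symm
  rw [this]

theorem bigCellFun_eq_zero {g : SpecialLinearGroup (Fin 2) R} (h : ¬ IsUnit (g 1 0)) :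
    bigCellFun θ g = 0 := by rw [bigCellFun, dif_neg h]

/-- The value `θ(c)⁻¹` picks up `θ(a)⁻¹` under right translation, whereas `θ(a)` is wanted. This is
where `θ² = 1` enters. -/
theorem isBiEquivariant_bigCellFun
    (hθ : ∀ u : Rˣ, (u : R) - 1 ∈ maximalIdeal R → θ u = 1) (hsq : ∀ u, θ u ^ 2 = 1) :
    IsBiEquivariant θ 1 (bigCellFun θ) where
  left a x g := by
    have e0 : (borelElt a x * g) 1 0 = ((a⁻¹ : Rˣ) : R) * g 1 0 := by simp [entry_mul]
    by_cases h : IsUnit (g 1 0)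
    · rw [bigCellFun_of (g := borelElt a x * g) (a⁻¹ * h.unit) (by rw [e0]; simp),
        bigCellFun_of h.unit rfl]
      simp [mul_comm]
    · rw [bigCellFun_eq_zero h, bigCellFun_eq_zero, mul_zero]
      rw [e0, IsUnit.mul_iff]
      exact fun h' => h h'.2
  right a x g := by
    have e0 : (g * borelElt a x) 1 0 = g 1 0 * a := by simp [entry_mul]
    by_cases h : IsUnit (g 1 0)
    · rw [bigCellFun_of (g := g * borelElt a x) (h.unit * a) (by rw [e0]; simp),
        bigCellFun_of h.unit rfl]
      have := hsq a
      rw [pow_two, ← inv_eq_iff_mul_eq_one] at this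
      rw [mul_inv, map_mul, map_inv θ a, this, mul_comm, Units.val_mul]
    · rw [bigCellFun_eq_zero h, bigCellFun_eq_zero, mul_zero]
      rw [e0, IsUnit.mul_iff]
      exact fun h' => h h'.1
  invariant g k hk := by
    obtain ⟨k00, k01, k10, k11⟩ := mem_congruenceKer.1 hk
    have e0 : (g * k) 1 0 - g 1 0 = g 1 0 * (k 0 0 - 1) + g 1 1 * k 1 0 := by
      rw [entry_mul]; ring
    have y0 : (g * k) 1 0 - g 1 0 ∈ maximalIdeal R := by
      rw [e0, ← pow_one (maximalIdeal R)]
      exact add_mem (Ideal.mul_mem_left _ _ k00) (Ideal.mul_mem_left _ _ k10)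
    by_cases h : IsUnit (g 1 0)
    · have h' := isUnit_of_sub_mem h y0
      rw [bigCellFun_of h.unit rfl, bigCellFun_of h'.unit rfl]
      have : θ (h'.unit * h.unit⁻¹) = 1 := by
        apply hθ
        have e : ((h'.unit * h.unit⁻¹ : Rˣ) : R) - 1 =
            ((g * k) 1 0 - g 1 0) * ((h.unit⁻¹ : Rˣ) : R) := by
          have ed : g 1 0 * ((h.unit⁻¹ : Rˣ) : R) = 1 := by
            exact h.mul_val_inv
          rw [Units.val_mul, IsUnit.unit_spec]
          linear_combination ed
        rw [e]
        exact Ideal.mul_mem_right _ _ y0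
      rw [map_mul, map_inv, mul_inv_eq_one] at this
      rw [map_inv, map_inv, this]
    · rw [bigCellFun_eq_zero h, bigCellFun_eq_zero]
      exact fun h' => h (isUnit_of_sub_mem h' (by rw [← neg_sub]; exact neg_mem y0))

end BiEquivariant

end

end KTypes

namespace KTypes

noncomputable section

set_option linter.unusedSectionVars false

/-! ### Bi-equivariant functions over a discrete valuation ring, level by level -/

section Levels

open Matrix IsLocalRing

variable {R : Type*} [CommRing R] [IsDomain R] [IsDiscreteValuationRing R]
  {θ : Rˣ →* ℂˣ} {l m j : ℕ} {φ : SpecialLinearGroup (Fin 2) R → ℂ}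

theorem mem_maximalIdeal_pow_iff {p : R} (hp : Irreducible p) {x : R} :
    x ∈ maximalIdeal R ^ j ↔ p ^ j ∣ x := by
  rw [hp.maximalIdeal_eq, Ideal.span_singleton_pow, Ideal.mem_span_singleton]

theorem exists_eq_pow_mul_unit {p : R} (hp : Irreducible p) {c : R}
    (hc : c ∉ maximalIdeal R ^ (j + 1)) : ∃ k ≤ j, ∃ u : Rˣ, c = p ^ k * u := by
  have hc0 : c ≠ 0 := fun h => hc (h ▸ zero_mem _)
  obtain ⟨k, u, rfl⟩ := IsDiscreteValuationRing.eq_unit_mul_pow_irreducible hc0 hp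
  refine ⟨k, ?_, u, mul_comm _ _⟩
  by_contra hk
  apply hc
  rw [mem_maximalIdeal_pow_iff hp]
  exact Dvd.dvd.mul_left (pow_dvd_pow p (by omega)) _

theorem dvd_of_notMem_pow {c x : R} (hc : c ∉ maximalIdeal R ^ (j + 1))
    (hx : x ∈ maximalIdeal R ^ j) : c ∣ x := by
  obtain ⟨p, hp⟩ := IsDiscreteValuationRing.exists_irreducible R
  obtain ⟨k, hk, u, rfl⟩ := exists_eq_pow_mul_unit hp hc
  rw [mem_maximalIdeal_pow_iff hp] at hx
  rw [mul_comm, Units.mul_left_dvd]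
  exact (pow_dvd_pow p hk).trans hx

variable [Finite (ResidueField R)] (hodd : Odd (Nat.card (ResidueField R)))
include hodd

namespace IsBiEquivariant

/-- A unit `c` lies in the big cell, where the value at the Weyl element decides. Otherwise `c`
divides every element of `𝔪^{m-1}`, in particular `v - 1` for a unit `v` witnessing primitivity, and
`θ(v)² ≠ 1` because `θ(v)` has odd order. -/
theorem lower_eq_zero_of_notMem (h : IsBiEquivariant θ l φ) (hm : m ≠ 0)
    (hθ : ∀ u : Rˣ, (u : R) - 1 ∈ maximalIdeal R ^ m → θ u = 1)
    (hprim : m = 1 ∨ ∃ v : Rˣ, (v : R) - 1 ∈ maximalIdeal R ^ (m - 1) ∧ θ v ≠ 1)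
    (hw : φ (weylElt R) = 0) {c : R} (hc : c ∉ maximalIdeal R ^ m) : φ (lowerElt c) = 0 := by
  by_cases hcu : IsUnit c
  · rw [h.apply_of_unit_left hcu.unit rfl, hw, mul_zero]
  · have hc1 : c ∈ maximalIdeal R := hcu
    obtain ⟨j, rfl⟩ := Nat.exists_eq_succ_of_ne_zero hm
    have hj : j ≠ 0 := fun hj => hc (by subst hj; simpa using hc1)
    obtain ⟨v, hv, hv1⟩ := hprim.resolve_left (by omega)
    simp only [Nat.succ_eq_add_one, Nat.add_sub_cancel] at hv
    exact h.lower_eq_zero v (dvd_of_notMem_pow hc hv)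
      (sq_ne_one_of_ne_one hodd hθ (mem_max_of_mem_pow hj hv) hv1)

/-- If `θ² = 1`, then `θ` is trivial on `1 + 𝔪`, where its values have odd order, and primitivity
leaves only `m = 1`. Excluding that case leaves some unit with `θ(u)² ≠ 1`. -/
theorem weyl_eq_zero_of_primitive (h : IsBiEquivariant θ l φ)
    (hθ : ∀ u : Rˣ, (u : R) - 1 ∈ maximalIdeal R ^ m → θ u = 1)
    (hprim : m = 1 ∨ ∃ v : Rˣ, (v : R) - 1 ∈ maximalIdeal R ^ (m - 1) ∧ θ v ≠ 1)
    (hne : ¬ (m = 1 ∧ ∀ u, θ u ^ 2 = 1)) : φ (weylElt R) = 0 := by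
  by_cases hsq : ∀ u, θ u ^ 2 = 1
  · have hm1 : m ≠ 1 := fun e => hne ⟨e, hsq⟩
    obtain ⟨v, hv, hv1⟩ := hprim.resolve_left hm1
    by_cases hm0 : m = 0
    · exact absurd (hθ v (by rw [hm0, pow_zero, Ideal.one_eq_top]; trivial)) hv1
    · exact absurd (hsq v)
        (sq_ne_one_of_ne_one hodd hθ (mem_max_of_mem_pow (by omega) hv) hv1)
  · push Not at hsq
    obtain ⟨u, hu⟩ := hsq
    exact h.weyl_eq_zero u hu

/-- At the level of the conductor, a bi-equivariant function is determined by its values at the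
identity and at the Weyl element. -/
theorem eq_zero_of_level (h : IsBiEquivariant θ m φ) (hm : m ≠ 0)
    (hθ : ∀ u : Rˣ, (u : R) - 1 ∈ maximalIdeal R ^ m → θ u = 1)
    (hprim : m = 1 ∨ ∃ v : Rˣ, (v : R) - 1 ∈ maximalIdeal R ^ (m - 1) ∧ θ v ≠ 1)
    (h1 : φ 1 = 0) (hw : φ (weylElt R) = 0) : φ = 0 := by
  refine h.eq_zero (fun c => ?_) hw
  by_cases hc : c ∈ maximalIdeal R ^ m
  · rw [h.lower_congr (c := 0) (by simpa using hc), lowerElt_zero, h1]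
  · exact h.lower_eq_zero_of_notMem hodd hm hθ hprim hw hc

omit hodd in
-- Modulo `𝔪^{j+1}` and squares of units, `𝔪ʲ` has the three classes of `0`, `pʲ` and `δpʲ`.
theorem lower_of_mem_pow (h : IsBiEquivariant θ (j + 1) φ) {p : R} (hp : Irreducible p) {δ : Rˣ}
    (hδ : ∀ a : Rˣ, ∃ t : Rˣ, (a : R) - t ^ 2 ∈ maximalIdeal R ∨
      (a : R) - t ^ 2 * δ ∈ maximalIdeal R)
    (h1 : φ (lowerElt (p ^ j)) = φ 1) (h2 : φ (lowerElt (δ * p ^ j)) = φ 1) {c : R}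
    (hc : c ∈ maximalIdeal R ^ j) : φ (lowerElt c) = φ 1 := by
  rw [mem_maximalIdeal_pow_iff hp] at hc
  obtain ⟨a, rfl⟩ := hc
  have hmul : ∀ y ∈ maximalIdeal R, p ^ j * y ∈ maximalIdeal R ^ (j + 1) := fun y hy => by
    rw [pow_succ]
    exact Ideal.mul_mem_mul ((mem_maximalIdeal_pow_iff hp).2 dvd_rfl) hy
  by_cases ha : IsUnit a
  · obtain ⟨t, ht | ht⟩ := hδ ha.unit
    · rw [← h1, ← h.lower_sq_mul t (p ^ j)]
      apply h.lower_congr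
      convert hmul _ ht using 1
      rw [IsUnit.unit_spec]; ring
    · rw [← h2, ← h.lower_sq_mul t ((δ : R) * p ^ j)]
      apply h.lower_congr
      convert hmul _ ht using 1
      rw [IsUnit.unit_spec]; ring
  · rw [← lowerElt_zero]
    apply h.lower_congr
    rw [sub_zero]
    exact hmul a ha

/-- A bi-equivariant function of level `j + 1` which is constant on the lower unipotent elements of
`𝔪ʲ` has level `j`. -/
theorem invariant_of_level (h : IsBiEquivariant θ (j + 1) φ) (hj : j ≠ 0)
    (hθ : ∀ u : Rˣ, (u : R) - 1 ∈ maximalIdeal R ^ j → θ u = 1)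
    (hc : ∀ c ∈ maximalIdeal R ^ j, φ (lowerElt c) = φ 1)
    (g : SpecialLinearGroup (Fin 2) R) {k : SpecialLinearGroup (Fin 2) R}
    (hk : k ∈ congruenceKer (maximalIdeal R ^ j)) : φ (g * k) = φ g := by
  obtain ⟨p, hp⟩ := IsDiscreteValuationRing.exists_irreducible R
  -- It suffices that `φ` depends on the entry of a lower unipotent only modulo `𝔪ʲ`. On `𝔪ʲ` this
  -- is the hypothesis. Outside it, `c'/c` lies in `1 + 𝔪` and acts like a square.
  have hF : ∀ c c', c' - c ∈ maximalIdeal R ^ j → φ (lowerElt c') = φ (lowerElt c) := by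
    intro c c' hcc
    by_cases hcj : c ∈ maximalIdeal R ^ j
    · rw [hc c hcj, hc c' (by simpa using add_mem hcc hcj)]
    · obtain ⟨i, rfl⟩ := Nat.exists_eq_succ_of_ne_zero hj
      obtain ⟨k, hk, u, rfl⟩ := exists_eq_pow_mul_unit hp hcj
      obtain ⟨y, hy⟩ := (mem_maximalIdeal_pow_iff hp).1 hcc
      have hw0 : p ^ (i + 1 - k) * y * ((u⁻¹ : Rˣ) : R) ∈ maximalIdeal R := by
        refine Ideal.mul_mem_right _ _ (Ideal.mul_mem_right _ _
          (mem_max_of_mem_pow (j := i + 1 - k) (by omega) ?_))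
        exact (mem_maximalIdeal_pow_iff hp).2 dvd_rfl
      have hw : IsUnit (1 + p ^ (i + 1 - k) * y * ((u⁻¹ : Rˣ) : R)) :=
        isUnit_of_sub_mem isUnit_one (by rwa [add_sub_cancel_left])
      have hc' : c' = p ^ k * u * hw.unit := by
        rw [IsUnit.unit_spec]
        have e : (u : R) * ((u⁻¹ : Rˣ) : R) = 1 := by simp
        have e2 : p ^ k * p ^ (i + 1 - k) = p ^ (i + 1) := by
          rw [← pow_add]; congr 1; omega
        simp only [Nat.succ_eq_add_one] at hy
        linear_combination hy - p ^ k * p ^ (i + 1 - k) * y * e - y * e2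
      -- For `c' = cw` with `w^{2r+1}` congruent to `1`, the entry `w^{2r}c'` is congruent to `c`
      -- modulo `𝔪^{j+1}`.
      obtain ⟨r, hr⟩ := exists_odd_pow_sub_one_mem hodd (u := (hw.unit : R))
        (by rw [IsUnit.unit_spec, add_sub_cancel_left]; exact hw0) (i + 1 + 1)
      rw [← h.lower_sq_mul (hw.unit ^ r) c']
      apply h.lower_congr
      have := Ideal.mul_mem_left (maximalIdeal R ^ (i + 1 + 1)) (p ^ k * u) hr
      convert this using 1
      rw [hc']
      push_cast
      ring
  obtain ⟨k00, k01, k10, k11⟩ := mem_congruenceKer.1 hk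
  have e0 : (g * k) 1 0 - g 1 0 = g 1 0 * (k 0 0 - 1) + g 1 1 * k 1 0 := by
    rw [entry_mul]; ring
  have e1 : (g * k) 1 1 - g 1 1 = g 1 0 * k 0 1 + g 1 1 * (k 1 1 - 1) := by
    rw [entry_mul]; ring
  have y0 : (g * k) 1 0 - g 1 0 ∈ maximalIdeal R ^ j := by
    rw [e0]; exact add_mem (Ideal.mul_mem_left _ _ k00) (Ideal.mul_mem_left _ _ k10)
  have y1 : (g * k) 1 1 - g 1 1 ∈ maximalIdeal R ^ j := by
    rw [e1]; exact add_mem (Ideal.mul_mem_left _ _ k01) (Ideal.mul_mem_left _ _ k11)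
  have hθ' : ∀ u u' : Rˣ, (u' : R) - u ∈ maximalIdeal R ^ j → θ u' = θ u := by
    intro u u' hu
    have : θ (u' * u⁻¹) = 1 := hθ _ (by
      convert Ideal.mul_mem_right ((u⁻¹ : Rˣ) : R) _ hu using 1
      rw [sub_mul, Units.mul_inv, Units.val_mul])
    rwa [map_mul, map_inv, mul_inv_eq_one] at this
  by_cases hd : IsUnit (g 1 1)
  · have hd' : IsUnit ((g * k) 1 1) := isUnit_of_sub_mem hd (mem_max_of_mem_pow hj y1)
    rw [h.apply_of_unit_right hd.unit rfl, h.apply_of_unit_right hd'.unit rfl, map_inv, map_inv,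
      hθ' hd.unit hd'.unit y1]
    congr 1
    apply hF
    have e2 := hd.mul_val_inv
    have e3 := hd'.mul_val_inv
    -- The difference of the ratios of the lower entries, written over a common denominator.
    have : ((hd'.unit⁻¹ : Rˣ) : R) * (g * k) 1 0 - ((hd.unit⁻¹ : Rˣ) : R) * g 1 0 =
        ((hd'.unit⁻¹ : Rˣ) : R) * ((hd.unit⁻¹ : Rˣ) : R) *
          (g 1 1 * ((g * k) 1 0 - g 1 0) - g 1 0 * ((g * k) 1 1 - g 1 1)) := by
      linear_combination (-((hd'.unit⁻¹ : Rˣ) : R) * (g * k) 1 0) * e2 +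
        (((hd.unit⁻¹ : Rˣ) : R) * g 1 0) * e3
    rw [this]
    exact Ideal.mul_mem_left _ _ (sub_mem (Ideal.mul_mem_left _ _ y0) (Ideal.mul_mem_left _ _ y1))
  · have hc0 := isUnit_lower_row g hd
    have hc0' : IsUnit ((g * k) 1 0) := isUnit_of_sub_mem hc0 (mem_max_of_mem_pow hj y0)
    rw [h.apply_of_unit_left hc0.unit rfl, h.apply_of_unit_left hc0'.unit rfl, map_inv, map_inv,
      hθ' hc0.unit hc0'.unit y0]

end IsBiEquivariant

omit hodd in
theorem isBiEquivariant_lowerRowFun_pow (hj : j ≠ 0)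
    (hθ : ∀ u : Rˣ, (u : R) - 1 ∈ maximalIdeal R ^ j → θ u = 1) :
    IsBiEquivariant θ j (lowerRowFun θ (· ∈ maximalIdeal R ^ j)) :=
  isBiEquivariant_lowerRowFun hj le_rfl hθ _ (fun _ h => h) (fun _ _ h => Ideal.mul_mem_left _ _ h)
    (fun _ _ _ h => Ideal.mul_mem_right _ _ h) (fun _ _ hy h => add_mem h hy)

omit hodd in
-- For `a = 1` and `a = δ` these functions separate the two nonzero square classes of `𝔪ʲ` modulo
-- `𝔪^{j+1}`. They supply the two new eigenvectors of level `j + 1`.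
theorem isBiEquivariant_lowerRowFun_class (hj : j ≠ 0)
    (hθ : ∀ u : Rˣ, (u : R) - 1 ∈ maximalIdeal R ^ j → θ u = 1) {p : R} (hp : Irreducible p)
    (a : R) : IsBiEquivariant θ (j + 1)
      (lowerRowFun θ fun r => ∃ t : Rˣ, r - t ^ 2 * (a * p ^ j) ∈ maximalIdeal R ^ (j + 1)) := by
  have hpj : p ^ j ∈ maximalIdeal R ^ j := (mem_maximalIdeal_pow_iff hp).2 dvd_rfl
  have hr : ∀ r, (∃ t : Rˣ, r - t ^ 2 * (a * p ^ j) ∈ maximalIdeal R ^ (j + 1)) →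
      r ∈ maximalIdeal R ^ j := by
    rintro r ⟨t, ht⟩
    have := add_mem (Ideal.pow_le_pow_right (Nat.le_succ j) ht)
      (Ideal.mul_mem_left _ ((t : R) ^ 2 * a) hpj)
    convert this using 1
    ring
  refine isBiEquivariant_lowerRowFun hj (Nat.le_succ j) hθ _ hr ?_ ?_ ?_
  · rintro s r ⟨t, ht⟩
    refine ⟨s * t, ?_⟩
    convert Ideal.mul_mem_left _ ((s : R) ^ 2) ht using 1
    push_cast; ring
  · rintro r x hx ⟨t, ht⟩
    refine ⟨t, ?_⟩
    have := add_mem ht (Ideal.mul_mem_mul (hr r ⟨t, ht⟩) hx)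
    convert this using 1
    ring
  · rintro r y hy ⟨t, ht⟩
    refine ⟨t, ?_⟩
    convert add_mem ht hy using 1
    ring

omit hodd in
theorem lowerRowFun_lowerElt (P : R → Prop) (c : R) [Decidable (P c)] :
    lowerRowFun θ P (lowerElt c) = if P c then 1 else 0 := by
  split_ifs with h
  · rw [lowerRowFun_of P 1 (by simp) (by simpa using h)]
    simp
  · rw [lowerRowFun_eq_zero]
    simpa using h

omit hodd in
theorem class_iff {p : R} (hp : Irreducible p) (a b : R) :
    (∃ t : Rˣ, b * p ^ j - t ^ 2 * (a * p ^ j) ∈ maximalIdeal R ^ (j + 1)) ↔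
      ∃ t : Rˣ, b - t ^ 2 * a ∈ maximalIdeal R := by
  refine exists_congr fun t => ?_
  have e : b * p ^ j - t ^ 2 * (a * p ^ j) = p ^ j * (b - t ^ 2 * a) := by ring
  rw [e, mem_maximalIdeal_pow_iff hp, pow_succ, mul_dvd_mul_iff_left (pow_ne_zero _ hp.ne_zero),
    hp.maximalIdeal_eq, Ideal.mem_span_singleton]

/-- The squares have index two in the multiplicative group of a finite field of odd cardinality; `δ`
lifts a nonsquare. -/
theorem exists_nonsquare_unit : ∃ δ : Rˣ,
    (∀ a : Rˣ, ∃ t : Rˣ, (a : R) - t ^ 2 ∈ maximalIdeal R ∨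
      (a : R) - t ^ 2 * δ ∈ maximalIdeal R) ∧
    (∀ t : Rˣ, (δ : R) - t ^ 2 ∉ maximalIdeal R) ∧
    (∀ t : Rˣ, (1 : R) - t ^ 2 * δ ∉ maximalIdeal R) := by
  classical
  let := Fintype.ofFinite (ResidueField R)
  have hchar : ringChar (ResidueField R) ≠ 2 := fun h => by
    have := FiniteField.even_card_of_char_two h
    rw [Nat.card_eq_fintype_card] at hodd
    rw [Nat.odd_iff] at hodd
    omega
  obtain ⟨d, hd⟩ := FiniteField.exists_nonsquare hchar
  have hlift : ∀ x : ResidueField R, x ≠ 0 → ∃ u : Rˣ, residue R u = x := fun x hx => by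
    obtain ⟨r, rfl⟩ := residue_surjective x
    have : IsUnit r := by
      by_contra h
      exact hx ((residue_eq_zero_iff r).2 h)
    exact ⟨this.unit, rfl⟩
  have hd0 : d ≠ 0 := fun h => hd (h ▸ IsSquare.zero)
  obtain ⟨δ, rfl⟩ := hlift d hd0
  have hu : ∀ u : Rˣ, residue R (u : R) ≠ 0 := fun u h => by
    rw [residue_eq_zero_iff] at h
    exact h u.isUnit
  refine ⟨δ, fun a => ?_, fun t ht => hd ?_, fun t ht => hd ?_⟩
  · by_cases ha : IsSquare (residue R (a : R))
    · obtain ⟨x, hx⟩ := ha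
      obtain ⟨t, rfl⟩ := hlift x (fun h => hu a (by rw [hx, h, zero_mul]))
      refine ⟨t, Or.inl ?_⟩
      rw [← residue_eq_zero_iff, map_sub, hx, map_pow]; ring
    -- By the quadratic character, a product of two nonsquares is a square.
    · have h1 : IsSquare (residue R (a : R) * residue R (δ : R)) := by
        rw [← quadraticChar_one_iff_isSquare (mul_ne_zero (hu a) hd0), map_mul,
          quadraticChar_neg_one_iff_not_isSquare.2 ha,
          quadraticChar_neg_one_iff_not_isSquare.2 hd]
        norm_num
      obtain ⟨x, hx⟩ := h1
      obtain ⟨t, ht⟩ := hlift (x / residue R (δ : R)) (div_ne_zero (fun h =>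
        mul_ne_zero (hu a) hd0 (by rw [hx, h, zero_mul])) hd0)
      refine ⟨t, Or.inr ?_⟩
      rw [← residue_eq_zero_iff, map_sub, map_mul, map_pow, ht, sub_eq_zero]
      field_simp
      rw [hx]; ring
  · rw [← residue_eq_zero_iff, map_sub, map_pow, sub_eq_zero] at ht
    exact ⟨residue R (t : R), by rw [ht, pow_two]⟩
  · rw [← residue_eq_zero_iff, map_sub, map_mul, map_pow, map_one, sub_eq_zero] at ht
    refine ⟨(residue R (t : R))⁻¹, ?_⟩
    have := hu t
    field_simp
    rw [mul_comm, ← ht]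

end Levels

end

end KTypes

namespace KTypes

noncomputable section

set_option linter.unusedSectionVars false

/-! ### Functions in a smoothly induced representation -/

section SmoothInd

variable {G V : Type*} [Group G] [TopologicalSpace G] [IsTopologicalGroup G]
  [AddCommGroup V] [Module ℂ V] {S : Subgroup G} {σ : Representation ℂ S V}

/-- The function on the group underlying an element of a smoothly induced representation. -/
def indFun (f : SmoothIndSpace S σ) : G → V := f.1.1

theorem indFun_ext {f f' : SmoothIndSpace S σ} (h : ∀ x, indFun f x = indFun f' x) : f = f' :=
  Subtype.ext (Subtype.ext (funext h))

theorem indFun_smul (c : ℂ) (f : SmoothIndSpace S σ) (x : G) :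
    indFun (c • f) x = c • indFun f x := rfl

theorem indFun_mul_left (f : SmoothIndSpace S σ) (b : S) (x : G) :
    indFun f (b * x) = σ b (indFun f x) := f.1.2 b x

theorem indFun_smoothInd (f : SmoothIndSpace S σ) (g x : G) :
    indFun (smoothInd S σ g f) x = indFun f (x * g) := rfl

theorem indFun_smooth (f : SmoothIndSpace S σ) :
    ∀ᶠ g in nhds (1 : G), ∀ x, indFun f (x * g) = indFun f x := by
  filter_upwards [f.2] with g hg x
  exact congrFun (congrArg Subtype.val hg) x

theorem smoothInd_eventually (f : SmoothIndSpace S σ) :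
    ∀ᶠ g in nhds (1 : G), smoothInd S σ g f = f := by
  filter_upwards [indFun_smooth f] with g hg
  exact indFun_ext hg

/-- The element of a smoothly induced representation with a given underlying function. -/
def indMk (φ : G → V) (hφ : ∀ (b : S) x, φ (b * x) = σ b (φ x))
    (hs : ∀ᶠ g in nhds (1 : G), ∀ x, φ (x * g) = φ x) : SmoothIndSpace S σ :=
  ⟨⟨φ, hφ⟩, by
    change ∀ᶠ g in nhds (1 : G), _ = _
    filter_upwards [hs] with g hg
    exact Subtype.ext (funext hg)⟩

@[simp] theorem indFun_indMk (φ : G → V) (hφ : ∀ (b : S) x, φ (b * x) = σ b (φ x))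
    (hs : ∀ᶠ g in nhds (1 : G), ∀ x, φ (x * g) = φ x) (x : G) :
    indFun (indMk (σ := σ) φ hφ hs) x = φ x := rfl

/-- Evaluation at a point. -/
def indEval (σ : Representation ℂ S V) (x : G) : SmoothIndSpace S σ →ₗ[ℂ] V where
  toFun f := indFun f x
  map_add' _ _ := rfl
  map_smul' _ _ := rfl

@[simp] theorem indEval_apply (x : G) (f : SmoothIndSpace S σ) : indEval σ x f = indFun f x := rfl

theorem charRep_apply {H : Type*} [Group H] (ψ : H →* ℂˣ) (h : H) (z : ℂ) :
    charRep ψ h z = ψ h * z := rfl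

/-- The translates of evaluation at `1` are the evaluations at all points of the group. -/
theorem isWhittaker_indEval (ψ : S →* ℂˣ) :
    IsWhittaker (smoothInd S (charRep ψ)) ψ (indEval (charRep ψ) 1) where
  equivariant b f := by
    rw [indEval_apply, indEval_apply, indFun_smoothInd, one_mul, ← charRep_apply,
      ← indFun_mul_left, mul_one]
  separating f hf := indFun_ext fun x => by
    have := hf x
    rwa [indEval_apply, indFun_smoothInd, one_mul] at this

/-- Frobenius reciprocity for the endomorphisms of a representation induced from a character. -/
theorem exists_hom_of_equivariant (ψ : S →* ℂˣ) (μ : SmoothIndSpace S (charRep ψ) →ₗ[ℂ] ℂ)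
    (hμ : ∀ (b : S) f, μ (smoothInd S (charRep ψ) b f) = ψ b * μ f) :
    ∃ T : SmoothIndSpace S (charRep ψ) →ₗ[ℂ] SmoothIndSpace S (charRep ψ),
      (∀ g f, T (smoothInd S (charRep ψ) g f) = smoothInd S (charRep ψ) g (T f)) ∧
      ∀ f, indEval (charRep ψ) 1 (T f) = μ f := by
  have h1 : ∀ f (b : S) x, μ (smoothInd S (charRep ψ) (b * x) f) =
      charRep ψ b (μ (smoothInd S (charRep ψ) x f)) := fun f b x => by
    rw [map_mul, Module.End.mul_apply, hμ, charRep_apply]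
  have h2 : ∀ f, ∀ᶠ g in nhds (1 : G), ∀ x, μ (smoothInd S (charRep ψ) (x * g) f) =
      μ (smoothInd S (charRep ψ) x f) := fun f =>
    (smoothInd_eventually f).mono fun g hg x => by rw [map_mul, Module.End.mul_apply, hg]
  refine ⟨{ toFun := fun f => indMk (fun g => μ (smoothInd S (charRep ψ) g f)) (h1 f) (h2 f)
            map_add' := fun f f' => indFun_ext fun x => ?_
            map_smul' := fun c f => indFun_ext fun x => ?_ },
    fun g f => indFun_ext fun x => ?_, fun f => ?_⟩
  · change μ (smoothInd S (charRep ψ) x (f + f')) = _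
    rw [map_add, map_add]; rfl
  · change μ (smoothInd S (charRep ψ) x (c • f)) = _
    rw [map_smul, map_smul]; rfl
  · change μ (smoothInd S (charRep ψ) x (smoothInd S (charRep ψ) g f)) =
      μ (smoothInd S (charRep ψ) (x * g) f)
    rw [map_mul, Module.End.mul_apply]
  · change μ (smoothInd S (charRep ψ) 1 f) = _
    rw [map_one, Module.End.one_apply]

end SmoothInd

/-! ### Coordinates on the inverse image of the maximal compact subgroup -/

section Coordinates

open Matrix

variable {F : Type*} [Field F] [ValuativeRel F] [TopologicalSpace F] [IsNonarchimedeanLocalField F]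
variable {n : ℕ} [Fact (n ∣ Nat.card 𝓀[F] - 1)]

theorem eventually_nhds_one {P : MetaSL2 F n → Prop} :
    (∀ᶠ g in nhds (1 : MetaSL2 F n), P g) ↔ ∃ j : ℕ+, ∀ g ∈ congruenceCover F n j, P g := by
  rw [(congruenceBasis F n).nhds_one_hasBasis.eventually_iff]
  constructor
  · rintro ⟨_, ⟨j, rfl⟩, h⟩
    exact ⟨j, fun g hg => h hg⟩
  · rintro ⟨j, h⟩
    exact ⟨_, ⟨j, rfl⟩, fun g hg => h g hg⟩

theorem eventually_nhds_one_subgroup {S : Subgroup (MetaSL2 F n)} {P : S → Prop} :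
    (∀ᶠ g in nhds (1 : S), P g) ↔
      ∃ j : ℕ+, ∀ g ∈ (congruenceCover F n j).subgroupOf S, P g := by
  rw [nhds_subtype_eq_comap, Filter.eventually_comap]
  change (∀ᶠ b in nhds (1 : MetaSL2 F n), _) ↔ _
  rw [eventually_nhds_one]
  constructor
  · rintro ⟨j, h⟩
    exact ⟨j, fun g hg => h g hg g rfl⟩
  · rintro ⟨j, h⟩
    refine ⟨j, ?_⟩
    rintro _ hb a rfl
    exact h a hb

theorem map_integers_injective :
    Function.Injective (SpecialLinearGroup.map (n := Fin 2) (algebraMap 𝒪[F] F)) := by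
  intro g k h
  apply entry_ext <;> apply Subtype.ext
  · exact congrArg (fun g : SpecialLinearGroup (Fin 2) F => g 0 0) h
  · exact congrArg (fun g : SpecialLinearGroup (Fin 2) F => g 0 1) h
  · exact congrArg (fun g : SpecialLinearGroup (Fin 2) F => g 1 0) h
  · exact congrArg (fun g : SpecialLinearGroup (Fin 2) F => g 1 1) h

variable (F n) in
/-- The projection `K̃¹ → SL₂(𝒪)`. -/
def integralBase : compactCover F n →* SpecialLinearGroup (Fin 2) 𝒪[F] :=
  ((MonoidHom.ofInjective (map_integers_injective (F := F))).symm.toMonoidHom).comp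
    ((MetaSL2.proj F n).subgroupComap (maxCompact F))

theorem map_integralBase (x : compactCover F n) :
    SpecialLinearGroup.map (algebraMap 𝒪[F] F) (integralBase F n x) = x.1.base :=
  congrArg Subtype.val ((MonoidHom.ofInjective (map_integers_injective (F := F))).apply_symm_apply
    ((MetaSL2.proj F n).subgroupComap (maxCompact F) x))

theorem integralBase_apply (x : compactCover F n) (i j : Fin 2) :
    ((integralBase F n x i j : 𝒪[F]) : F) = x.1.base i j := by
  rw [← map_integralBase]; rfl

variable (F n) in
/-- The coordinate `K̃¹ → μₙ` given by the splitting over `SL₂(𝒪)`. -/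
def rootCoord : compactCover F n →* rootsOfUnity n 𝓀[F] where
  toFun x := x.1.root / sec n x.1.base
  map_one' := by
    change (1 : rootsOfUnity n 𝓀[F]) / sec n 1 = 1
    rw [sec_of_zero (by simp), div_one]
  map_mul' x y := by
    have h := kubota_mul_sec (n := n) (show x.1.base ∈ maxCompact F from x.2)
      (show y.1.base ∈ maxCompact F from y.2)
    change kubota n x.1.base y.1.base * x.1.root * y.1.root / sec n (x.1.base * y.1.base) = _
    rw [← h, div_mul_div_comm, mul_assoc, mul_assoc, mul_div_mul_left_eq_div]

theorem rootCoord_apply (x : compactCover F n) : rootCoord F n x = x.1.root / sec n x.1.base := rfl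

variable (F n) in
/-- The splitting of `K̃¹` over `SL₂(𝒪)`. -/
def splitting : SpecialLinearGroup (Fin 2) 𝒪[F] →* compactCover F n where
  toFun g := ⟨⟨SpecialLinearGroup.map (algebraMap 𝒪[F] F) g,
    sec n (SpecialLinearGroup.map (algebraMap 𝒪[F] F) g)⟩, ⟨g, rfl⟩⟩
  map_one' := by
    apply Subtype.ext
    apply MetaSL2.ext
    · exact map_one _
    · change sec n _ = 1
      rw [map_one, sec_of_zero (by simp)]
  map_mul' g k := by
    apply Subtype.ext
    apply MetaSL2.ext
    · exact map_mul _ _ _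
    · have h := kubota_mul_sec (n := n) (show SpecialLinearGroup.map (algebraMap 𝒪[F] F) g ∈
        maxCompact F from ⟨g, rfl⟩) (show SpecialLinearGroup.map (algebraMap 𝒪[F] F) k ∈
        maxCompact F from ⟨k, rfl⟩)
      change sec n (SpecialLinearGroup.map (algebraMap 𝒪[F] F) (g * k)) = _
      rw [map_mul, ← h]; rfl

@[simp] theorem integralBase_splitting (g : SpecialLinearGroup (Fin 2) 𝒪[F]) :
    integralBase F n (splitting F n g) = g :=
  map_integers_injective (map_integralBase _)

@[simp] theorem rootCoord_splitting (g : SpecialLinearGroup (Fin 2) 𝒪[F]) :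
    rootCoord F n (splitting F n g) = 1 := div_self' _

variable (F n) in
/-- The inclusion of `μₙ` in `K̃¹`. -/
def inclCompact : rootsOfUnity n 𝓀[F] →* compactCover F n :=
  (MetaSL2.incl F n).codRestrict _ fun _ => one_mem (maxCompact F)

@[simp] theorem integralBase_inclCompact (ζ : rootsOfUnity n 𝓀[F]) :
    integralBase F n (inclCompact F n ζ) = 1 :=
  map_integers_injective ((map_integralBase _).trans (map_one _).symm)

@[simp] theorem rootCoord_inclCompact (ζ : rootsOfUnity n 𝓀[F]) :
    rootCoord F n (inclCompact F n ζ) = ζ := by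
  change ζ / sec n 1 = ζ
  rw [sec_of_zero (by simp), div_one]

theorem compactCover_ext {x y : compactCover F n} (h : integralBase F n x = integralBase F n y)
    (h' : rootCoord F n x = rootCoord F n y) : x = y := by
  have hb : x.1.base = y.1.base := by rw [← map_integralBase, ← map_integralBase, h]
  apply Subtype.ext
  apply MetaSL2.ext hb
  rw [rootCoord_apply, rootCoord_apply, hb] at h'
  exact div_left_injective h'

/-- Thus `K̃¹` is the product of `μₙ` and `SL₂(𝒪)`, and a function on it with prescribed behaviour
under `μₙ` amounts to a function on `SL₂(𝒪)`. -/
theorem eq_inclCompact_mul_splitting (x : compactCover F n) :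
    x = inclCompact F n (rootCoord F n x) * splitting F n (integralBase F n x) := by
  apply compactCover_ext <;> simp

/-- The function `sec` is trivial on congruence subgroups, so `K¹ₗ × {1}` agrees with the image of
the congruence kernel under the splitting. -/
theorem mem_congruenceCover_subgroupOf {l : ℕ+} {x : compactCover F n} :
    x ∈ (congruenceCover F n l).subgroupOf (compactCover F n) ↔
      integralBase F n x ∈ congruenceKer (𝓂[F] ^ (l : ℕ)) ∧ rootCoord F n x = 1 := by
  rw [Subgroup.mem_subgroupOf, mem_congruenceCover]
  have e : x.1.base ∈ congruence F l ↔
      integralBase F n x ∈ congruenceKer (𝓂[F] ^ (l : ℕ)) := by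
    rw [← map_integralBase]
    exact Subgroup.mem_map_iff_mem map_integers_injective
  rw [e]
  refine and_congr_right fun h => ?_
  rw [rootCoord_apply, sec_congruence (e.2 h), div_one]

instance finite_integers_quotient (l : ℕ) : Finite (𝒪[F] ⧸ 𝓂[F] ^ l) := by
  have : Finite (𝒪[F] ⧸ 𝓂[F]) := inferInstanceAs (Finite 𝓀[F])
  exact Ideal.finite_quotient_pow (IsNoetherian.noetherian _) _

instance finite_rootsOfUnity : Finite (rootsOfUnity n 𝓀[F]) :=
  Finite.of_injective (fun ζ : rootsOfUnity n 𝓀[F] => ((ζ : 𝓀[F]ˣ) : 𝓀[F]))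
    (Units.val_injective.comp Subtype.val_injective)

instance finiteIndex_congruenceCover (l : ℕ+) :
    ((congruenceCover F n l).subgroupOf (compactCover F n)).FiniteIndex := by
  have : Finite (SpecialLinearGroup (Fin 2) (𝒪[F] ⧸ 𝓂[F] ^ (l : ℕ))) :=
    Finite.of_injective (fun g => g.1) Subtype.val_injective
  have e : (congruenceCover F n l).subgroupOf (compactCover F n) =
      ((SpecialLinearGroup.map (Ideal.Quotient.mk (𝓂[F] ^ (l : ℕ)))).comp
        (integralBase F n)).ker ⊓ (rootCoord F n).ker := by
    ext x
    rw [mem_congruenceCover_subgroupOf]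
    rfl
  rw [e]
  infer_instance

theorem isSmoothFor_smoothInd {V : Type*} [AddCommGroup V] [Module ℂ V]
    {S : Subgroup (compactCover F n)} (σ : Representation ℂ S V) :
    IsSmoothFor (smoothInd S σ)
      (fun l : ℕ+ => (congruenceCover F n l).subgroupOf (compactCover F n)) where
  antitone _ _ h := Subgroup.comap_mono (congruenceCover_anti h)
  exists_fixed f := by
    obtain ⟨j, hj⟩ := eventually_nhds_one_subgroup.1 (smoothInd_eventually f)
    exact ⟨j, mem_fixedVectors.2 hj⟩

end Coordinates

end

end KTypes

namespace KTypes

noncomputable section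

set_option linter.unusedSectionVars false

/-! ### Representations of `K̃¹` induced from characters of `B̃¹ ∩ K̃¹` -/

section CompactInduction

open Matrix

variable {F : Type*} [Field F] [ValuativeRel F] [TopologicalSpace F] [IsNonarchimedeanLocalField F]
variable {n : ℕ} [Fact (n ∣ Nat.card 𝓀[F] - 1)]

variable (F n) in
/-- `K¹ₗ`, as a subgroup of `K̃¹`. -/
abbrev congruenceIn (l : ℕ+) : Subgroup (compactCover F n) :=
  (congruenceCover F n l).subgroupOf (compactCover F n)

/-- The character of `B̃¹ ∩ K̃¹` inflated from a character of `A`. -/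
abbrev inflate (γ : centA F n →* ℂˣ) : (borelCover F n).subgroupOf (compactCover F n) →* ℂˣ :=
  γ.comp (compactTorusProj F n)

/-- The representation of `K̃¹` induced from the inflation of a character of `A`. -/
abbrev charInd (γ : centA F n →* ℂˣ) :=
  smoothInd ((borelCover F n).subgroupOf (compactCover F n)) (charRep (inflate γ))

variable (F) in
/-- The identification of the units of `𝒪` with a subgroup of `Fˣ`. -/
def integerUnitsHom : 𝒪[F]ˣ →* integerUnits F :=
  (Units.map (algebraMap 𝒪[F] F).toMonoidHom).codRestrict _ fun u => by
    rw [mem_integerUnits, val_eq_zero_iff]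
    exact Valuation.Integers.one_of_isUnit (Valuation.integer.integers (valuation F)) u.isUnit

theorem integerUnitsHom_apply (u : 𝒪[F]ˣ) : (((integerUnitsHom F u : integerUnits F) : Fˣ) : F) =
    ((u : 𝒪[F]) : F) := rfl

variable (F n) in
/-- The homomorphism `u ↦ (dg(u), 1)` on units. -/
def unitTorusHom : integerUnits F →* centA F n where
  toFun u := unitTorus n u
  map_one' := by
    apply Subtype.ext
    apply Subtype.ext
    apply MetaSL2.ext
    · exact map_one dg
    · rfl
  map_mul' u v := by
    apply Subtype.ext
    apply Subtype.ext
    apply MetaSL2.ext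
    · exact map_mul dg _ _
    · change 1 = kubota n (dg (u : Fˣ)) (dg (v : Fˣ)) * 1 * 1
      unfold kubota
      rw [← map_mul, kubotaX_dg, kubotaX_dg, kubotaX_dg, hilbert_unit_unit, one_mul, one_mul]
      · rw [val_div, val_inv, val_inv, val_mul, mem_integerUnits.1 u.2, mem_integerUnits.1 v.2]; rfl
      · rw [val_div, val_inv, val_inv, val_mul, mem_integerUnits.1 u.2, mem_integerUnits.1 v.2]; rfl

/-- The restriction of a character of `A` to `𝒪ˣ`. -/
def unitChar (γ : centA F n →* ℂˣ) : 𝒪[F]ˣ →* ℂˣ :=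
  γ.comp ((unitTorusHom F n).comp (integerUnitsHom F))

/-- On upper triangular matrices `sec` is trivial, so the splitting coordinate is the given root of
unity. -/
theorem compactTorusProj_apply (b : (borelCover F n).subgroupOf (compactCover F n)) (u : 𝒪[F]ˣ)
    (hu : (u : 𝒪[F]) = integralBase F n b 0 0) :
    compactTorusProj F n b =
      inclA F n (rootCoord F n b) * unitTorusHom F n (integerUnitsHom F u) := by
  have hb : (b : compactCover F n).1.base 1 0 = 0 := b.2
  have h00 : ((u : 𝒪[F]) : F) = (b : compactCover F n).1.base 0 0 := by
    rw [hu, integralBase_apply]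
  have hX : (kubotaX (b : compactCover F n).1.base)⁻¹ = integerUnitsHom F u := by
    rw [inv_eq_iff_eq_inv]
    apply Units.ext
    rw [kubotaX_of_eq hb, Units.val_inv_eq_inv_val, integerUnitsHom_apply, h00]
    have h := entry_det (b : compactCover F n).1.base
    rw [hb, mul_zero, sub_zero] at h
    exact eq_inv_of_mul_eq_one_right h
  apply Subtype.ext
  apply Subtype.ext
  apply MetaSL2.ext
  · change dg (kubotaX (b : compactCover F n).1.base)⁻¹ = 1 * dg ((integerUnitsHom F u : Fˣ))
    rw [hX, one_mul]
  · change (b : compactCover F n).1.root =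
      kubota n 1 (dg ((integerUnitsHom F u : Fˣ))) * rootCoord F n b * 1
    rw [kubota_one_left, one_mul, mul_one, rootCoord_apply, sec_of_zero hb, div_one]

theorem mem_borel_of_integralBase {x : compactCover F n} {u : 𝒪[F]ˣ} {y : 𝒪[F]}
    (h : integralBase F n x = borelElt u y) :
    x ∈ (borelCover F n).subgroupOf (compactCover F n) := by
  change x.1.base 1 0 = 0
  rw [← integralBase_apply, h, borelElt_10]; rfl

theorem exists_integralBase_eq (b : (borelCover F n).subgroupOf (compactCover F n)) :
    ∃ (u : 𝒪[F]ˣ) (y : 𝒪[F]), integralBase F n b = borelElt u y := by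
  have hb : (b : compactCover F n).1.base 1 0 = 0 := b.2
  have h10 : integralBase F n b 1 0 = 0 := Subtype.ext ((integralBase_apply _ _ _).trans hb)
  have h := entry_det (integralBase F n b)
  rw [h10, mul_zero, sub_zero] at h
  refine ⟨⟨_, _, h, by rw [mul_comm, h]⟩, integralBase F n b 0 1, ?_⟩
  apply entry_ext <;> simp [h10]

variable {γ : centA F n →* ℂˣ}

theorem inflate_apply (b : (borelCover F n).subgroupOf (compactCover F n)) {u : 𝒪[F]ˣ} {y : 𝒪[F]}
    (h : integralBase F n b = borelElt u y) :
    inflate γ b = γ (inclA F n (rootCoord F n b)) * unitChar γ u := by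
  rw [inflate, MonoidHom.comp_apply, compactTorusProj_apply b u (by rw [h, borelElt_00]), map_mul]
  rfl

/-- The function on `SL₂(𝒪)` attached to an element of `Ind χ`. -/
def restrictFun (f : SmoothIndSpace ((borelCover F n).subgroupOf (compactCover F n))
    (charRep (inflate γ))) (g : SpecialLinearGroup (Fin 2) 𝒪[F]) : ℂ :=
  indFun f (splitting F n g)

variable {f : SmoothIndSpace ((borelCover F n).subgroupOf (compactCover F n))
    (charRep (inflate γ))}

theorem indFun_borel_mul {b : compactCover F n} {u : 𝒪[F]ˣ} {y : 𝒪[F]}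
    (h : integralBase F n b = borelElt u y) (x : compactCover F n) :
    indFun f (b * x) = γ (inclA F n (rootCoord F n b)) * unitChar γ u * indFun f x := by
  have := indFun_mul_left f ⟨b, mem_borel_of_integralBase h⟩ x
  rw [this, charRep_apply, inflate_apply _ h, Units.val_mul]

theorem indFun_eq_restrictFun (x : compactCover F n) :
    indFun f x = γ (inclA F n (rootCoord F n x)) * restrictFun f (integralBase F n x) := by
  conv_lhs => rw [eq_inclCompact_mul_splitting x]
  rw [indFun_borel_mul (u := 1) (y := 0), rootCoord_inclCompact, map_one, Units.val_one, mul_one]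
  · rfl
  · rw [integralBase_inclCompact]
    apply entry_ext <;> simp

theorem restrictFun_injective {f' : SmoothIndSpace ((borelCover F n).subgroupOf (compactCover F n))
    (charRep (inflate γ))} (h : restrictFun f = restrictFun f') : f = f' :=
  indFun_ext fun x => by rw [indFun_eq_restrictFun, indFun_eq_restrictFun, h]

/-- Equivariance on the left is the definition of the induced representation; on the right it is the
eigenvector condition for `B̃¹ ∩ K̃¹`. -/
theorem isBiEquivariant_restrictFun {l : ℕ+}
    (hf : f ∈ eigenspace (charInd γ) (inflate γ))
    (hl : f ∈ fixedVectors (charInd γ) (congruenceIn F n l)) :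
    IsBiEquivariant (unitChar γ) l (restrictFun f) where
  left u y g := by
    rw [restrictFun, map_mul, indFun_borel_mul (integralBase_splitting _), rootCoord_splitting,
      map_one, map_one, Units.val_one, one_mul]
    rfl
  right u y g := by
    have h := hf ⟨splitting F n (borelElt u y), mem_borel_of_integralBase (integralBase_splitting _)⟩
    have h' := congrArg (fun f => indFun f (splitting F n g)) h
    simp only [indFun_smoothInd, indFun_smul] at h'
    rw [restrictFun, map_mul, h', inflate_apply _ (integralBase_splitting _), rootCoord_splitting,
      map_one, map_one, one_mul]
    rfl
  invariant g k hk := by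
    have h := mem_fixedVectors.1 hl (splitting F n k)
      (mem_congruenceCover_subgroupOf.2 ⟨by rwa [integralBase_splitting], rootCoord_splitting _⟩)
    rw [restrictFun, map_mul, ← indFun_smoothInd, h]
    rfl

theorem mem_fixedVectors_of_restrictFun {l : ℕ+}
    (h : ∀ g, ∀ k ∈ congruenceKer (𝓂[F] ^ (l : ℕ)), restrictFun f (g * k) = restrictFun f g) :
    f ∈ fixedVectors (charInd γ) (congruenceIn F n l) :=
  mem_fixedVectors.2 fun k hk => by
    rw [mem_congruenceCover_subgroupOf] at hk
    refine indFun_ext fun x => ?_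
    rw [indFun_smoothInd, indFun_eq_restrictFun, indFun_eq_restrictFun, map_mul (rootCoord F n),
      hk.2, mul_one, map_mul, h _ _ hk.1]

/-- The function on `K̃¹` attached to a function on `SL₂(𝒪)`. -/
def liftFun (γ : centA F n →* ℂˣ) (φ : SpecialLinearGroup (Fin 2) 𝒪[F] → ℂ)
    (x : compactCover F n) : ℂ :=
  γ (inclA F n (rootCoord F n x)) * φ (integralBase F n x)

/-- Bi-equivariant functions of finite level come from eigenvectors of `B̃¹ ∩ K̃¹` in `Ind χ`. -/
theorem exists_restrictFun_eq (γ : centA F n →* ℂˣ) {l : ℕ+}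
    {φ : SpecialLinearGroup (Fin 2) 𝒪[F] → ℂ} (h : IsBiEquivariant (unitChar γ) l φ) :
    ∃ f ∈ eigenspace (charInd γ) (inflate γ), f ∈ fixedVectors (charInd γ) (congruenceIn F n l) ∧
      restrictFun f = φ := by
  have h1 : ∀ (b : (borelCover F n).subgroupOf (compactCover F n)) (x : compactCover F n),
      liftFun γ φ (b * x) = charRep (inflate γ) b (liftFun γ φ x) := by
    intro b x
    obtain ⟨u, y, hb⟩ := exists_integralBase_eq b
    rw [charRep_apply, inflate_apply b hb, liftFun, liftFun, map_mul, map_mul, map_mul, map_mul, hb, h.left,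
      Units.val_mul, Units.val_mul]
    ring
  have h2 : ∀ᶠ g in nhds (1 : compactCover F n), ∀ x : compactCover F n,
      liftFun γ φ (x * g) = liftFun γ φ x := by
    rw [eventually_nhds_one_subgroup]
    refine ⟨l, fun g hg x => ?_⟩
    rw [mem_congruenceCover_subgroupOf] at hg
    rw [liftFun, map_mul (rootCoord F n), hg.2, mul_one, map_mul, h.invariant _ _ hg.1]; rfl
  have h3 : restrictFun (γ := γ) (indMk _ h1 h2) = φ := by
    funext g
    change (γ (inclA F n (rootCoord F n (splitting F n g))) : ℂ) *
      φ (integralBase F n (splitting F n g)) = φ g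
    rw [rootCoord_splitting, integralBase_splitting, map_one, map_one, Units.val_one, one_mul]
  refine ⟨indMk _ h1 h2, fun b => indFun_ext fun x => ?_,
    mem_fixedVectors_of_restrictFun fun g k hk => by rw [h3, h.invariant g k hk], h3⟩
  obtain ⟨u, y, hb⟩ := exists_integralBase_eq b
  rw [indFun_smul, inflate_apply b hb, indFun_smoothInd, indFun_indMk, indFun_indMk, liftFun,
    liftFun, map_mul,
    map_mul, map_mul, map_mul, hb, h.right, smul_eq_mul, Units.val_mul, Units.val_mul]
  ring

/-- Evaluation at the point of `K̃¹` above a point of `SL₂(𝒪)`. -/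
def restrictEval (γ : centA F n →* ℂˣ) (g : SpecialLinearGroup (Fin 2) 𝒪[F]) :
    SmoothIndSpace ((borelCover F n).subgroupOf (compactCover F n)) (charRep (inflate γ)) →ₗ[ℂ] ℂ :=
  indEval _ (splitting F n g)

theorem restrictEval_apply (g : SpecialLinearGroup (Fin 2) 𝒪[F]) :
    restrictEval γ g f = restrictFun f g := rfl

theorem isSmoothFor_charInd (γ : centA F n →* ℂˣ) :
    IsSmoothFor (charInd γ) (congruenceIn F n) := isSmoothFor_smoothInd _

theorem mem_fixedVectors_of_proj {l : ℕ+}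
    (h : (fixedVectors (charInd γ) (congruenceIn F n l)).subtype
      ((isSmoothFor_charInd γ).proj l f) = f) :
    f ∈ fixedVectors (charInd γ) (congruenceIn F n l) :=
  h ▸ ((isSmoothFor_charInd γ).proj l f).2

variable (hodd : Odd (Nat.card 𝓀[F]))
include hodd

/-- An eigenvector of level `m` is determined by its value at `1`, because the value at the Weyl
element vanishes. The function supported on lower rows with `cd ∈ 𝔭ᵐ` shows that the space is not
zero. -/
theorem isIrreducible_onFixed (γ : centA F n →* ℂˣ) (m : ℕ+)
    (hθ : ∀ u : 𝒪[F]ˣ, (u : 𝒪[F]) - 1 ∈ 𝓂[F] ^ (m : ℕ) → unitChar γ u = 1)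
    (hprim : (m : ℕ) = 1 ∨ ∃ v : 𝒪[F]ˣ, (v : 𝒪[F]) - 1 ∈ 𝓂[F] ^ ((m : ℕ) - 1) ∧ unitChar γ v ≠ 1)
    (hne : ¬ ((m : ℕ) = 1 ∧ ∀ u, unitChar γ u ^ 2 = 1)) :
    (onFixed (charInd γ) (congruenceIn F n m)).IsIrreducible := by
  have : Nontrivial (fixedVectors (charInd γ) (congruenceIn F n m)) := by
    obtain ⟨f, -, hf, e⟩ := exists_restrictFun_eq γ (isBiEquivariant_lowerRowFun_pow m.ne_zero hθ)
    refine ⟨⟨f, hf⟩, 0, fun h => ?_⟩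
    have h0 : f = 0 := congrArg Subtype.val h
    have h1 : restrictFun f 1 = 1 := by
      rw [e, lowerRowFun_of _ 1 (by simp) (by simp), inv_one, map_one, Units.val_one]
    rw [h0] at h1
    exact zero_ne_one h1
  refine ((isSmoothFor_charInd γ).isRetract_fixed m).isIrreducible
    (isWhittaker_indEval (inflate γ)) (L := congruenceIn F n m) (fun g hg y => ?_)
    (restrictEval γ 1) fun f hf hp h1 => ?_
  · exact Subtype.ext (mem_fixedVectors.1 y.2 g hg)
  · have hb := isBiEquivariant_restrictFun hf (mem_fixedVectors_of_proj hp)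
    exact restrictFun_injective (hb.eq_zero_of_level hodd m.ne_zero hθ hprim h1
      (hb.weyl_eq_zero_of_primitive hodd hθ hprim hne))

/-- The values at `1` and at the Weyl element are coordinates on the eigenvectors of level one. The
dual basis consists of the functions supported on the preimages of the two Bruhat cells of the
residual group. -/
theorem splitsInTwo_onFixed (γ : centA F n →* ℂˣ)
    (hθ : ∀ u : 𝒪[F]ˣ, (u : 𝒪[F]) - 1 ∈ 𝓂[F] → unitChar γ u = 1)
    (hsq : ∀ u, unitChar γ u ^ 2 = 1) :
    SplitsInTwo (onFixed (charInd γ) (congruenceIn F n 1)) := by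
  have hθ' : ∀ u : 𝒪[F]ˣ, (u : 𝒪[F]) - 1 ∈ 𝓂[F] ^ ((1 : ℕ+) : ℕ) → unitChar γ u = 1 :=
    fun u hu => hθ u (by simpa using hu)
  refine ((isSmoothFor_charInd γ).isRetract_fixed 1).splitsInTwo
    (isWhittaker_indEval (inflate γ)) (L := congruenceIn F n 1) (fun g hg y => ?_)
    (exists_hom_of_equivariant _) ((restrictEval γ 1).prod (restrictEval γ (weylElt _)))
    (fun f hf hp h1 => ?_) fun z => ?_
  · exact Subtype.ext (mem_fixedVectors.1 y.2 g hg)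
  · have hb := isBiEquivariant_restrictFun hf (mem_fixedVectors_of_proj hp)
    exact restrictFun_injective (hb.eq_zero_of_level hodd one_ne_zero hθ' (Or.inl rfl)
      (congrArg Prod.fst h1) (congrArg Prod.snd h1))
  · obtain ⟨f₁, h₁, h₁', e₁⟩ := exists_restrictFun_eq γ (l := 1)
      (isBiEquivariant_lowerRowFun_pow one_ne_zero hθ')
    obtain ⟨f₂, h₂, h₂', e₂⟩ := exists_restrictFun_eq γ (l := 1)
      (isBiEquivariant_bigCellFun hθ hsq)
    have hmem : z.1 • f₁ + z.2 • f₂ ∈ fixedVectors (charInd γ) (congruenceIn F n 1) :=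
      add_mem (Submodule.smul_mem _ _ h₁') (Submodule.smul_mem _ _ h₂')
    refine ⟨z.1 • f₁ + z.2 • f₂, add_mem (Submodule.smul_mem _ _ h₁) (Submodule.smul_mem _ _ h₂),
      (isSmoothFor_charInd γ).proj_of_mem hmem, ?_⟩
    have a1 : restrictFun f₁ 1 = 1 := by
      rw [e₁, lowerRowFun_of _ 1 (by simp) (by simp), inv_one, map_one, Units.val_one]
    have a2 : restrictFun f₁ (weylElt _) = 0 := by
      rw [e₁, lowerRowFun_eq_zero]
      simp [weylElt]
    have a3 : restrictFun f₂ 1 = 0 := by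
      rw [e₂, bigCellFun_eq_zero]
      simp
    have a4 : restrictFun f₂ (weylElt _) = 1 := by
      rw [e₂, bigCellFun_of 1 (by simp [weylElt]), inv_one, map_one, Units.val_one]
    apply Prod.ext
    · change restrictEval γ 1 (z.1 • f₁ + z.2 • f₂) = z.1
      rw [map_add, map_smul, map_smul, restrictEval_apply, restrictEval_apply, a1, a3]
      simp
    · change restrictEval γ (weylElt _) (z.1 • f₁ + z.2 • f₂) = z.2
      rw [map_add, map_smul, map_smul, restrictEval_apply, restrictEval_apply, a2, a4]
      simp

/-- With `l = j + 1`, the coordinates are the differences between the values at the lower unipotents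
of entries `pʲ`, `δpʲ` and the value at `1`. They vanish on vectors of level `j`, and an eigenvector
of level `j + 1` on which both vanish has level `j`. -/
theorem splitsInTwo_fixedQuotient (γ : centA F n →* ℂˣ) {m l : ℕ+} (hl : m < l)
    (hθ : ∀ u : 𝒪[F]ˣ, (u : 𝒪[F]) - 1 ∈ 𝓂[F] ^ (m : ℕ) → unitChar γ u = 1) :
    SplitsInTwo (fixedQuotient (charInd γ) (congruenceIn F n l) (congruenceIn F n (l - 1))) := by
  have h1l : 1 < l := lt_of_le_of_lt (_root_.one_le (a := m)) hl
  -- Subtraction on `ℕ+` is truncated; as `l > 1`, it is replaced once and for all by `l = j + 1`.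
  obtain ⟨j, hj⟩ : ∃ j, l - 1 = j := ⟨_, rfl⟩
  have hlj : l = j + 1 := by rw [← hj, IsSmoothFor.pnat_sub_one_add_one h1l]
  have hmj : m ≤ j := hj ▸ IsSmoothFor.le_pnat_sub_one hl
  rw [hj]
  clear hj
  subst hlj
  have hjl : j ≤ j + 1 := (PNat.lt_add_right j 1).le
  have hθj : ∀ u : 𝒪[F]ˣ, (u : 𝒪[F]) - 1 ∈ 𝓂[F] ^ (j : ℕ) → unitChar γ u = 1 :=
    fun u hu => hθ u (Ideal.pow_le_pow_right hmj hu)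
  obtain ⟨p, hp⟩ := IsDiscreteValuationRing.exists_irreducible 𝒪[F]
  obtain ⟨δ, hδ, hδ1, hδ2⟩ := exists_nonsquare_unit (R := 𝒪[F]) hodd
  have hS := isSmoothFor_charInd γ
  set q : 𝒪[F] := p ^ (j : ℕ) with hq
  have hpj : q ∈ 𝓂[F] ^ (j : ℕ) := (mem_maximalIdeal_pow_iff hp).2 dvd_rfl
  have hlow : ∀ c ∈ 𝓂[F] ^ (j : ℕ), lowerElt c ∈ congruenceKer (𝓂[F] ^ (j : ℕ)) := fun c hc => by
    rw [mem_congruenceKer]; simpa using hc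
  -- the two coordinates vanish on vectors of level `j`
  have hkill : ∀ c ∈ 𝓂[F] ^ (j : ℕ), ∀ f ∈ fixedVectors (charInd γ) (congruenceIn F n j),
      (restrictEval γ (lowerElt c) - restrictEval γ 1) f = 0 := by
    intro c hc f hf
    have h := mem_fixedVectors.1 hf (splitting F n (lowerElt c))
      (mem_congruenceCover_subgroupOf.2 ⟨by rw [integralBase_splitting]; exact hlow c hc,
        rootCoord_splitting _⟩)
    rw [LinearMap.sub_apply, restrictEval_apply, restrictEval_apply, sub_eq_zero]
    have h' := congrArg (fun f => indFun f (splitting F n 1)) h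
    simp only [indFun_smoothInd] at h'
    rw [map_one, one_mul] at h'
    rw [restrictFun, h', restrictFun, map_one]
  have hdq : (δ : 𝒪[F]) * q ∈ 𝓂[F] ^ (j : ℕ) := Ideal.mul_mem_left _ _ hpj
  refine (hS.isRetract_quotient hjl).splitsInTwo
    (isWhittaker_indEval (inflate γ)) (L := congruenceIn F n (j + 1))
    (IsSmoothFor.quotient_trivial (j + 1) j)
    (exists_hom_of_equivariant _) ((restrictEval γ (lowerElt q) - restrictEval γ 1).prod
      (restrictEval γ (lowerElt (δ * q)) - restrictEval γ 1))
    (fun f hf hp' h1 => ?_) fun z => ?_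
  -- Now `hp'` says that `f` equals its projection to level `j + 1` minus its projection to level
  -- `j`. This is zero as soon as `f` has level `j`.
  · rw [hS.inclQuotient_projQuotient hjl] at hp'
    have hfl : f ∈ fixedVectors (charInd γ) (congruenceIn F n (j + 1)) := by
      rw [← hp']
      exact sub_mem (hS.proj (j + 1) f).2
        (fixedVectors_anti (hS.antitone hjl) (hS.proj j f).2)
    have hb := isBiEquivariant_restrictFun hf hfl
    rw [PNat.add_coe, PNat.one_coe] at hb
    have e1 : restrictFun f (lowerElt q) = restrictFun f 1 :=
      sub_eq_zero.1 (congrArg Prod.fst h1)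
    have e2 : restrictFun f (lowerElt (δ * q)) = restrictFun f 1 :=
      sub_eq_zero.1 (congrArg Prod.snd h1)
    have hfj : f ∈ fixedVectors (charInd γ) (congruenceIn F n j) :=
      mem_fixedVectors_of_restrictFun fun g k hk =>
        hb.invariant_of_level hodd j.ne_zero hθj
          (fun c hc => hb.lower_of_mem_pow hp hδ e1 e2 hc) g hk
    rw [hS.proj_of_mem hfl, hS.proj_of_mem hfj, sub_self] at hp'
    exact hp'.symm
  · have hex : ∀ a : 𝒪[F], ∃ f ∈ eigenspace (charInd γ) (inflate γ),
        f ∈ fixedVectors (charInd γ) (congruenceIn F n (j + 1)) ∧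
        restrictFun f = lowerRowFun (unitChar γ)
          fun r => ∃ t : 𝒪[F]ˣ, r - t ^ 2 * (a * q) ∈ 𝓂[F] ^ ((j : ℕ) + 1) := fun a =>
      exists_restrictFun_eq γ (l := j + 1) (isBiEquivariant_lowerRowFun_class j.ne_zero hθj hp a)
    obtain ⟨f₁, h₁, h₁', e₁⟩ := hex 1
    obtain ⟨f₂, h₂, h₂', e₂⟩ := hex δ
    have hval : ∀ (a b c : 𝒪[F]) (P : Prop) [Decidable P], c = b * q →
        ((∃ t : 𝒪[F]ˣ, b - t ^ 2 * a ∈ 𝓂[F]) ↔ P) →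
        lowerRowFun (unitChar γ) (fun r => ∃ t : 𝒪[F]ˣ, r - t ^ 2 * (a * q) ∈ 𝓂[F] ^ ((j : ℕ) + 1))
          (lowerElt c) = if P then 1 else 0 := by
      rintro a b _ P _ rfl hP
      classical
      rw [lowerRowFun_lowerElt]
      exact if_congr ((class_iff hp a b).trans hP) rfl rfl
    have a11 : restrictFun f₁ (lowerElt q) = 1 := by
      rw [e₁, hval 1 1 _ True (one_mul q).symm, if_pos trivial]
      exact iff_true_intro ⟨1, by simp⟩
    have a1δ : restrictFun f₁ (lowerElt (δ * q)) = 0 := by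
      rw [e₁, hval 1 δ _ False rfl, if_neg id]
      exact iff_false_intro fun ⟨t, ht⟩ => hδ1 t (by simpa using ht)
    have a10 : restrictFun f₁ 1 = 0 := by
      rw [e₁, ← lowerElt_zero, hval 1 0 _ False (zero_mul q).symm, if_neg id]
      exact iff_false_intro fun ⟨t, ht⟩ => by simp at ht
    have a21 : restrictFun f₂ (lowerElt q) = 0 := by
      rw [e₂, hval δ 1 _ False (one_mul q).symm, if_neg id]
      exact iff_false_intro fun ⟨t, ht⟩ => hδ2 t ht
    have a2δ : restrictFun f₂ (lowerElt (δ * q)) = 1 := by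
      rw [e₂, hval δ δ _ True rfl, if_pos trivial]
      exact iff_true_intro ⟨1, by simp⟩
    have a20 : restrictFun f₂ 1 = 0 := by
      rw [e₂, ← lowerElt_zero, hval δ 0 _ False (zero_mul q).symm, if_neg id]
      exact iff_false_intro fun ⟨t, ht⟩ => by simp at ht
    let f := z.1 • f₁ + z.2 • f₂
    have hf : f ∈ eigenspace (charInd γ) (inflate γ) :=
      add_mem (Submodule.smul_mem _ _ h₁) (Submodule.smul_mem _ _ h₂)
    have hfl : f ∈ fixedVectors (charInd γ) (congruenceIn F n (j + 1)) :=
      add_mem (Submodule.smul_mem _ _ h₁') (Submodule.smul_mem _ _ h₂')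
    have hpe : (hS.proj j f).1 ∈ eigenspace (charInd γ) (inflate γ) := fun b => by
      rw [← hS.proj_apply, hf b, map_smul]; rfl
    have hpl : (hS.proj j f).1 ∈
        fixedVectors (charInd γ) (congruenceIn F n (j + 1)) :=
      fixedVectors_anti (hS.antitone hjl) (hS.proj j f).2
    -- Subtracting the component of level `j` moves `f` into the complement that represents the
    -- quotient, and by `hkill` it does not affect the coordinates.
    refine ⟨f - (hS.proj j f).1, sub_mem hf hpe, ?_, ?_⟩
    · rw [hS.inclQuotient_projQuotient hjl, hS.proj_of_mem (sub_mem hfl hpl), map_sub,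
        Submodule.coe_sub, hS.proj_of_mem (hS.proj j f).2, sub_self, sub_zero]
    · have hcalc : ∀ c ∈ 𝓂[F] ^ (j : ℕ),
          (restrictEval γ (lowerElt c) - restrictEval γ 1) (f - (hS.proj j f).1) =
            z.1 * restrictFun f₁ (lowerElt c) + z.2 * restrictFun f₂ (lowerElt c) := by
        intro c hc
        rw [map_sub, hkill c hc _ (hS.proj j f).2, sub_zero, LinearMap.sub_apply, map_add, map_add,
          map_smul, map_smul, map_smul, map_smul]
        simp only [restrictEval_apply, a10, a20, smul_eq_mul]
        ring
      apply Prod.ext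
      · exact (hcalc q hpj).trans (by rw [a11, a21]; ring)
      · exact (hcalc _ hdq).trans (by rw [a1δ, a2δ]; ring)

end CompactInduction

end

end KTypes

namespace KTypes

noncomputable section

set_option linter.unusedSectionVars false

/-! ### The covering torus and its characters -/

section TorusCharacters

open Matrix

variable {F : Type*} [Field F] [ValuativeRel F] [TopologicalSpace F] [IsNonarchimedeanLocalField F]
variable {n : ℕ} [Fact (n ∣ Nat.card 𝓀[F] - 1)]

theorem kubota_dg (s t : Fˣ) : kubota n (dg s) (dg t) = hilbert n t s := by
  unfold kubota
  rw [← map_mul, kubotaX_dg, kubotaX_dg, kubotaX_dg]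
  have e1 : (s * t)⁻¹ / s⁻¹ = t⁻¹ := by rw [mul_inv, mul_div_cancel_left]
  have e2 : (s * t)⁻¹ / t⁻¹ = s⁻¹ := by rw [mul_inv, mul_div_cancel_right]
  rw [e1, e2, map_inv, map_inv, MonoidHom.inv_apply, inv_inv]

/-- The element `(dg(t), ζ)` of `T̃¹`. -/
def torusElt (t : Fˣ) (ζ : rootsOfUnity n 𝓀[F]) : torusCover F n := ⟨⟨dg t, ζ⟩, ⟨t, rfl⟩⟩

theorem torusElt_mul (s t : Fˣ) (ζ η : rootsOfUnity n 𝓀[F]) :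
    torusElt s ζ * torusElt t η = torusElt (s * t) (hilbert n t s * ζ * η) := by
  apply Subtype.ext
  apply MetaSL2.ext
  · exact (map_mul dg s t).symm
  · change kubota n (dg s) (dg t) * ζ * η = _
    rw [kubota_dg]; rfl

theorem eq_torusElt (x : torusCover F n) : x = torusElt (torusCoord F n x) x.1.root := by
  apply Subtype.ext
  apply MetaSL2.ext
  · exact (dg_torusCoord x).symm
  · rfl

@[simp] theorem torusCoord_torusElt (t : Fˣ) (ζ : rootsOfUnity n 𝓀[F]) :
    torusCoord F n (torusElt t ζ) = t := by
  change (kubotaX (dg t))⁻¹ = t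
  rw [kubotaX_dg, inv_inv]

theorem inclTorus_eq (ζ : rootsOfUnity n 𝓀[F]) : inclTorus F n ζ = torusElt 1 ζ := by
  apply Subtype.ext
  apply MetaSL2.ext
  · exact (map_one dg).symm
  · rfl

theorem mul_eq_of_mul_eq_one {M : Type*} [CommGroup M] {a b : M} (r s : M) (h : a * b = 1) :
    b * r * s = a * s * r * b ^ 2 := by
  have e : a * s * r * b ^ 2 = a * b * (b * r * s) := by rw [sq]; ac_rfl
  rw [e, h, one_mul]

/-- The commutator of two elements of `T̃¹`. -/
theorem torus_mul_comm (x y : torusCover F n) :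
    x * y = y * x * inclTorus F n (hilbert n (torusCoord F n y) (torusCoord F n x) ^ 2) := by
  rw [eq_torusElt x, eq_torusElt y, inclTorus_eq, torusElt_mul, torusElt_mul, torusElt_mul,
    torusCoord_torusElt, torusCoord_torusElt, mul_comm (torusCoord F n y), mul_one,
    MonoidHom.map_one, MonoidHom.one_apply, one_mul]
  congr 1
  exact mul_eq_of_mul_eq_one _ _ (hilbert_skew n (torusCoord F n x) (torusCoord F n y))

theorem inclTorus_mem_center (ζ : rootsOfUnity n 𝓀[F]) :
    inclTorus F n ζ ∈ Subgroup.center (torusCover F n) := by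
  rw [Subgroup.mem_center_iff]
  intro y
  rw [torus_mul_comm, inclTorus_eq, torusCoord_torusElt, MonoidHom.map_one, MonoidHom.one_apply,
    one_pow, map_one, mul_one]

theorem mem_center_of_hilbert {x : torusCover F n}
    (h : ∀ t, hilbert n t (torusCoord F n x) ^ 2 = 1) :
    x ∈ Subgroup.center (torusCover F n) := by
  rw [Subgroup.mem_center_iff]
  intro y
  rw [torus_mul_comm x y, h, map_one, mul_one]

theorem integerUnitsHom_surjective : Function.Surjective (integerUnitsHom F) := fun t => by
  have h := (val_eq_zero_iff _).1 t.2
  have h' := (val_eq_zero_iff _).1 (t⁻¹).2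
  refine ⟨⟨⟨(t : Fˣ), h.le⟩, ⟨((t⁻¹ : integerUnits F) : Fˣ), h'.le⟩, ?_, ?_⟩, ?_⟩
  · exact Subtype.ext (by simp)
  · exact Subtype.ext (by simp)
  · exact Subtype.ext (Units.ext rfl)

theorem valuation_sub_one_lt {u : 𝒪[F]ˣ} (hu : (u : 𝒪[F]) - 1 ∈ 𝓂[F]) :
    valuation F ((((integerUnitsHom F u : integerUnits F) : Fˣ) : F) - 1) < 1 :=
  valuation_lt_one_of_mem (x := (u : 𝒪[F]) - 1) (j := 1) (by simpa using hu)

theorem hilbert_one_unit {u : 𝒪[F]ˣ} (hu : (u : 𝒪[F]) - 1 ∈ 𝓂[F]) (t : Fˣ) :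
    hilbert n t (integerUnitsHom F u : integerUnits F) = 1 :=
  hilbert_one_add n t (valuation_sub_one_lt hu)

/-- The Hilbert symbol of a uniformizer and a unit. -/
theorem hilbert_uniformizer {ϖ : Fˣ} (hϖ : val ϖ = 1) (u : integerUnits F) :
    ((hilbert n ϖ (u : Fˣ) : rootsOfUnity n 𝓀[F]) : 𝓀[F]ˣ) =
      (red F u)⁻¹ ^ ((Nat.card 𝓀[F] - 1) / n) := by
  have : tameElt ϖ (u : Fˣ) = u⁻¹ := by
    apply Subtype.ext
    simp [tameElt, hϖ, mem_integerUnits.1 u.2]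
  rw [hilbert_val, this, map_inv]

theorem red_integerUnitsHom (u : 𝒪[F]ˣ) :
    red F (integerUnitsHom F u) = Units.map (IsLocalRing.residue 𝒪[F]).toMonoidHom u := by
  apply Units.ext
  rw [red_val]; rfl

theorem exists_red_eq (x : 𝓀[F]ˣ) : ∃ u : 𝒪[F]ˣ, red F (integerUnitsHom F u) = x := by
  obtain ⟨r, hr⟩ := IsLocalRing.residue_surjective (x : 𝓀[F])
  have : IsUnit r := by
    by_contra h
    exact x.ne_zero (hr ▸ (IsLocalRing.residue_eq_zero_iff r).2 h)
  refine ⟨this.unit, ?_⟩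
  rw [red_integerUnitsHom]
  exact Units.ext hr

variable (F) in
/-- There is a unit which generates the residue field. -/
theorem exists_generator : ∃ u : 𝒪[F]ˣ,
    (∀ v : 𝒪[F]ˣ, ∃ k : ℕ, ((v * (u ^ k)⁻¹ : 𝒪[F]ˣ) : 𝒪[F]) - 1 ∈ 𝓂[F]) ∧
    orderOf (red F (integerUnitsHom F u)) = Nat.card 𝓀[F] - 1 := by
  obtain ⟨g, hg⟩ := IsCyclic.exists_generator (α := 𝓀[F]ˣ)
  obtain ⟨u, rfl⟩ := exists_red_eq g
  refine ⟨u, fun v => ?_, ?_⟩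
  · obtain ⟨k, hk⟩ := mem_powers_iff_mem_zpowers.2 (hg (red F (integerUnitsHom F v)))
    refine ⟨k, ?_⟩
    have h1 : red F (integerUnitsHom F (v * (u ^ k)⁻¹)) = 1 := by
      rw [map_mul, map_inv, map_pow, map_mul, map_inv, map_pow]
      simp only at hk
      rw [hk, mul_inv_cancel]
    rw [red_integerUnitsHom] at h1
    rw [← IsLocalRing.residue_eq_zero_iff, map_sub, map_one, sub_eq_zero]
    exact congrArg Units.val h1
  · rw [orderOf_eq_card_of_forall_mem_zpowers hg, Nat.card_units]

/-- The symbol with a uniformizer is, up to inversion, the power `(q - 1)/n` of the reduction, which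
here has order `q - 1`. -/
theorem orderOf_hilbert {ϖ : Fˣ} (hϖ : val ϖ = 1) {u : 𝒪[F]ˣ}
    (hu : orderOf (red F (integerUnitsHom F u)) = Nat.card 𝓀[F] - 1) :
    orderOf (hilbert n ϖ (integerUnitsHom F u : integerUnits F)) = n := by
  have hd : n ∣ Nat.card 𝓀[F] - 1 := Fact.out
  have hpos : 0 < Nat.card 𝓀[F] - 1 := by
    rw [← Nat.card_units]; exact Nat.card_pos
  obtain ⟨k, hk⟩ := hd
  have hn : 0 < n := Nat.pos_of_ne_zero (by rintro rfl; omega)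
  have hk0 : k ≠ 0 := by rintro rfl; omega
  rw [← Subgroup.orderOf_coe, hilbert_uniformizer hϖ, hk, Nat.mul_div_cancel_left _ hn,
    orderOf_pow_of_dvd hk0, orderOf_inv, hu, hk, Nat.mul_div_cancel _ (Nat.pos_of_ne_zero hk0)]
  rw [orderOf_inv, hu, hk]
  exact dvd_mul_left _ _

/-! ### The characters `χᵢ` on units -/

variable {χ₀ : centA F n →* ℂˣ} {ε : rootsOfUnity n 𝓀[F] →* ℂˣ} {ϖ : Fˣ} {i k : ℕ}

theorem unitChar_twist (χ₀ : centA F n →* ℂˣ) (ϖ : Fˣ) (i : ℕ) (u : 𝒪[F]ˣ) :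
    unitChar (twist χ₀ ϖ i) u = unitChar χ₀ u *
      χ₀ (inclA F n (hilbert n ϖ (integerUnitsHom F u : integerUnits F) ^ (2 * i))) := by
  have h : unitPart ϖ (torusCoord F n (unitTorusHom F n (integerUnitsHom F u)).1) =
      (integerUnitsHom F u : integerUnits F) := by
    have h1 : torusCoord F n (unitTorusHom F n (integerUnitsHom F u)).1 =
        (integerUnitsHom F u : integerUnits F) := torusCoord_torusElt _ 1
    rw [h1]
    change _ * ϖ ^ (-val _) = _
    rw [mem_integerUnits.1 (integerUnitsHom F u).2, neg_zero, zpow_zero, mul_one]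
  change χ₀ _ * χ₀ (inclA F n (hilbert n ϖ (unitPart ϖ (torusCoord F n
    (unitTorusHom F n (integerUnitsHom F u)).1)) ^ (2 * i))) = _
  rw [h]; rfl

/-- Squaring `χᵢ` on `u` gives `χ₀(dg(u²), 1)` times `ε((ϖ, u²)ₙ)^{2i}`, so `(Eᵢ)` says that this
square is trivial. -/
theorem exceptional_iff_sq (h : ∀ ζ, χ₀ (inclA F n ζ) = ε ζ) :
    Exceptional χ₀ ε ϖ i ↔ ∀ u, unitChar (twist χ₀ ϖ i) u ^ 2 = 1 := by
  refine integerUnitsHom_surjective.forall.trans (forall_congr' fun u => ?_)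
  have e : unitChar (twist χ₀ ϖ i) u ^ 2 = χ₀ (unitTorus n (integerUnitsHom F u ^ 2)) *
      ε (hilbert n ϖ ((integerUnitsHom F u ^ 2 : integerUnits F) : Fˣ) ^ (2 * (i : ℤ))) := by
    rw [← map_pow (unitChar _) u 2, unitChar_twist, h, map_pow (integerUnitsHom F)]
    have e2 : (2 * (i : ℤ)) = ((2 * i : ℕ) : ℤ) := by push_cast; rfl
    rw [e2, _root_.zpow_natCast]
    congr 1
  rw [e, _root_.zpow_neg, map_inv, ← mul_eq_one_iff_eq_inv]

/-- Given `(Eᵢ)`, the condition `(E_k)` says that `(ϖ, t)ₙ` to the power `4(i - k)` is trivial for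
all units `t`. By faithfulness of `ε` and the order of the symbol on a residual generator, this is a
divisibility. -/
theorem exceptional_iff_dvd (hϖ : val ϖ = 1) (hε : Function.Injective ε)
    (hi : Exceptional χ₀ ε ϖ i) :
    Exceptional χ₀ ε ϖ k ↔ (n : ℤ) ∣ 4 * ((i : ℤ) - k) := by
  obtain ⟨u, -, hu⟩ := exists_generator F
  have ho := orderOf_hilbert (n := n) hϖ hu
  have key : ∀ t : integerUnits F, (χ₀ (unitTorus n (t ^ 2)) =
      ε (hilbert n ϖ ((t ^ 2 : integerUnits F) : Fˣ) ^ (-(2 * (k : ℤ))))) ↔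
      hilbert n ϖ (t : Fˣ) ^ (4 * ((i : ℤ) - k)) = 1 := by
    intro t
    rw [hi t, hε.eq_iff, Subgroup.coe_pow, map_pow, ← _root_.zpow_natCast, ← _root_.zpow_mul, ← _root_.zpow_mul,
      ← mul_inv_eq_one, ← _root_.zpow_neg, ← _root_.zpow_add, ← inv_eq_one, ← _root_.zpow_neg]
    have : -(((2 : ℕ) : ℤ) * -(2 * (i : ℤ)) + -(((2 : ℕ) : ℤ) * -(2 * (k : ℤ)))) =
        4 * ((i : ℤ) - k) := by push_cast; ring
    rw [this]
  rw [Exceptional]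
  simp only [key]
  constructor
  · intro h
    rw [← ho]
    exact orderOf_dvd_iff_zpow_eq_one.2 (h _)
  · rintro ⟨d, hd⟩ t
    rw [hd, _root_.zpow_mul, _root_.zpow_natCast]
    have : hilbert n ϖ (t : Fˣ) ^ n = 1 := Subtype.ext (hilbert n ϖ (t : Fˣ)).2
    rw [this, _root_.one_zpow]

theorem unitTorusHom_mem_congruenceCover {j : ℕ+} {u : 𝒪[F]ˣ}
    (hu : (u : 𝒪[F]) - 1 ∈ 𝓂[F] ^ (j : ℕ)) :
    ((unitTorusHom F n (integerUnitsHom F u)).1 : MetaSL2 F n) ∈ congruenceCover F n j := by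
  refine ⟨⟨borelElt u 0, mem_congruenceKer.2 ⟨hu, zero_mem _, zero_mem _, ?_⟩, ?_⟩, rfl⟩
  · have := Ideal.mul_mem_left _ (-((u⁻¹ : 𝒪[F]ˣ) : 𝒪[F])) hu
    convert this using 1
    rw [borelElt_11, mul_sub, neg_mul, Units.inv_mul]; ring
  · apply entry_ext
    · rfl
    · rfl
    · rfl
    · change (((u⁻¹ : 𝒪[F]ˣ) : 𝒪[F]) : F) = (((integerUnitsHom F u)⁻¹ : integerUnits F) : Fˣ)
      rw [← map_inv]; rfl

theorem unitTorusHom_mem_center {u : 𝒪[F]ˣ} (hu : (u : 𝒪[F]) - 1 ∈ 𝓂[F]) :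
    (unitTorusHom F n (integerUnitsHom F u)).1 ∈ Subgroup.center (torusCover F n) :=
  mem_center_of_hilbert fun t => by
    have h1 : torusCoord F n (unitTorusHom F n (integerUnitsHom F u)).1 =
        (integerUnitsHom F u : integerUnits F) := torusCoord_torusElt _ 1
    rw [h1, hilbert_one_unit hu, one_pow]

variable {χ : Subgroup.center (torusCover F n) →* ℂˣ}
  (hχ₀ : χ₀.comp (Subgroup.inclusion center_le_centA) = χ)

include hχ₀ in
theorem apply_of_mem_center (a : centA F n) (ha : a.1 ∈ Subgroup.center (torusCover F n)) :
    χ₀ a = χ ⟨a.1, ha⟩ := by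
  rw [← hχ₀]; rfl

variable {m : ℕ+} (hm : IsLeast {j : ℕ+ | ∀ z : Subgroup.center (torusCover F n),
      ((z : torusCover F n) : MetaSL2 F n) ∈ congruenceCover F n j → χ z = 1} m)
include hχ₀ hm

/-- The symbol is trivial on `1 + 𝔭`, so there `χᵢ` coincides with `χ₀`. Those units moreover give
central elements, on which `χ₀` is `χ`. The conductor of `χ` thus controls all the `χᵢ`
simultaneously. -/
theorem unitChar_twist_eq_one (ϖ : Fˣ) (i : ℕ) (u : 𝒪[F]ˣ)
    (hu : (u : 𝒪[F]) - 1 ∈ 𝓂[F] ^ (m : ℕ)) : unitChar (twist χ₀ ϖ i) u = 1 := by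
  have hu1 := Ideal.pow_le_self m.ne_zero hu
  rw [unitChar_twist, hilbert_one_unit hu1, one_pow, map_one, map_one, mul_one]
  exact (apply_of_mem_center hχ₀ _ (unitTorusHom_mem_center hu1)).trans
    (hm.1 _ (unitTorusHom_mem_congruenceCover hu))

theorem exists_unitChar_twist_ne_one (ϖ : Fˣ) (i : ℕ) : (m : ℕ) = 1 ∨
    ∃ v : 𝒪[F]ˣ, (v : 𝒪[F]) - 1 ∈ 𝓂[F] ^ ((m : ℕ) - 1) ∧ unitChar (twist χ₀ ϖ i) v ≠ 1 := by
  by_cases h1 : m = 1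
  · exact Or.inl (by rw [h1]; rfl)
  right
  have hlt : 1 < m := lt_of_le_of_ne (_root_.one_le (a := m)) (Ne.symm h1)
  have hnot : ¬ ∀ z : Subgroup.center (torusCover F n),
      ((z : torusCover F n) : MetaSL2 F n) ∈ congruenceCover F n (m - 1) → χ z = 1 :=
    fun h => absurd (hm.2 h) (not_le.2 (IsSmoothFor.pnat_sub_one_lt hlt))
  push Not at hnot
  -- Minimality of `m` gives a central element of `K¹_{m-1}` on which `χ` is not trivial; its upper
  -- left entry is the unit sought.
  obtain ⟨z, ⟨⟨k, hk, hkz⟩, hroot⟩, hz⟩ := hnot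
  have hcoe : ((m - 1 : ℕ+) : ℕ) = (m : ℕ) - 1 := by
    rw [PNat.sub_coe, if_pos hlt]; rfl
  obtain ⟨k00, -, -, k11⟩ := (mem_congruenceKer (I := 𝓂[F] ^ ((m - 1 : ℕ+) : ℕ))).1 hk
  have hkdg : SpecialLinearGroup.map (algebraMap 𝒪[F] F) k = dg (torusCoord F n z) :=
    hkz.trans (dg_torusCoord z.1).symm
  have e00 : ((k 0 0 : 𝒪[F]) : F) = torusCoord F n z :=
    congrArg (fun g : SpecialLinearGroup (Fin 2) F => g 0 0) hkdg
  have e10 : ((k 1 0 : 𝒪[F]) : F) = 0 :=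
    congrArg (fun g : SpecialLinearGroup (Fin 2) F => g 1 0) hkdg
  have e10' : k 1 0 = 0 := Subtype.ext e10
  have hdet := entry_det k
  rw [e10', mul_zero, sub_zero] at hdet
  let v : 𝒪[F]ˣ := ⟨k 0 0, k 1 1, hdet, by rw [mul_comm, hdet]⟩
  have hv : (v : 𝒪[F]) - 1 ∈ 𝓂[F] ^ ((m - 1 : ℕ+) : ℕ) := k00
  refine ⟨v, by rwa [hcoe] at hv, ?_⟩
  have hv1 := Ideal.pow_le_self (m - 1 : ℕ+).ne_zero hv
  rw [unitChar_twist, hilbert_one_unit hv1, one_pow, map_one, map_one, mul_one]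
  have hzv : (unitTorusHom F n (integerUnitsHom F v)).1 = z.1 := by
    rw [eq_torusElt z.1, hroot]
    change torusElt _ 1 = _
    congr 1
    exact Units.ext e00
  have := apply_of_mem_center hχ₀ _ (unitTorusHom_mem_center (n := n) hv1)
  refine fun h => hz (Eq.trans ?_ (this.symm.trans h))
  congr 1
  exact Subtype.ext hzv.symm

end TorusCharacters

end

end KTypes

namespace KTypes

noncomputable section

set_option linter.unusedSectionVars false

/-! ### Irreducible genuine representations of the covering torus -/

section Eigenvector

open Polynomial

/-- Finite dimension is not available, but `T` satisfies `X^N - c^N`. Were every `T - a` with `a^N =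
c^N` injective, so would be their product with multiplicities, which is zero. -/
theorem exists_root_ker {V : Type*} [AddCommGroup V] [Module ℂ V] [Nontrivial V]
    (T : Module.End ℂ V) {N : ℕ} (hN : N ≠ 0) {c : ℂ} (h : ∀ v, (T ^ N) v = c ^ N • v) :
    ∃ (a : ℂ) (v : V), a ^ N = c ^ N ∧ v ≠ 0 ∧ T v = a • v := by
  have hprod := (IsAlgClosed.splits (X ^ N - C (c ^ N) : ℂ[X])).eq_prod_roots_of_monic
    (monic_X_pow_sub_C _ hN)
  have h0 : aeval T (X ^ N - C (c ^ N) : ℂ[X]) = 0 := by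
    ext v
    rw [map_sub, map_pow, aeval_X, aeval_C, LinearMap.sub_apply, h, Module.algebraMap_end_apply,
      sub_self, LinearMap.zero_apply]
  by_contra! hne
  have key : ∀ s : Multiset ℂ, (∀ a ∈ s, a ^ N = c ^ N) →
      Function.Injective (aeval T (s.map fun a => (X - C a : ℂ[X])).prod) := by
    intro s
    induction s using Multiset.induction_on with
    | empty =>
      intro _
      rw [Multiset.map_zero, Multiset.prod_zero, map_one]
      exact Function.injective_id
    | cons a s ih =>
      intro hs
      rw [Multiset.map_cons, Multiset.prod_cons, map_mul, Module.End.coe_mul]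
      refine Function.Injective.comp ?_ (ih fun b hb => hs b (Multiset.mem_cons_of_mem hb))
      rw [← LinearMap.ker_eq_bot, LinearMap.ker_eq_bot']
      intro v hv
      by_contra hv0
      refine hne a v (hs a (Multiset.mem_cons_self a s)) hv0 ?_
      rwa [map_sub, aeval_X, aeval_C, LinearMap.sub_apply, Module.algebraMap_end_apply,
        sub_eq_zero] at hv
  obtain ⟨v, hv⟩ := exists_ne (0 : V)
  have hinj := key (X ^ N - C (c ^ N) : ℂ[X]).roots fun a ha => by
    have := isRoot_of_mem_roots ha
    simpa [sub_eq_zero] using this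
  rw [← hprod, h0] at hinj
  exact hv (hinj rfl)

end Eigenvector

/-- Clifford theory for an irreducible representation of a group generated by an element `x` and a
subgroup `T₀`, itself generated by `τ` and elements acting by scalars, such that `x` permutes the
eigenspaces of `τ` cyclically. -/
theorem exists_basis_of_commutation {T V : Type*} [Group T] [AddCommGroup V] [Module ℂ V]
    [Nontrivial V] {ρ : Representation ℂ T V} (hirr : ρ.IsIrreducible) (T₀ : Subgroup T) (x : T)
    (τ : T₀) {N : ℕ} (hN : N ≠ 0) (η : T →* ℂˣ) (ψ : T₀ →* ℂˣ)
    (hcomm : ∀ t (k : ℤ) v, ρ t (ρ (x ^ k) v) = ((η t ^ (2 * k) : ℂˣ) : ℂ) • ρ (x ^ k) (ρ t v))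
    (hx : ∀ t, ∃ k : ℤ, x ^ (-k) * t ∈ T₀)
    (hxN : ∀ d : ℤ, ∃ r : ℂ, ∀ v, ρ ((x ^ N) ^ d) v = r • v)
    (hτN : ∀ v, ρ ((τ : T) ^ N) v = (ψ τ : ℂ) ^ N • v)
    (hω : IsPrimitiveRoot ((η τ : ℂ) ^ 2) N)
    (hT₀ : ∀ t : T₀, ∃ k : ℕ, ∀ v, ρ (((τ ^ k)⁻¹ * t : T₀) : T) v = (ψ ((τ ^ k)⁻¹ * t) : ℂ) • v) :
    ∃ b : Module.Basis (Fin N) ℂ V, ∀ (j : Fin N) (t : T₀),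
      ρ t (b j) = ((ψ t : ℂ) * (η t : ℂ) ^ (2 * (j : ℕ))) • b j := by
  have happ : ∀ (s t : T) v, ρ (s * t) v = ρ s (ρ t v) := fun s t v => by
    rw [map_mul, Module.End.mul_apply]
  have hinj : ∀ (t : T) v, ρ t v = 0 → v = 0 := fun t v hv => by
    have := congrArg (ρ t⁻¹) hv
    rwa [← happ, inv_mul_cancel, map_one, map_zero, Module.End.one_apply] at this
  have hc0 : (ψ τ : ℂ) ≠ 0 := Units.ne_zero _
  -- An eigenvector of `τ` exists, with an eigenvalue differing from `ψ(τ)` by an `N`-th root of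
  -- unity.
  obtain ⟨a, w, ha, hw0, hw⟩ := exists_root_ker (ρ τ) hN (c := ψ τ) fun v => by
    rw [← map_pow, hτN]
  -- This root of unity is a power of `η(τ)²`. Since `x` shifts eigenvalues of `τ` by that factor,
  -- translating by `x⁻ⁱ` makes the eigenvalue equal to `ψ(τ)`.
  obtain ⟨i, -, hi⟩ : ∃ i < N, ((η τ : ℂ) ^ 2) ^ i = a / ψ τ := by
    have : NeZero N := ⟨hN⟩
    exact hω.eq_pow_of_pow_eq_one (by rw [div_pow, ha, div_self (pow_ne_zero _ hc0)])
  obtain ⟨v₀, hv₀⟩ : ∃ v₀, v₀ = ρ (x ^ (-(i : ℤ))) w := ⟨_, rfl⟩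
  have hv₀0 : v₀ ≠ 0 := fun h => hw0 (hinj _ _ (hv₀.symm.trans h))
  have hτv₀ : ρ τ v₀ = (ψ τ : ℂ) • v₀ := by
    rw [hv₀, hcomm, hw, map_smul, smul_smul]
    congr 1
    rw [← (eq_div_iff hc0).1 hi, ← mul_assoc, mul_neg, zpow_neg, zpow_mul, zpow_natCast,
      Units.val_inv_eq_inv_val, Units.val_pow_eq_pow_val]
    have : (((η τ) ^ (2 : ℤ) : ℂˣ) : ℂ) = (η τ : ℂ) ^ 2 := by
      rw [← Units.val_pow_eq_pow_val, ← zpow_natCast]; rfl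
    rw [this, inv_mul_cancel₀, one_mul]
    exact pow_ne_zero _ (pow_ne_zero _ (Units.ne_zero _))
  have hpow : ∀ k : ℕ, ρ ((τ ^ k : T₀) : T) v₀ = (ψ τ : ℂ) ^ k • v₀ := by
    intro k
    induction k with
    | zero => simp
    | succ k ih => rw [pow_succ', Subgroup.coe_mul, happ, ih, map_smul, hτv₀, smul_smul, pow_succ]
  have hUv₀ : ∀ t : T₀, ρ t v₀ = (ψ t : ℂ) • v₀ := by
    intro t
    obtain ⟨k, hk⟩ := hT₀ t
    obtain ⟨z, hz⟩ : ∃ z, z = (τ ^ k)⁻¹ * t := ⟨_, rfl⟩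
    rw [← hz] at hk
    have e : t = τ ^ k * z := by rw [hz, mul_inv_cancel_left]
    rw [e, Subgroup.coe_mul, happ, hk, map_smul, hpow, smul_smul, map_mul, map_pow, Units.val_mul,
      Units.val_pow_eq_pow_val, mul_comm]
  have hvk : ∀ (k : ℤ) (t : T₀),
      ρ t (ρ (x ^ k) v₀) = (((η t ^ (2 * k) : ℂˣ) : ℂ) * ψ t) • ρ (x ^ k) v₀ := by
    intro k t
    rw [hcomm, hUv₀ t, map_smul, smul_smul]
  let b : Fin N → V := fun j => ρ (x ^ (j : ℤ)) v₀
  have hb0 : ∀ j, b j ≠ 0 := fun j h => hv₀0 (hinj _ _ h)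
  have hb : ∀ (j : Fin N) (t : T₀), ρ t (b j) = ((ψ t : ℂ) * (η t : ℂ) ^ (2 * (j : ℕ))) • b j := by
    intro j t
    rw [hvk (j : ℤ) t, mul_comm, ← Units.val_pow_eq_pow_val, ← zpow_natCast]
    push_cast; rfl
  -- The vectors have distinct eigenvalues under `τ`, as `η(τ)²` is a primitive `N`-th root of
  -- unity.
  have hli : LinearIndependent ℂ b := by
    refine Module.End.eigenvectors_linearIndependent' (ρ τ)
      (fun j : Fin N => (ψ τ : ℂ) * (η τ : ℂ) ^ (2 * (j : ℕ))) ?_ b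
      fun j => ⟨Module.End.mem_eigenspace_iff.2 (hb j τ), hb0 j⟩
    intro j k hjk
    have := mul_left_cancel₀ hc0 hjk
    rw [pow_mul, pow_mul] at this
    exact Fin.ext (hω.pow_inj j.2 k.2 this)
  have hspan : ⊤ ≤ Submodule.span ℂ (Set.range b) := by
    -- Powers of `x^N` act by scalars, so only the exponent modulo `N` matters.
    have hmem : ∀ k : ℤ, ρ (x ^ k) v₀ ∈ Submodule.span ℂ (Set.range b) := by
      intro k
      have hN' : (0 : ℤ) < N := by omega
      have e : x ^ k = (x ^ N) ^ (k / N) * x ^ (k % N) := by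
        rw [← zpow_natCast x N, ← zpow_mul, ← zpow_add, Int.mul_ediv_add_emod]
      obtain ⟨r, hr⟩ := Int.eq_ofNat_of_zero_le (Int.emod_nonneg k hN'.ne')
      have hrN : r < N := by have := Int.emod_lt_of_pos k hN'; omega
      obtain ⟨y, hy⟩ := hxN (k / N)
      rw [e, happ, hr, hy]
      exact Submodule.smul_mem _ _ (Submodule.subset_span ⟨⟨r, hrN⟩, rfl⟩)
    have hle : ∀ t, Submodule.span ℂ (Set.range b) ≤
        (Submodule.span ℂ (Set.range b)).comap (ρ t) := by
      intro t
      rw [Submodule.span_le]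
      rintro _ ⟨j, rfl⟩
      obtain ⟨k, hk⟩ := hx t
      have e : t = x ^ k * (x ^ (-k) * t) := by rw [zpow_neg, mul_inv_cancel_left]
      change ρ t (ρ (x ^ (j : ℤ)) v₀) ∈ Submodule.span ℂ (Set.range b)
      rw [e, happ, hvk _ ⟨_, hk⟩, map_smul, ← happ, ← zpow_add]
      exact Submodule.smul_mem _ _ (hmem _)
    let S : Subrepresentation ρ :=
      { toSubmodule := Submodule.span ℂ (Set.range b)
        apply_mem_toSubmodule := fun t v hv => hle t hv }
    have hS : S ≠ ⊥ := fun h => by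
      have h1 : v₀ ∈ S := by
        have := hmem 0
        rwa [zpow_zero, map_one, Module.End.one_apply] at this
      rw [h] at h1
      exact hv₀0 ((Submodule.mem_bot ℂ).1 h1)
    have := (hirr.eq_bot_or_eq_top S).resolve_left hS
    exact (congrArg Subrepresentation.toSubmodule this).ge
  refine ⟨Module.Basis.mk hli hspan, fun j t => ?_⟩
  rw [Module.Basis.mk_apply]
  exact hb j t

theorem underline_ne_zero {n : ℕ} (hn : 2 ≤ n) : underline n ≠ 0 := by
  unfold underline; split_ifs <;> omega

theorem dvd_two_mul_underline (n : ℕ) : n ∣ 2 * underline n := by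
  unfold underline
  split_ifs with h
  · exact dvd_mul_left _ _
  · rw [Nat.not_odd_iff_even] at h
    rw [Nat.mul_div_cancel' h.two_dvd]

/-- Together with `dvd_two_mul_underline`, this says that the square of a primitive `n`-th root of
unity has order exactly `n̲`. -/
theorem underline_dvd {n k : ℕ} (hn : 2 ≤ n) (h : n ∣ 2 * k) : underline n ∣ k := by
  unfold underline
  split_ifs with ho
  · exact (Nat.Coprime.dvd_of_dvd_mul_left (Nat.coprime_two_right.2 ho) h)
  · rw [Nat.not_odd_iff_even] at ho
    obtain ⟨r, rfl⟩ := ho.two_dvd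
    rw [Nat.mul_div_cancel_left _ two_pos]
    exact Nat.dvd_of_mul_dvd_mul_left two_pos h

/-! ### Eigenvectors of the compact part of the torus in a genuine irreducible representation -/

section TorusRepresentation

open Matrix

variable {F : Type*} [Field F] [ValuativeRel F] [TopologicalSpace F] [IsNonarchimedeanLocalField F]
variable {n : ℕ} [Fact (n ∣ Nat.card 𝓀[F] - 1)]
variable {V : Type*} [AddCommGroup V] [Module ℂ V] {ρ : Representation ℂ (torusCover F n) V}

theorem mem_centA_of_val {t : torusCover F n} (ht : val (torusCoord F n t) = 0) :
    t ∈ centA F n :=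
  mem_centA_of_compact t (by
    change t.1.base ∈ maxCompact F
    rw [← dg_torusCoord]
    exact dg_mem_maxCompact ⟨_, mem_integerUnits.2 ht⟩)

theorem twist_of_val (χ₀ : centA F n →* ℂˣ) (ϖ : Fˣ) (i : ℕ) {t : torusCover F n}
    (ht : val (torusCoord F n t) = 0) (hA : t ∈ centA F n) :
    twist χ₀ ϖ i ⟨t, hA⟩ = χ₀ ⟨t, hA⟩ *
      χ₀ (inclA F n (hilbert n ϖ (torusCoord F n t) ^ (2 * i))) := by
  change χ₀ _ * χ₀ (inclA F n (hilbert n ϖ (torusCoord F n t * ϖ ^ (-val (torusCoord F n t))) ^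
    (2 * i))) = _
  rw [ht, neg_zero, _root_.zpow_zero, mul_one]

/-- Commutators in `T̃¹` are squares of symbols, and `n` divides `2n̲`. -/
theorem pow_mem_center (x : torusCover F n) : x ^ underline n ∈ Subgroup.center (torusCover F n) :=
  mem_center_of_hilbert fun t => by
    rw [map_pow, map_pow, ← pow_mul, mul_comm]
    obtain ⟨d, hd⟩ := dvd_two_mul_underline n
    have h1 : hilbert n t (torusCoord F n x) ^ n = 1 := Subtype.ext (hilbert n t _).2
    rw [hd, pow_mul, h1, one_pow]

/-- A genuine irreducible representation of the torus has a basis of eigenvectors for the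
characters `χᵢ`. -/
theorem exists_basis_twist (hn : 2 ≤ n) {ϖ : Fˣ} (hϖ : val ϖ = 1)
    {ε : rootsOfUnity n 𝓀[F] →* ℂˣ} (hε : Function.Injective ε) (hirr : ρ.IsIrreducible)
    (hgen : ∀ ζ v, ρ (inclTorus F n ζ) v = (ε ζ : ℂ) • v)
    {χ : Subgroup.center (torusCover F n) →* ℂˣ}
    (hχ : ∀ (z : Subgroup.center (torusCover F n)) (v : V),
      ρ (z : torusCover F n) v = (χ z : ℂ) • v)
    {χ₀ : centA F n →* ℂˣ} (hχ₀ : χ₀.comp (Subgroup.inclusion center_le_centA) = χ)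
    (h₀ : ∀ ζ, χ₀ (inclA F n ζ) = ε ζ) [Nontrivial V] :
    ∃ b : Module.Basis (Fin (underline n)) ℂ V, ∀ (i : Fin (underline n)) (t : torusCover F n)
      (ht : val (torusCoord F n t) = 0),
      ρ t (b i) = (twist χ₀ ϖ i ⟨t, mem_centA_of_val ht⟩ : ℂ) • b i := by
  obtain ⟨u, hu, hu'⟩ := exists_generator F
  have ho := orderOf_hilbert (n := n) hϖ hu'
  -- The subgroup is `T̃¹ ∩ K̃¹`. Below, `τ` lies over a unit generating the residue field and `x`
  -- over the uniformizer.
  let T₀ : Subgroup (torusCover F n) := (integerUnits F).comap (torusCoord F n)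
  have hT₀ : ∀ t ∈ T₀, val (torusCoord F n t) = 0 := fun _ h => h
  let τ : T₀ := ⟨torusElt (integerUnitsHom F u : integerUnits F) 1, by
    change torusCoord F n _ ∈ integerUnits F
    rw [torusCoord_torusElt]
    exact (integerUnitsHom F u).2⟩
  have hτ : torusCoord F n τ = (integerUnitsHom F u : integerUnits F) := torusCoord_torusElt _ _
  let x : torusCover F n := torusElt ϖ 1
  have hxc : torusCoord F n x = ϖ := torusCoord_torusElt _ _
  -- Commuting `t` past `x` produces the square of this character at `t`, which is the twist
  -- relating `χᵢ` and `χᵢ₊₁` on units.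
  let η : torusCover F n →* ℂˣ := ε.comp ((hilbert n ϖ).comp (torusCoord F n))
  let ψ : T₀ →* ℂˣ := χ₀.comp (Subgroup.inclusion fun t ht => mem_centA_of_val (hT₀ t ht))
  have hψ : ∀ (t : T₀) (ht : (t : torusCover F n) ∈ Subgroup.center (torusCover F n)) (v : V),
      ρ t v = (ψ t : ℂ) • v := fun t ht v =>
    (hχ ⟨t, ht⟩ v).trans (by rw [← apply_of_mem_center hχ₀ ⟨t, mem_centA_of_val (hT₀ t t.2)⟩ ht]; rfl)
  suffices h : ∃ b : Module.Basis (Fin (underline n)) ℂ V, ∀ (j : Fin (underline n)) (t : T₀),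
      ρ t (b j) = ((ψ t : ℂ) * (η t : ℂ) ^ (2 * (j : ℕ))) • b j by
    obtain ⟨b, hb⟩ := h
    refine ⟨b, fun i t ht => ?_⟩
    rw [hb i ⟨t, ht⟩, twist_of_val _ _ _ ht, h₀, Units.val_mul, map_pow, Units.val_pow_eq_pow_val]
    rfl
  refine exists_basis_of_commutation hirr T₀ x τ (underline_ne_zero hn) η ψ
    (fun t k v => ?_) (fun t => ⟨val (torusCoord F n t), ?_⟩)
    (fun d => ⟨_, hχ ⟨_, zpow_mem (pow_mem_center x) d⟩⟩) (fun v => ?_) ?_ fun t => ?_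
  · rw [← Module.End.mul_apply, ← map_mul, torus_mul_comm, map_mul, Module.End.mul_apply, hgen,
      map_smul, map_mul, Module.End.mul_apply]
    have e : ε (hilbert n (torusCoord F n (x ^ k)) (torusCoord F n t) ^ 2) = η t ^ (2 * k) := by
      rw [map_zpow, hxc, map_zpow, MonoidHom.zpow_apply, ← _root_.zpow_natCast,
        ← _root_.zpow_mul, map_zpow, mul_comm]
      rfl
    rw [e]
  · change val (torusCoord F n _) = 0
    rw [map_mul, map_zpow, hxc, val_mul, val_zpow, hϖ, mul_one, neg_add_cancel]
  · rw [← Units.val_pow_eq_pow_val, ← map_pow ψ]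
    exact hψ (τ ^ underline n) (pow_mem_center _) v
  · have h1 : IsPrimitiveRoot (hilbert n ϖ (integerUnitsHom F u : integerUnits F)) n := by
      have := IsPrimitiveRoot.orderOf (hilbert n ϖ (integerUnitsHom F u : integerUnits F))
      rwa [ho] at this
    have h2 : IsPrimitiveRoot (η τ : ℂ) n := by
      have := (h1.map_of_injective hε).map_of_injective (f := Units.coeHom ℂ) Units.val_injective
      rw [← hτ] at this
      exact this
    refine ⟨?_, fun k hk => ?_⟩
    · rw [← pow_mul]
      exact (h2.pow_eq_one_iff_dvd _).2 (dvd_two_mul_underline n)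
    · rw [← pow_mul] at hk
      exact underline_dvd hn ((h2.pow_eq_one_iff_dvd _).1 hk)
  -- After division by a power of the generator, the unit lies in `1 + 𝔭`, whose lifts are central
  -- and so act by scalars.
  · obtain ⟨v, hv⟩ := integerUnitsHom_surjective ⟨torusCoord F n t, t.2⟩
    obtain ⟨k, hk⟩ := hu v
    refine ⟨k, hψ _ (mem_center_of_hilbert fun s => ?_)⟩
    have : torusCoord F n (((τ ^ k)⁻¹ * t : T₀) : torusCover F n) =
        (integerUnitsHom F (v * (u ^ k)⁻¹) : integerUnits F) := by
      rw [Subgroup.coe_mul, Subgroup.coe_inv, Subgroup.coe_pow, map_mul, map_inv, map_pow, hτ,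
        map_mul, hv, map_inv, map_pow, mul_comm]
      rfl
    rw [this, hilbert_one_unit hk, one_pow]

end TorusRepresentation

end

end KTypes

namespace KTypes

noncomputable section

set_option linter.unusedSectionVars false

/-! ### Isomorphisms of direct sums of representations -/

section Equivalences

variable {Γ : Type*} [Group Γ]

/-- Products of equivalent representations are equivalent. -/
def prodEquiv {X₁ X₂ Y₁ Y₂ : Type*} [AddCommMonoid X₁] [Module ℂ X₁] [AddCommMonoid X₂] [Module ℂ X₂]
    [AddCommMonoid Y₁] [Module ℂ Y₁] [AddCommMonoid Y₂] [Module ℂ Y₂]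
    {π₁ : Representation ℂ Γ X₁} {π₂ : Representation ℂ Γ X₂} {τ₁ : Representation ℂ Γ Y₁}
    {τ₂ : Representation ℂ Γ Y₂} (e₁ : Representation.Equiv π₁ τ₁)
    (e₂ : Representation.Equiv π₂ τ₂) : Representation.Equiv (π₁.prod π₂) (τ₁.prod τ₂) :=
  Representation.Equiv.mk (e₁.toLinearEquiv.prodCongr e₂.toLinearEquiv) fun g =>
    LinearMap.ext fun x => Prod.ext (LinearMap.congr_fun (e₁.isIntertwining' g) x.1)
      (LinearMap.congr_fun (e₂.isIntertwining' g) x.2)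

/-- Direct sums of equivalent representations are equivalent. -/
def directSumEquiv {J : Type*} [DecidableEq J] {X Y : J → Type*} [∀ j, AddCommMonoid (X j)]
    [∀ j, Module ℂ (X j)] [∀ j, AddCommMonoid (Y j)] [∀ j, Module ℂ (Y j)]
    {π : ∀ j, Representation ℂ Γ (X j)} {τ : ∀ j, Representation ℂ Γ (Y j)}
    (e : ∀ j, Representation.Equiv (π j) (τ j)) :
    Representation.Equiv (Representation.directSum π) (Representation.directSum τ) :=
  Representation.Equiv.mk (DFinsupp.mapRange.linearEquiv fun j => (e j).toLinearEquiv) fun g =>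
    LinearMap.ext fun x => DFinsupp.ext fun j => LinearMap.congr_fun ((e j).isIntertwining' g) (x j)

/-- A representation is the product of two complementary subrepresentations. -/
def equivProdOfIsCompl {X : Type*} [AddCommGroup X] [Module ℂ X] {π : Representation ℂ Γ X}
    {P Q : Subrepresentation π} (h : IsCompl P.toSubmodule Q.toSubmodule) :
    Representation.Equiv (P.toRepresentation.prod Q.toRepresentation) π :=
  Representation.Equiv.mk (Submodule.prodEquivOfIsCompl _ _ h) fun g => LinearMap.ext fun x => by
    change (P.toRepresentation g x.1 : X) + (Q.toRepresentation g x.2 : X) = π g (x.1 + x.2)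
    rw [map_add]; rfl

theorem isCompl_toSubmodule {X : Type*} [AddCommGroup X] [Module ℂ X] {π : Representation ℂ Γ X}
    {P Q : Subrepresentation π} (h : IsCompl P Q) : IsCompl P.toSubmodule Q.toSubmodule := by
  constructor
  · rw [Submodule.disjoint_def]
    intro x hP hQ
    have h1 : x ∈ P ⊓ Q := ⟨hP, hQ⟩
    rw [h.inf_eq_bot] at h1
    exact h1
  · rw [codisjoint_iff]
    exact congrArg Subrepresentation.toSubmodule h.sup_eq_top

end Equivalences

/-! ### The restriction of the principal series -/

section Mackey

open Matrix

variable {F : Type*} [Field F] [ValuativeRel F] [TopologicalSpace F] [IsNonarchimedeanLocalField F]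
variable {n : ℕ} [Fact (n ∣ Nat.card 𝓀[F] - 1)]

/-- The lower left entry is cleared by a lower unipotent if it is not larger than the lower right
one. Otherwise an integral upper unipotent combined with the Weyl element serves. -/
theorem exists_mem_maxCompact (g : SpecialLinearGroup (Fin 2) F) :
    ∃ k ∈ maxCompact F, (g * k⁻¹) 1 0 = 0 := by
  have hdet := entry_det g
  rcases le_or_gt (valuation F (g 1 0)) (valuation F (g 1 1)) with h | h
  · have hd : g 1 1 ≠ 0 := by
      intro h0
      rw [h0, map_zero, le_zero_iff, map_eq_zero] at h
      rw [h0, h] at hdet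
      simp at hdet
    refine ⟨lowerElt (g 1 0 / g 1 1), ?_, ?_⟩
    · rw [mem_maxCompact_iff]
      intro i j
      fin_cases i <;> fin_cases j
      · simp
      · simp
      · simp only [Fin.mk_one, Fin.zero_eta, lowerElt_10, map_div₀]
        exact div_le_one_of_le₀ h zero_le
      · simp
    · rw [entry_mul, SpecialLinearGroup.SL2_inv_expl]
      simp
      field_simp
      ring
  · have hc : g 1 0 ≠ 0 := by
      intro h0
      rw [h0, map_zero] at h
      exact not_lt_zero h
    refine ⟨weylElt F * borelElt 1 (g 1 1 / g 1 0), ?_, ?_⟩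
    · rw [mem_maxCompact_iff]
      intro i j
      fin_cases i <;> fin_cases j <;> rw [entry_mul]
      · simp [weylElt]
      · simp [weylElt]
      · simp [weylElt]
      · simp only [Fin.mk_one, weylElt]
        simpa using div_le_one_of_le₀ h.le zero_le
    · rw [_root_.mul_inv_rev, entry_mul, entry_mul, entry_mul]
      rw [SpecialLinearGroup.SL2_inv_expl, SpecialLinearGroup.SL2_inv_expl]
      simp [weylElt]
      field_simp
      ring

/-- The Iwasawa decomposition. -/
theorem exists_borel_mul_compact (g : MetaSL2 F n) :
    ∃ (b : borelCover F n) (k : compactCover F n), g = b * k := by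
  obtain ⟨k, hk, h⟩ := exists_mem_maxCompact g.base
  exact ⟨⟨g * (⟨k, 1⟩ : MetaSL2 F n)⁻¹, h⟩, ⟨⟨k, 1⟩, hk⟩, by simp⟩

variable {V : Type*} [AddCommGroup V] [Module ℂ V] (ρ : Representation ℂ (torusCover F n) V)
  {N : ℕ} (b : Module.Basis (Fin N) ℂ V) (γ : Fin N → centA F n →* ℂˣ)

/-- The action is diagonal in the basis, so each coordinate of a vector-valued function transforms
by a character. The components of the principal series therefore lie in the `charInd (γ i)`. -/
theorem repr_apply_of_eigen (hb : ∀ (i : Fin N) (t : torusCover F n)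
      (ht : val (torusCoord F n t) = 0), ρ t (b i) = (γ i ⟨t, mem_centA_of_val ht⟩ : ℂ) • b i)
    (t : torusCover F n) (ht : val (torusCoord F n t) = 0) (v : V) (i : Fin N) :
    b.repr (ρ t v) i = γ i ⟨t, mem_centA_of_val ht⟩ * b.repr v i := by
  have : b.coord i ∘ₗ ρ t = (γ i ⟨t, mem_centA_of_val ht⟩ : ℂ) • b.coord i := by
    refine b.ext fun j => ?_
    rw [LinearMap.comp_apply, hb j t ht, map_smul, LinearMap.smul_apply, Module.Basis.coord_apply,
      Module.Basis.repr_self]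
    by_cases hij : j = i
    · rw [hij]
    · rw [Finsupp.single_eq_of_ne' hij, smul_zero, smul_zero]
  exact LinearMap.congr_fun this v

/-- The space of the representation induced from the character `γ` of `A`. -/
abbrev CharIndSpace (γ : centA F n →* ℂˣ) :=
  SmoothIndSpace ((borelCover F n).subgroupOf (compactCover F n)) (charRep (inflate γ))

variable (hb : ∀ (i : Fin N) (t : torusCover F n) (ht : val (torusCoord F n t) = 0),
  ρ t (b i) = (γ i ⟨t, mem_centA_of_val ht⟩ : ℂ) • b i)

theorem val_torusProj (x : (borelCover F n).subgroupOf (compactCover F n)) :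
    val (torusCoord F n (torusProj ⟨x.1.1, x.2⟩)) = 0 :=
  torusCoord_unit _ (by
    have hx : x.1.1.base ∈ maxCompact F := x.1.2
    have h0 : x.1.1.base 1 0 = 0 := x.2
    have hv := kubotaX_unit hx (Or.inl h0)
    exact dg_mem_maxCompact ⟨(kubotaX x.1.1.base)⁻¹, by rw [mem_integerUnits, val_inv, hv]; rfl⟩)

theorem inflate_eq (γ : centA F n →* ℂˣ) (x : (borelCover F n).subgroupOf (compactCover F n)) :
    inflate γ x = γ ⟨torusProj ⟨x.1.1, x.2⟩, mem_centA_of_val (val_torusProj x)⟩ := rfl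

/-- The components of an element of the principal series, as functions on `K̃¹`. -/
def component (i : Fin N) : SmoothIndSpace (borelCover F n) (ρ.comp torusProj) →ₗ[ℂ]
    CharIndSpace (γ i) where
  toFun f := indMk (fun k : compactCover F n => b.repr (indFun f k) i)
    (fun x k => by
      have := indFun_mul_left f ⟨x.1.1, x.2⟩ k
      rw [charRep_apply, inflate_eq, ← repr_apply_of_eigen ρ b γ hb _ (val_torusProj x)]
      exact congrArg (fun v => b.repr v i) this)
    (by
      rw [eventually_nhds_one_subgroup]
      obtain ⟨j, hj⟩ := eventually_nhds_one.1 (indFun_smooth f)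
      exact ⟨j, fun g hg x => by
        have := hj g hg x
        exact congrArg (fun v => b.repr v i) this⟩)
  map_add' f f' := indFun_ext fun k => by
    change b.repr (indFun f k + indFun f' k) i = b.repr (indFun f k) i + b.repr (indFun f' k) i
    rw [map_add]; rfl
  map_smul' c f := indFun_ext fun k => by
    change b.repr (c • indFun f k) i = c • b.repr (indFun f k) i
    rw [map_smul]; rfl

theorem indFun_component (i : Fin N) (f : SmoothIndSpace (borelCover F n) (ρ.comp torusProj))
    (k : compactCover F n) :
    indFun (component ρ b γ hb i f) k = b.repr (indFun f k) i := rfl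

/-- By the Iwasawa decomposition, an element of the principal series is determined by its
restriction to `K̃¹`. -/
theorem component_injective : Function.Injective (LinearMap.pi fun i => component ρ b γ hb i) := by
  rw [← LinearMap.ker_eq_bot, LinearMap.ker_eq_bot']
  intro f hf
  refine indFun_ext fun g => ?_
  obtain ⟨x, k, rfl⟩ := exists_borel_mul_compact g
  have h : indFun f k = 0 := by
    apply b.repr.injective
    ext i
    rw [map_zero, ← indFun_component ρ b γ hb, Finsupp.zero_apply]
    exact congrArg (fun f => indFun f k) (congrFun hf i)
  rw [indFun_mul_left, h, map_zero]; rfl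

/-- The function on the covering group with given components. -/
def assemble (φ : ∀ i, CharIndSpace (γ i)) (g : MetaSL2 F n) : V :=
  ρ (torusProj (exists_borel_mul_compact g).choose)
    (∑ i, indFun (φ i) (exists_borel_mul_compact g).choose_spec.choose • b i)

include hb in
-- `assemble` uses a chosen Iwasawa decomposition. Two decompositions differ by an element of `B̃¹ ∩
-- K̃¹`, which multiplies both the component `φ i` and the basis vector `b i` by the value of `γ i`,
-- so the result is independent of the choice.
theorem assemble_mul (φ : ∀ i, CharIndSpace (γ i)) (x : borelCover F n) (k : compactCover F n) :
    assemble ρ b γ φ (x * k) = ρ (torusProj x) (∑ i, indFun (φ i) k • b i) := by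
  suffices key : ∀ (x' : borelCover F n) (k' : compactCover F n), (x * k : MetaSL2 F n) = x' * k' →
      ρ (torusProj x') (∑ i, indFun (φ i) k' • b i) =
        ρ (torusProj x) (∑ i, indFun (φ i) k • b i) from
    key _ _ (exists_borel_mul_compact (x * k : MetaSL2 F n)).choose_spec.choose_spec
  intro x' k' h
  have e : (k' : MetaSL2 F n) * (k : MetaSL2 F n)⁻¹ = (x' : MetaSL2 F n)⁻¹ * x := by
    rw [eq_inv_mul_iff_mul_eq, ← mul_assoc, ← h, mul_inv_cancel_right]
  have hy : k' * k⁻¹ ∈ (borelCover F n).subgroupOf (compactCover F n) := by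
    rw [Subgroup.mem_subgroupOf, Subgroup.coe_mul, Subgroup.coe_inv, e]
    exact mul_mem (inv_mem x'.2) x.2
  have e1 : (⟨(k' * k⁻¹ : compactCover F n).1, hy⟩ : borelCover F n) = x'⁻¹ * x := Subtype.ext e
  have e2 : torusProj x = torusProj x' * torusProj ⟨(k' * k⁻¹ : compactCover F n).1, hy⟩ := by
    rw [e1, ← map_mul, mul_inv_cancel_left]
  have e3 : ∀ i, indFun (φ i) k' =
      γ i ⟨torusProj ⟨(k' * k⁻¹ : compactCover F n).1, hy⟩,
        mem_centA_of_val (val_torusProj ⟨k' * k⁻¹, hy⟩)⟩ * indFun (φ i) k := fun i => by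
    have := indFun_mul_left (φ i) ⟨k' * k⁻¹, hy⟩ k
    rwa [inv_mul_cancel_right, charRep_apply, inflate_eq] at this
  rw [e2, map_mul, Module.End.mul_apply]
  congr 1
  rw [map_sum]
  refine Finset.sum_congr rfl fun i _ => ?_
  rw [map_smul, hb i _ (val_torusProj ⟨k' * k⁻¹, hy⟩), e3, smul_smul, mul_comm]

theorem component_surjective :
    Function.Surjective (LinearMap.pi fun i => component ρ b γ hb i) := by
  intro φ
  have h1 : ∀ (x : borelCover F n) (g : MetaSL2 F n), assemble ρ b γ φ (x * g) =
      (ρ.comp torusProj) x (assemble ρ b γ φ g) := by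
    intro x g
    obtain ⟨y, k, rfl⟩ := exists_borel_mul_compact g
    have := assemble_mul ρ b γ hb φ (x * y) k
    rw [Subgroup.coe_mul, mul_assoc, map_mul, map_mul, Module.End.mul_apply,
      ← assemble_mul ρ b γ hb] at this
    exact this
  have h2 : ∀ᶠ h in nhds (1 : MetaSL2 F n), ∀ g, assemble ρ b γ φ (g * h) =
      assemble ρ b γ φ g := by
    rw [eventually_nhds_one]
    have hsm : ∀ᶠ h in nhds (1 : compactCover F n), ∀ i k,
        indFun (φ i) (k * h) = indFun (φ i) k :=
      Filter.eventually_all.2 fun i => indFun_smooth (φ i)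
    obtain ⟨j, hj⟩ := eventually_nhds_one_subgroup.1 hsm
    refine ⟨j, fun h hh g => ?_⟩
    obtain ⟨y, k, rfl⟩ := exists_borel_mul_compact g
    have hK : h ∈ compactCover F n := congruence_le j hh.1
    have := assemble_mul ρ b γ hb φ y (k * ⟨h, hK⟩)
    rw [Subgroup.coe_mul, ← mul_assoc] at this
    rw [assemble_mul ρ b γ hb, this]
    congr 1
    exact Finset.sum_congr rfl fun i _ => by rw [hj ⟨h, hK⟩ hh i k]
  refine ⟨indMk _ h1 h2, funext fun i => indFun_ext fun k => ?_⟩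
  rw [LinearMap.pi_apply, indFun_component, indFun_indMk]
  have := assemble_mul ρ b γ hb φ 1 k
  rw [Subgroup.coe_one, one_mul, map_one, map_one, Module.End.one_apply] at this
  rw [this, Module.Basis.repr_sum_self]

include hb in
/-- The restriction of the principal series to `K̃¹`. -/
theorem nonempty_equiv_resPrincipalSeries :
    Nonempty (Representation.Equiv (resPrincipalSeries ρ)
      (Representation.directSum fun i : Fin N => charInd (γ i))) := by
  let e : SmoothIndSpace (borelCover F n) (ρ.comp torusProj) ≃ₗ[ℂ] ∀ i, CharIndSpace (γ i) :=
    LinearEquiv.ofBijective (LinearMap.pi fun i => component ρ b γ hb i)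
      ⟨component_injective ρ b γ hb, component_surjective ρ b γ hb⟩
  refine ⟨Representation.Equiv.mk
    (e.trans (DirectSum.linearEquivFunOnFintype ℂ (Fin N) fun i => CharIndSpace (γ i)).symm)
    fun g => ?_⟩
  refine LinearMap.ext fun f => DFinsupp.ext fun i => ?_
  rfl

end Mackey

end

end KTypes

namespace KTypes

noncomputable section

set_option linter.unusedSectionVars false

/-! ### The exceptional indices -/

/-- If `4 ∤ n`, the divisibility already gives `n̲ ∣ i - k`: either `n` is odd, hence prime to `4`,
or `n = 2r` with `r` odd, hence prime to the remaining factor `2`. Both indices are smaller than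
`n̲`. -/
theorem eq_of_dvd_four_mul {n : ℕ} (hn : 2 ≤ n) (h4 : ¬ 4 ∣ n) {i k : ℕ} (hi : i < underline n)
    (hk : k < underline n) (h : (n : ℤ) ∣ 4 * ((i : ℤ) - k)) : k = i := by
  have h' : (underline n : ℤ) ∣ (i : ℤ) - k := by
    unfold underline
    split_ifs with ho
    · have hc : IsCoprime (n : ℤ) 4 := by
        have : Nat.Coprime n 4 := (Nat.coprime_two_right.2 ho).pow_right 2
        exact_mod_cast this
      exact hc.dvd_of_dvd_mul_left h
    · rw [Nat.not_odd_iff_even] at ho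
      obtain ⟨r, rfl⟩ := ho.two_dvd
      rw [Nat.mul_div_cancel_left _ two_pos]
      have hr : Odd r := by
        rw [← Nat.not_even_iff_odd]
        exact fun he => h4 (by obtain ⟨s, rfl⟩ := he.two_dvd; exact ⟨s, by ring⟩)
      have hc : IsCoprime (r : ℤ) 2 := by exact_mod_cast Nat.coprime_two_right.2 hr
      refine hc.dvd_of_dvd_mul_left ?_
      obtain ⟨d, hd⟩ := h
      exact ⟨d, by push_cast at hd; linarith⟩
  have := Int.eq_zero_of_abs_lt_dvd h' (by rw [abs_lt]; constructor <;> omega)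
  omega

/-- For `n = 4r` the condition is a congruence modulo `r`, and each class modulo `r` has exactly two
members among `0, …, 2r - 1`, at distance `r = n/4`. -/
theorem exists_of_four_dvd {n : ℕ} (hn : 2 ≤ n) (h4 : 4 ∣ n) {i : ℕ} (hi : i < underline n) :
    ∃ k < underline n, 4 * |(i : ℤ) - k| = n ∧
      ∀ j < underline n, (n : ℤ) ∣ 4 * ((i : ℤ) - j) ↔ j = i ∨ j = k := by
  obtain ⟨r, rfl⟩ := h4
  have hu : underline (4 * r) = 2 * r := by
    unfold underline
    rw [if_neg (by rw [Nat.not_odd_iff_even]; exact ⟨2 * r, by ring⟩)]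
    omega
  rw [hu] at hi ⊢
  have hdvd : ∀ z : ℤ, (((4 * r : ℕ) : ℤ) ∣ 4 * z) ↔ (r : ℤ) ∣ z := fun z => by
    push_cast
    exact mul_dvd_mul_iff_left (by norm_num)
  have key : ∀ j < 2 * r, (r : ℤ) ∣ (i : ℤ) - j ↔ j = i ∨ j = i + r ∨ j + r = i := by
    intro j hj
    constructor
    · rintro ⟨d, hd⟩
      have h1 : d < 2 := by
        by_contra hc
        have : (r : ℤ) * 2 ≤ r * d := by gcongr; omega
        omega
      have h2 : -2 < d := by
        by_contra hc
        have : (r : ℤ) * d ≤ r * (-2) := by gcongr; omega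
        omega
      obtain rfl | rfl | rfl : d = -1 ∨ d = 0 ∨ d = 1 := by omega
      all_goals omega
    · rintro (rfl | rfl | h)
      · simp
      · exact ⟨-1, by push_cast; ring⟩
      · exact ⟨1, by omega⟩
  rcases lt_or_ge i r with h | h
  · refine ⟨i + r, by omega, ?_, fun j hj => ?_⟩
    · push_cast
      rw [sub_add_cancel_left, abs_neg, Nat.abs_cast]
    · rw [hdvd, key j hj]; omega
  · refine ⟨i - r, by omega, ?_, fun j hj => ?_⟩
    · push_cast [h]
      rw [sub_sub_cancel, Nat.abs_cast]
    · rw [hdvd, key j hj]; omega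

theorem IsSmoothFor.nonempty_equiv_of_isCompl {Γ X : Type*} [Group Γ] [AddCommGroup X] [Module ℂ X]
    {π : Representation ℂ Γ X} {L : ℕ+ → Subgroup Γ} [∀ j, (L j).Normal] [∀ j, (L j).FiniteIndex]
    (h : IsSmoothFor π L) (m : ℕ+)
    {Wp Wm : (l : {l : ℕ+ // m < l}) → Subrepresentation (fixedQuotient π (L l) (L (l - 1)))}
    (hW : ∀ l, IsCompl (Wp l) (Wm l)) :
    Nonempty (Representation.Equiv π ((onFixed π (L m)).prod
      (Representation.directSum fun l : {l : ℕ+ // m < l} =>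
        (Wp l).toRepresentation.prod (Wm l).toRepresentation))) :=
  (h.nonempty_equiv m).map fun e => e.trans (prodEquiv (Representation.Equiv.refl _)
    (directSumEquiv fun l => (equivProdOfIsCompl (isCompl_toSubmodule (hW l))).symm))

/-- A direct sum of smooth representations whose quotients `π_j^{L l} / π_j^{L (l - 1)}` split for
`l > m` is the direct sum of the `π_j^{L m}` and of the summands of these quotients. -/
theorem exists_directSum_equiv {Γ J X₀ : Type*} [Group Γ] [DecidableEq J] [AddCommMonoid X₀]
    [Module ℂ X₀] {X : J → Type*} [∀ j, AddCommGroup (X j)] [∀ j, Module ℂ (X j)]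
    {π₀ : Representation ℂ Γ X₀} (π : ∀ j, Representation ℂ Γ (X j))
    (L : ℕ+ → Subgroup Γ) [∀ l, (L l).Normal] [∀ l, (L l).FiniteIndex]
    (hπ : ∀ j, IsSmoothFor (π j) L) (m : ℕ+)
    (hW : ∀ j, ∀ l : {l : ℕ+ // m < l}, SplitsInTwo (fixedQuotient (π j) (L l) (L (l - 1))))
    (h₀ : Nonempty (Representation.Equiv π₀ (Representation.directSum π))) :
    ∃ Wp Wm : (j : J) → (l : {l : ℕ+ // m < l}) →
        Subrepresentation (fixedQuotient (π j) (L l) (L (l - 1))),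
      (∀ j l, IsCompl (Wp j l) (Wm j l) ∧ (Wp j l).toRepresentation.IsIrreducible ∧
        (Wm j l).toRepresentation.IsIrreducible) ∧
      Nonempty (Representation.Equiv π₀ (Representation.directSum fun j =>
        (onFixed (π j) (L m)).prod (Representation.directSum fun l : {l : ℕ+ // m < l} =>
          (Wp j l).toRepresentation.prod (Wm j l).toRepresentation))) := by
  choose Wp Wm hc hp hm using hW
  exact ⟨Wp, Wm, fun j l => ⟨hc j l, hp j l, hm j l⟩, h₀.map fun e => e.trans
    (directSumEquiv fun j => ((hπ j).nonempty_equiv_of_isCompl m (hc j)).some)⟩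

end

end KTypes

/-! ### The theorem on `K`-types -/

theorem mainTheorem2 {F : Type*} [Field F] [ValuativeRel F] [TopologicalSpace F]
    [IsNonarchimedeanLocalField F] (hodd : Odd (Nat.card 𝓀[F]))
    (n : ℕ) (hn : 2 ≤ n) [Fact (n ∣ Nat.card 𝓀[F] - 1)]
    (ϖ : Fˣ) (hϖ : KTypes.val ϖ = 1)
    (ε : rootsOfUnity n 𝓀[F] →* ℂˣ) (hε : Function.Injective ε)
    {V : Type*} [AddCommGroup V] [Module ℂ V]
    (ρ : Representation ℂ (KTypes.torusCover F n) V)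
    (hirr : ρ.IsIrreducible) (hsm : KTypes.IsSmooth ρ)
    (hgen : ∀ ζ v, ρ (KTypes.inclTorus F n ζ) v = (ε ζ : ℂ) • v)
    (χ : Subgroup.center (KTypes.torusCover F n) →* ℂˣ)
    (hχ : ∀ (z : Subgroup.center (KTypes.torusCover F n)) (v : V),
      ρ (z : KTypes.torusCover F n) v = (χ z : ℂ) • v)
    (χ₀ : KTypes.centA F n →* ℂˣ)
    (hχ₀ : χ₀.comp (Subgroup.inclusion KTypes.center_le_centA) = χ)
    (m : ℕ+)
    (hm : IsLeast {j : ℕ+ | ∀ z : Subgroup.center (KTypes.torusCover F n),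
      ((z : KTypes.torusCover F n) : KTypes.MetaSL2 F n) ∈ KTypes.congruenceCover F n j →
        χ z = 1} m) :
    (∃ Wp Wm : (i : Fin (KTypes.underline n)) → (l : {l : ℕ+ // m < l}) →
        Subrepresentation (KTypes.levelRep χ₀ ϖ i l),
      (∀ i l, IsCompl (Wp i l) (Wm i l) ∧ (Wp i l).toRepresentation.IsIrreducible ∧
        (Wm i l).toRepresentation.IsIrreducible) ∧
      Nonempty (Representation.Equiv (KTypes.resPrincipalSeries ρ)
        (Representation.directSum fun i : Fin (KTypes.underline n) =>
          (KTypes.fixedRep χ₀ ϖ i m).prod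
            (Representation.directSum fun l : {l : ℕ+ // m < l} =>
              (Wp i l).toRepresentation.prod (Wm i l).toRepresentation)))) ∧
    (¬ (m = 1 ∧ ∃ i : Fin (KTypes.underline n), KTypes.Exceptional χ₀ ε ϖ i) →
      ∀ i : Fin (KTypes.underline n), (KTypes.fixedRep χ₀ ϖ i m).IsIrreducible) ∧
    (m = 1 → (∃ i : Fin (KTypes.underline n), KTypes.Exceptional χ₀ ε ϖ i) → ¬ 4 ∣ n →
      ∃ i : Fin (KTypes.underline n),
      (∀ j : Fin (KTypes.underline n), KTypes.Exceptional χ₀ ε ϖ j ↔ j = i) ∧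
      KTypes.SplitsInTwo (KTypes.fixedRep χ₀ ϖ i m) ∧
      ∀ j : Fin (KTypes.underline n), j ≠ i → (KTypes.fixedRep χ₀ ϖ j m).IsIrreducible) ∧
    (m = 1 → (∃ i : Fin (KTypes.underline n), KTypes.Exceptional χ₀ ε ϖ i) → 4 ∣ n →
      ∃ i k : Fin (KTypes.underline n), 4 * |(i : ℤ) - (k : ℤ)| = n ∧
      (∀ j : Fin (KTypes.underline n), KTypes.Exceptional χ₀ ε ϖ j ↔ j = i ∨ j = k) ∧
      KTypes.SplitsInTwo (KTypes.fixedRep χ₀ ϖ i m) ∧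
      KTypes.SplitsInTwo (KTypes.fixedRep χ₀ ϖ k m) ∧
      ∀ j : Fin (KTypes.underline n), j ≠ i → j ≠ k → (KTypes.fixedRep χ₀ ϖ j m).IsIrreducible) := by
  have hnt : Nontrivial V := by
    by_contra hV
    rw [not_nontrivial_iff_subsingleton] at hV
    obtain ⟨P, Q, hPQ⟩ := hirr.exists_pair_ne
    exact hPQ (SetLike.ext fun v => by
      rw [Subsingleton.elim v 0]
      exact ⟨fun _ => zero_mem Q.toSubmodule, fun _ => zero_mem P.toSubmodule⟩)
  -- The roots of unity are central, so there `χ₀` is the central character, which `hgen` identifies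
  -- with `ε` on a nonzero vector.
  have h₀ : ∀ ζ, χ₀ (KTypes.inclA F n ζ) = ε ζ := fun ζ => by
    obtain ⟨v, hv⟩ := exists_ne (0 : V)
    have h := KTypes.inclTorus_mem_center (F := F) ζ
    rw [KTypes.apply_of_mem_center hχ₀ (KTypes.inclA F n ζ) h]
    exact Units.ext (smul_left_injective ℂ hv ((hχ ⟨_, h⟩ v).symm.trans (hgen ζ v)))
  have hθ := fun i : Fin (KTypes.underline n) => KTypes.unitChar_twist_eq_one hχ₀ hm ϖ (i : ℕ)
  have hprim := fun i : Fin (KTypes.underline n) =>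
    KTypes.exists_unitChar_twist_ne_one hχ₀ hm ϖ (i : ℕ)
  have hirred : ∀ i : Fin (KTypes.underline n), ¬ (m = 1 ∧ KTypes.Exceptional χ₀ ε ϖ i) →
      (KTypes.fixedRep χ₀ ϖ i m).IsIrreducible := fun i hi =>
    KTypes.isIrreducible_onFixed hodd _ m (hθ i) (hprim i) fun ⟨h1, h2⟩ =>
      hi ⟨PNat.coe_eq_one_iff.1 h1, (KTypes.exceptional_iff_sq h₀).2 h2⟩
  have hsplit : ∀ i : Fin (KTypes.underline n), m = 1 → KTypes.Exceptional χ₀ ε ϖ i →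
      KTypes.SplitsInTwo (KTypes.fixedRep χ₀ ϖ i m) := by
    rintro i rfl hi
    exact KTypes.splitsInTwo_onFixed hodd _ (fun u hu => hθ i u (by simpa using hu))
      ((KTypes.exceptional_iff_sq h₀).1 hi)
  have hW : ∀ (i : Fin (KTypes.underline n)) (l : {l : ℕ+ // m < l}),
      KTypes.SplitsInTwo (KTypes.levelRep χ₀ ϖ i l) := fun i l =>
    KTypes.splitsInTwo_fixedQuotient hodd (KTypes.twist χ₀ ϖ i) l.2 (hθ i)
  have h₁ : Nonempty (Representation.Equiv (KTypes.resPrincipalSeries ρ)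
      (Representation.directSum fun i : Fin (KTypes.underline n) =>
        KTypes.compactInd χ₀ ϖ i)) := by
    obtain ⟨b, hb⟩ := KTypes.exists_basis_twist hn hϖ hε hirr hgen hχ hχ₀ h₀
    exact KTypes.nonempty_equiv_resPrincipalSeries ρ b _ hb
  have hfirst := KTypes.exists_directSum_equiv
    (fun i : Fin (KTypes.underline n) => KTypes.compactInd χ₀ ϖ i) (KTypes.congruenceIn F n)
    (fun i => KTypes.isSmoothFor_charInd (KTypes.twist χ₀ ϖ i)) m hW h₁
  refine ⟨?_, fun h i => hirred i fun hi => h ⟨hi.1, i, hi.2⟩, ?_, ?_⟩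
  · exact hfirst
  · rintro h1 ⟨i, hi⟩ h4
    have hiff : ∀ j : Fin (KTypes.underline n), KTypes.Exceptional χ₀ ε ϖ j ↔ j = i := fun j =>
      ⟨fun hj => Fin.ext (KTypes.eq_of_dvd_four_mul hn h4 i.2 j.2
        ((KTypes.exceptional_iff_dvd hϖ hε hi).1 hj)), fun hj => hj ▸ hi⟩
    exact ⟨i, hiff, hsplit i h1 hi, fun j hj => hirred j fun h => hj ((hiff j).1 h.2)⟩
  · rintro h1 ⟨i, hi⟩ h4
    obtain ⟨k, hk, hik, hiff'⟩ := KTypes.exists_of_four_dvd hn h4 i.2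
    have hiff : ∀ j : Fin (KTypes.underline n),
        KTypes.Exceptional χ₀ ε ϖ j ↔ j = i ∨ j = ⟨k, hk⟩ := fun j => by
      rw [KTypes.exceptional_iff_dvd hϖ hε hi, hiff' j j.2, Fin.ext_iff, Fin.ext_iff]
    exact ⟨i, ⟨k, hk⟩, hik, hiff, hsplit i h1 hi, hsplit _ h1 ((hiff _).2 (Or.inr rfl)),
      fun j hj hj' => hirred j fun h => ((hiff j).1 h.2).elim hj hj'⟩
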